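/- **Setting.** Let $d,m\ge 1$ and let $f^0,\dots,f^m:\mathbb R^d\to\mathbb R$ be convex, $\mathcal X=\{x: f^i(x)\le 0,\ i\in[m]\}$. Assume that $\|x-y\|\le R$ for all $x,y\in\mathcal X$, that each $f^i$ ($0\le i\le m$) is differentiable at the points of $\mathcal X$ and on $\mathcal X$ is $L_i$-Lipschitz and $M_i$-smooth, i.e. $f^i(x)\le f^i(y)+\langle\nabla f^i(y),x-y\rangle+\frac{M_i}{2}\|x-y\|^2$ for $x,y\in\mathcal X$ ($L_i,M_i>0$), and that $x_0$ is a point with $\max_{i\in[m]}f^i(x_0)\le-\beta$, $\beta>0$. Put $L=\max_i L_i$, $M=\max_i M_i$, and let $\hat\beta>0$ satisfy $|f^i|\le\hat\beta$ on $\mathcal X$ for $i\in[m]$. For $0<\eta\le\beta/2$ let $B_\eta(x)=f^0(x)-\eta\sum_{i=1}^m\log(-f^i(x))$ on $\{f^i<0,\ i\in[m]\}$ and let $x^*_\eta$ be a minimizer of $B_\eta$. **Oracle.** A query at $x$ returns, for all $i$, $F^i(x,\xi)\in\mathbb R$ and $G^i(x,\xi)\in\mathbb R^d$, with i.i.d.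 samples $\xi$. For $x\in\mathcal X$: $\mathbb E F^i(x,\xi)=f^i(x)$, $\|\mathbb E G^i(x,\xi)-\nabla f^i(x)\|\le\hat b_i$, $\mathbb E\|G^i(x,\xi)-\mathbb E G^i(x,\xi)\|^2\le\hat\sigma_i^2$, and for all $\delta'\in(0,1)$, $|F^i(x,\xi)-f^i(x)|\le\sigma_i\sqrt{\ln(1/\delta')}$ with probability at least $1-\delta'$ and $\|G^i(x,\xi)-\mathbb E G^i(x,\xi)\|\le\hat\sigma_i\sqrt{\ln(1/\delta')}$ with probability at least $1-\delta'$. Write $F^i_n,G^i_n$ for averages over $n$ samples, and $\sigma_i(n)=\sigma_i/\sqrt n$, $\hat\sigma_i(n)=\hat\sigma_i/\sqrt n$. **LB-SGD** with confidence parameter $\delta$: put $x_1=x_0$; for $t=1,\dots,T$ take a fresh batch of $n$ samples at $x_t$ and put $$g_t=G^0_n+\eta\sum_{i=1}^m\frac{G^i_n}{-F^i_n},\qquad \underline\alpha^i_t=-F^i_n-\sigma_i(n)\sqrt{\ln\tfrac1\delta},\qquad \hat\theta^i_t=\Big|\Big\langle G^i_n,\frac{g_t}{\|g_t\|}\Big\rangle\Big|+\hat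 b_i+\hat\sigma_i(n)\sqrt{\ln\tfrac1\delta},$$ $$\hat M_2(x_t)=M_0+10\eta\sum_{i=1}^m\frac{M_i}{\underline\alpha^i_t}+8\eta\sum_{i=1}^m\frac{(\hat\theta^i_t)^2}{(\underline\alpha^i_t)^2},\qquad \gamma_t=\min\Big\{\min_{i\in[m]}\frac{\underline\alpha^i_t}{2|\hat\theta^i_t|+\sqrt{\underline\alpha^i_tM_i}}\cdot\frac1{\|g_t\|},\ \frac1{\hat M_2(x_t)}\Big\},$$ $x_{t+1}=x_t-\gamma_tg_t$ (if $g_t=0$, read $g_t/\|g_t\|$ as $0$ and $\gamma_t=1/\hat M_2(x_t)$). The output is $\bar x_T=\sum_{t=1}^T\gamma_tx_t\big/\sum_{t=1}^T\gamma_t$. **Constants.** For any $\rho\in[\eta,\beta/2]$ let $l=\frac{\beta-\rho}{R}$, $c=\frac12\big(\frac{l}{4L(2m+1)}\big)^m$ and $$C=\frac{c}{2L^2(1+\frac mc)}\cdot\frac{1}{\max\{4+\frac{5Mc\eta}{L^2},\,1+\sqrt{\frac{Mc\eta}{4L^2}}\}}.$$ **Theorem.** There is $\kappa>0$ depending only on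 $m,R,\beta$ and the $L_i,M_i$ such that, whenever $\hat b_i\le\kappa\frac{\eta}{R}$ for $0\le i\le m$, the following holds for every $\hat\delta\in(0,1)$. 1. Let $T\ge1$ be an integer with $T\ge\frac{\|x_0-x^*_\eta\|^2}{C\eta^2}$, let $0<\delta\le\min\{\frac12,\frac{\hat\delta}{mT}\}$, and let $n\ge1$ be such that $\sigma_i(n)\le\kappa\frac{\eta^2}{R\sqrt{\ln(1/\delta)}}$ for $i\in[m]$ and $\hat\sigma_i(n)\le\kappa\frac{\eta}{R\sqrt{\ln(1/\delta)}}$ for $0\le i\le m$. Then with probability at least $1-\hat\delta$ the point $\bar x_T$ satisfies $f^i(\bar x_T)<0$ for all $i\in[m]$, $$B_\eta(\bar x_T)-B_\eta(x^*_\eta)\le\eta\qquad\text{and}\qquad f^0(\bar x_T)-\min_{x\in\mathcal X}f^0(x)\le\varepsilon,\quad \varepsilon=\eta(m+1)+\eta m\log\Big(\frac{2mLR\hat\beta}{\eta\beta}\Big).$$ 2. There are $A,K>0$ depending only on $m,R,\beta$ and the $L_i,M_i,\sigma_i,\hat\sigma_i$ such that for $T=\max\big\{1,\big\lceil\frac{\|x_0-x^*_\eta\|^2}{C\eta^2}\big\rceil\big\}$,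 $\delta=\min\{\frac12,\frac{\hat\delta}{mT}\}$ and $n=\lceil A\ln(1/\delta)/\eta^4\rceil$ samples per iteration, the conclusion of part 1 holds with probability at least $1-\hat\delta$, and the total number of oracle calls is $nT\le K\eta^{-6}\ln\frac{K}{\eta\hat\delta}=\tilde O(\eta^{-6})$. -/

import Mathlib

open MeasureTheory ProbabilityTheory
open scoped RealInnerProductSpace

noncomputable section

namespace LBSGD

/-- The Euclidean space `ℝᵈ`. -/
abbrev Space (d : ℕ) : Type := EuclideanSpace ℝ (Fin d)

/-! The objective is `f 0`, the constraints are `f i.succ` for `i : Fin m`. -/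

/-- The feasible set `{x | f¹(x) ≤ 0, …, fᵐ(x) ≤ 0}`. -/
def feasible {d m : ℕ} (f : Fin (m + 1) → Space d → ℝ) : Set (Space d) :=
  {x | ∀ i : Fin m, f i.succ x ≤ 0}

/-- The set where all constraints are strictly satisfied, i.e. the domain of the log barrier. -/
def strictlyFeasible {d m : ℕ} (f : Fin (m + 1) → Space d → ℝ) : Set (Space d) :=
  {x | ∀ i : Fin m, f i.succ x < 0}

/-- The log barrier `B_η(x) = f⁰(x) - η ∑ᵢ log (-fⁱ(x))` (meaningful on `strictlyFeasible f`). -/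
def logBarrier {d m : ℕ} (f : Fin (m + 1) → Space d → ℝ) (η : ℝ) (x : Space d) : ℝ :=
  f 0 x - η * ∑ i : Fin m, Real.log (-f i.succ x)

/-- `xs` minimizes the log barrier over its domain. -/
def IsBarrierMinimizer {d m : ℕ} (f : Fin (m + 1) → Space d → ℝ) (η : ℝ) (xs : Space d) : Prop :=
  xs ∈ strictlyFeasible f ∧ ∀ y ∈ strictlyFeasible f, logBarrier f η xs ≤ logBarrier f η y

/-- The standing assumptions on the problem: bounded diameter, Lipschitz continuity and smoothness
on the feasible set, a strictly feasible starting point with margin `β`, and convexity. -/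
structure IsConvexProblem {d m : ℕ} (L M : Fin (m + 1) → ℝ) (R β : ℝ)
    (f : Fin (m + 1) → Space d → ℝ) (x₀ : Space d) : Prop where
  diam : ∀ x ∈ feasible f, ∀ y ∈ feasible f, ‖x - y‖ ≤ R
  lipschitz : ∀ i, ∀ x ∈ feasible f, ∀ y ∈ feasible f, |f i x - f i y| ≤ L i * ‖x - y‖
  differentiable : ∀ i, ∀ x ∈ feasible f, DifferentiableAt ℝ (f i) x
  smooth : ∀ i, ∀ x ∈ feasible f, ∀ y ∈ feasible f,
    f i x ≤ f i y + ⟪gradient (f i) y, x - y⟫ + M i / 2 * ‖x - y‖ ^ 2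
  start : ∀ i : Fin m, f i.succ x₀ ≤ -β
  convex : ∀ i, ConvexOn ℝ Set.univ (f i)

/-- `(F, G)` is a stochastic first-order oracle for `f` with samples of law `ν`: the values are
unbiased and sub-Gaussian with parameters `σ`, the gradients have bias at most `b` and are
sub-Gaussian (with variance) with parameters `σg`. -/
structure IsOracle {d m : ℕ} {Ξ : Type*} [MeasurableSpace Ξ] (ν : Measure Ξ)
    (f : Fin (m + 1) → Space d → ℝ)
    (F : Fin (m + 1) → Space d → Ξ → ℝ) (G : Fin (m + 1) → Space d → Ξ → Space d)
    (σ σg b : Fin (m + 1) → ℝ) : Prop where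
  measurable_value : ∀ i, Measurable (Function.uncurry (F i))
  measurable_grad : ∀ i, Measurable (Function.uncurry (G i))
  integrable_value : ∀ i, ∀ x ∈ feasible f, Integrable (F i x) ν
  unbiased_value : ∀ i, ∀ x ∈ feasible f, ∫ ξ, F i x ξ ∂ν = f i x
  tail_value : ∀ i, ∀ x ∈ feasible f, ∀ δ : ℝ, 0 < δ → δ < 1 →
    1 - δ ≤ ν.real {ξ | |F i x ξ - f i x| ≤ σ i * √(Real.log (1 / δ))}
  integrable_grad : ∀ i, ∀ x ∈ feasible f, Integrable (G i x) ν
  bias_grad : ∀ i, ∀ x ∈ feasible f, ‖(∫ ξ, G i x ξ ∂ν) - gradient (f i) x‖ ≤ b i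
  variance_grad : ∀ i, ∀ x ∈ feasible f,
    ∫ ξ, ‖G i x ξ - ∫ ξ', G i x ξ' ∂ν‖ ^ 2 ∂ν ≤ σg i ^ 2
  tail_grad : ∀ i, ∀ x ∈ feasible f, ∀ δ : ℝ, 0 < δ → δ < 1 →
    1 - δ ≤ ν.real {ξ | ‖G i x ξ - ∫ ξ', G i x ξ' ∂ν‖ ≤ σg i * √(Real.log (1 / δ))}

/-- `ξ t j` is the `j`-th sample drawn at iteration `t`; all samples are i.i.d. of law `ν`. -/
structure IsIIDSample {Ω Ξ : Type*} [MeasurableSpace Ω] [MeasurableSpace Ξ] (μ : Measure Ω)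
    (ν : Measure Ξ) (ξ : ℕ → ℕ → Ω → Ξ) : Prop where
  measurable : ∀ t j, Measurable (ξ t j)
  law : ∀ t j, μ.map (ξ t j) = ν
  indep : iIndepFun (fun p : ℕ × ℕ => ξ p.1 p.2) μ

/-- The data LB-SGD is run with: the oracle, the smoothness constants `M`, the noise parameters
`σ`, `σg`, `b`, the barrier parameter `η`, the confidence parameter `δ`, and the batch size `n`. -/
structure Alg (d m : ℕ) (Ξ : Type*) where
  F : Fin (m + 1) → Space d → Ξ → ℝ
  G : Fin (m + 1) → Space d → Ξ → Space d
  M : Fin (m + 1) → ℝ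
  σ : Fin (m + 1) → ℝ
  σg : Fin (m + 1) → ℝ
  b : Fin (m + 1) → ℝ
  η : ℝ
  δ : ℝ
  n : ℕ

namespace Alg

variable {d m : ℕ} {Ξ : Type*} (P : Alg d m Ξ)

/-! In the following, `x` is the current iterate and `s 0, …, s (n-1)` is the current batch. -/

/-- Averaged value measurement `Fⁱₙ`. -/
def Fn (i : Fin (m + 1)) (x : Space d) (s : ℕ → Ξ) : ℝ :=
  (∑ j ∈ Finset.range P.n, P.F i x (s j)) / P.n

/-- Averaged gradient measurement `Gⁱₙ`. -/
def Gn (i : Fin (m + 1)) (x : Space d) (s : ℕ → Ξ) : Space d :=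
  (P.n : ℝ)⁻¹ • ∑ j ∈ Finset.range P.n, P.G i x (s j)

/-- The log barrier gradient estimator `g = G⁰ₙ + η ∑ᵢ Gⁱₙ / (-Fⁱₙ)`. -/
def g (x : Space d) (s : ℕ → Ξ) : Space d :=
  P.Gn 0 x s + P.η • ∑ i : Fin m, (-P.Fn i.succ x s)⁻¹ • P.Gn i.succ x s

/-- Lower confidence bound on `αⁱ = -fⁱ(x)`, with `σᵢ(n) = σᵢ / √n`. -/
def αLow (i : Fin m) (x : Space d) (s : ℕ → Ξ) : ℝ :=
  -P.Fn i.succ x s - P.σ i.succ / √P.n * √(Real.log (1 / P.δ))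

/-- Upper confidence bound on `|⟨∇fⁱ(x), g/‖g‖⟩|`, with `σ̂ᵢ(n) = σ̂ᵢ / √n`. -/
def θHat (i : Fin m) (x : Space d) (s : ℕ → Ξ) : ℝ :=
  |⟪P.Gn i.succ x s, ‖P.g x s‖⁻¹ • P.g x s⟫| + P.b i.succ
    + P.σg i.succ / √P.n * √(Real.log (1 / P.δ))

/-- The estimated local smoothness constant of the log barrier. -/
def M2Hat (x : Space d) (s : ℕ → Ξ) : ℝ :=
  P.M 0 + 10 * P.η * ∑ i : Fin m, P.M i.succ / P.αLow i x s
    + 8 * P.η * ∑ i : Fin m, P.θHat i x s ^ 2 / P.αLow i x s ^ 2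

open Classical in
/-- The adaptive step size `γ`. If `g = 0`, the first term of the minimum, which has the factor
`1 / ‖g‖`, is `+∞`. -/
def γ (x : Space d) (s : ℕ → Ξ) : ℝ :=
  if P.g x s = 0 then 1 / P.M2Hat x s
  else min
    ((⨅ i : Fin m, P.αLow i x s / (2 * |P.θHat i x s| + √(P.αLow i x s * P.M i.succ)))
      * (1 / ‖P.g x s‖))
    (1 / P.M2Hat x s)

/-- The iterates of LB-SGD started at `x₀`, when iteration `t` uses the batch `S t`
(iterations are counted from `0`, so the first one takes place at `x₀`). -/
def iter (x₀ : Space d) (S : ℕ → ℕ → Ξ) : ℕ → Space d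
  | 0 => x₀
  | t + 1 => iter x₀ S t - P.γ (iter x₀ S t) (S t) • P.g (iter x₀ S t) (S t)

/-- The step size used at iteration `t`. -/
def step (x₀ : Space d) (S : ℕ → ℕ → Ξ) (t : ℕ) : ℝ :=
  P.γ (P.iter x₀ S t) (S t)

/-- The output after `T` iterations: the average of the iterates, weighted by the step sizes. -/
def average (x₀ : Space d) (S : ℕ → ℕ → Ξ) (T : ℕ) : Space d :=
  (∑ t ∈ Finset.range T, P.step x₀ S t)⁻¹ •
    ∑ t ∈ Finset.range T, P.step x₀ S t • P.iter x₀ S t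

end Alg

/-- The largest of finitely many constants. -/
def maxConst {m : ℕ} (a : Fin (m + 1) → ℝ) : ℝ :=
  Finset.univ.sup' Finset.univ_nonempty a

/-- `c = ½ (l / (4 L (2m + 1)))ᵐ` with `l = (β - ρ) / R`. -/
def cConst (m : ℕ) (L R β ρ : ℝ) : ℝ :=
  1 / 2 * ((β - ρ) / R / (4 * L * (2 * m + 1))) ^ m

/-- `C = c / (2 L² (1 + m / c)) · 1 / max {4 + 5 M c η / L², 1 + √(M c η / (4 L²))}`. -/
def CConst (m : ℕ) (L M R β ρ η : ℝ) : ℝ :=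
  cConst m L R β ρ / (2 * L ^ 2 * (1 + m / cConst m L R β ρ)) *
    (1 / max (4 + 5 * M * cConst m L R β ρ * η / L ^ 2)
      (1 + √(M * cConst m L R β ρ * η / (4 * L ^ 2))))

/-- The accuracy `ε = η (m + 1) + η m log (2 m L R β̂ / (η β))`. -/
def accuracy (m : ℕ) (L R β βhat η : ℝ) : ℝ :=
  η * (m + 1) + η * m * Real.log (2 * m * L * R * βhat / (η * β))

/-- `x` is an `η`-approximate minimizer of the log barrier (in particular it lies in its domain),
and an `ε`-approximate minimizer of `f⁰` over the feasible set. -/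
def IsGoodPoint {d m : ℕ} (f : Fin (m + 1) → Space d → ℝ) (η ε : ℝ) (xs x : Space d) : Prop :=
  x ∈ strictlyFeasible f ∧ logBarrier f η x - logBarrier f η xs ≤ η ∧
    ∀ y ∈ feasible f, f 0 x - f 0 y ≤ ε

end LBSGD

end

/-!
The theorem combines a safety argument, a convergence argument and a concentration inequality; the
first two are deterministic, given that all measurements are accurate to order `η²` (values) and
`η` (gradients).

*Safety.* A single step leaves at least the fraction `0.48` of each slack `αⁱ = -fⁱ(x)`
(`slack_step`), so the iterates stay in the domain of the barrier, but this alone does not keep the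
slacks of order `η` over many steps. The quantity that is controlled is the family of products
`∏_{i ∈ I} η / αⁱ` over all nonempty sets `I` of constraints, with upper bounds `b_k ^ k` for
`k = |I|`, where `b_k` is proportional to `Λ ^ (m + 1 - k)` for a constant `Λ` (`HasMargin`). If the
product over `I` is close to its bound, then the bound for `I ∪ {j}` makes all constraints outside
of `I` negligible, while convexity and the slack `β` at the starting point make the part of the
barrier gradient that is due to `I` large. The step then moves against that part and does not increase the
product over `I` (`hasMargin_next`). Singletons give `αⁱ ≥ 5 c η` along the whole trajectory.

*Convergence.* The margin bounds the step sizes from below by a multiple of `C η` (`le_step`). The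
curvature estimate in the step size rule overestimates the contribution of the constraints, but
contains the smoothness constant `M₀` of the objective without any safety factor. Hence the
telescoping argument with the squared distance to the minimizer works only as long as
`γ M₀ ≤ 1 / 2`; from the first longer step on, the barrier gap divided by `M₀` is used as an
additional potential (`descent_bounds`, `sum_gap_le`). Jensen's inequality passes to the average.
The claim on `f⁰` follows since `η / αⁱ` are Lagrange multipliers at the minimizer of the barrier
(`minimizer_bounds`).

*Concentration.* Sums of centered random vectors with Gaussian tails are controlled by the
exponential moment `𝔼 cosh ‖·‖`, which, by the Hilbert space inequality `cosh_norm_add_le`, grows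
from one summand to the next by a factor independent of the dimension. Each batch is independent of
the iterate at which it is used, so the bound applies in every iteration that takes place at a
feasible point (`measure_norm_sum_gt_le`, `prob_not_isAccurate_le`), and a union bound over
iterations and measured functions finishes the proof.
-/

noncomputable section

namespace LBSGD

open scoped ENNReal

/-! ### Concentration of sums of vectors with sub-Gaussian norm -/

lemma cosh_sqrt_combo_le {w A B : ℝ} (hw₀ : 0 ≤ w) (hw₁ : w ≤ 1) (hA : 0 ≤ A) (hB : 0 ≤ B) :
    Real.cosh √(w * A + (1 - w) * B) ≤ w * Real.cosh √A + (1 - w) * Real.cosh √B := by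
  have hw₂ : 0 ≤ 1 - w := by linarith
  have key : ∀ s : ℝ, 0 ≤ s →
      HasSum (fun n : ℕ ↦ s ^ n / (Nat.factorial (2 * n) : ℝ)) (Real.cosh √s) := by
    intro s hs
    have h := Real.hasSum_cosh √s
    simpa only [pow_mul, Real.sq_sqrt hs] using h
  refine hasSum_le (fun n ↦ ?_) (key _ (by positivity))
    (((key A hA).mul_left w).add ((key B hB).mul_left (1 - w)))
  have h := (convexOn_pow (𝕜 := ℝ) n).2 (x := A) (y := B) hA hB hw₀ hw₂ (by ring)
  simp only [smul_eq_mul] at h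
  calc (w * A + (1 - w) * B) ^ n / (Nat.factorial (2 * n) : ℝ)
      ≤ (w * A ^ n + (1 - w) * B ^ n) / (Nat.factorial (2 * n) : ℝ) := by gcongr
    _ = _ := by ring

/-- Second-order expansion of `cosh ‖·‖` in a Hilbert space, with an error bound that does not
depend on the dimension. For fixed norms, both sides depend only on `⟪u, x⟫`, the left one convexly
and the right one affinely, so that it suffices to compare them when `u` and `x` are parallel. -/
lemma cosh_norm_add_le {E : Type*} [NormedAddCommGroup E] [InnerProductSpace ℝ E] (u x : E) :
    Real.cosh ‖u + x‖ ≤ Real.cosh ‖u‖ + Real.sinh ‖u‖ / ‖u‖ * ⟪u, x⟫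
      + Real.cosh ‖u‖ * (Real.exp ‖x‖ - 1 - ‖x‖) := by
  have hexp : Real.exp ‖x‖ = Real.cosh ‖x‖ + Real.sinh ‖x‖ := (Real.cosh_add_sinh _).symm
  have hsx : ‖x‖ ≤ Real.sinh ‖x‖ := Real.self_le_sinh_iff.2 (norm_nonneg _)
  have hcu : 1 ≤ Real.cosh ‖u‖ := Real.one_le_cosh _
  rcases eq_or_ne u 0 with rfl | hu
  · simp only [zero_add, norm_zero, Real.cosh_zero, Real.sinh_zero, inner_zero_left]
    linarith
  rcases eq_or_ne x 0 with rfl | hx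
  · simp
  have ha : 0 < ‖u‖ := norm_pos_iff.2 hu
  have hb : 0 < ‖x‖ := norm_pos_iff.2 hx
  set a := ‖u‖ with ha'
  set b := ‖x‖ with hb'
  have hc : |⟪u, x⟫| ≤ a * b := abs_real_inner_le_norm u x
  obtain ⟨hc₁, hc₂⟩ := abs_le.1 hc
  set c := ⟪u, x⟫ with hc'
  have hab : 0 < a * b := mul_pos ha hb
  set w : ℝ := (1 + c / (a * b)) / 2 with hw
  have hr₁ : -1 ≤ c / (a * b) := by rw [le_div_iff₀ hab]; linarith
  have hr₂ : c / (a * b) ≤ 1 := by rw [div_le_iff₀ hab]; linarith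
  have hn : ‖u + x‖ = √(w * (a + b) ^ 2 + (1 - w) * (a - b) ^ 2) := by
    have h1 : w * (a + b) ^ 2 + (1 - w) * (a - b) ^ 2 = ‖u + x‖ ^ 2 := by
      rw [norm_add_sq_real, hw]
      simp only [← ha', ← hb', ← hc']
      field_simp
      ring
    rw [h1, Real.sqrt_sq (norm_nonneg _)]
  have h := cosh_sqrt_combo_le (w := w) (A := (a + b) ^ 2) (B := (a - b) ^ 2)
    (by rw [hw]; linarith) (by rw [hw]; linarith) (by positivity) (by positivity)
  rw [← hn, Real.sqrt_sq (by positivity), Real.sqrt_sq_eq_abs, Real.cosh_abs, Real.cosh_add,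
    Real.cosh_sub] at h
  have hsu : Real.sinh a ≤ Real.cosh a := (Real.sinh_lt_cosh a).le
  have hsu₀ : 0 ≤ Real.sinh a := Real.sinh_nonneg_iff.2 ha.le
  have h1 : Real.sinh a / a * c = c / (a * b) * Real.sinh a * b := by field_simp
  have h2 : w * (Real.cosh a * Real.cosh b + Real.sinh a * Real.sinh b)
      + (1 - w) * (Real.cosh a * Real.cosh b - Real.sinh a * Real.sinh b)
      = Real.cosh a * Real.cosh b + c / (a * b) * Real.sinh a * Real.sinh b := by
    rw [hw]; ring
  rw [h2] at h
  rw [h1, hexp]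
  have h3 : c / (a * b) * Real.sinh a ≤ Real.cosh a := by
    nlinarith
  nlinarith [mul_le_mul_of_nonneg_right h3 (sub_nonneg.2 hsx)]

/-- The layer-cake bound behind the equivalence of Gaussian tails and square-exponential
moments. -/
lemma lintegral_exp_sq_le_two {Ξ : Type*} [MeasurableSpace Ξ] {ν : Measure Ξ}
    [IsProbabilityMeasure ν] {N : Ξ → ℝ} (hN : Measurable N) (hN₀ : ∀ x, 0 ≤ N x)
    (htail : ∀ s : ℝ, 0 < s → ν {x | s < N x} ≤ ENNReal.ofReal (Real.exp (-s ^ 2))) :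
    ∫⁻ x, ENNReal.ofReal (Real.exp (N x ^ 2 / 2)) ∂ν ≤ 2 := by
  rw [lintegral_eq_lintegral_meas_lt ν (Filter.Eventually.of_forall fun x ↦ (Real.exp_pos _).le)
    (by fun_prop)]
  rw [← Set.Ioc_union_Ioi_eq_Ioi (zero_le_one' ℝ),
    lintegral_union measurableSet_Ioi (Set.Ioc_disjoint_Ioi le_rfl)]
  have h1 : ∫⁻ t in Set.Ioc (0 : ℝ) 1, ν {a | t < Real.exp (N a ^ 2 / 2)} ≤ 1 := by
    calc _ ≤ ∫⁻ t in Set.Ioc (0 : ℝ) 1, 1 := lintegral_mono fun t ↦ prob_le_one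
      _ = 1 := by simp
  have h2 : ∫⁻ t in Set.Ioi (1 : ℝ), ν {a | t < Real.exp (N a ^ 2 / 2)} ≤ 1 := by
    calc _ ≤ ∫⁻ t in Set.Ioi (1 : ℝ), ENNReal.ofReal (t ^ (-2 : ℝ)) := by
          refine setLIntegral_mono' measurableSet_Ioi fun t ht ↦ ?_
          have ht : (1 : ℝ) < t := ht
          have hlog : 0 < Real.log t := Real.log_pos ht
          have hs : 0 < √(2 * Real.log t) := Real.sqrt_pos.2 (by positivity)
          refine (measure_mono fun a ha ↦ ?_).trans ((htail _ hs).trans_eq ?_)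
          · have ha : t < Real.exp (N a ^ 2 / 2) := ha
            have := (Real.log_lt_iff_lt_exp (by linarith)).2 ha
            have hNa : 0 < N a := by
              refine lt_of_le_of_ne (hN₀ a) fun h ↦ ?_
              rw [← h] at this
              norm_num at this
              linarith
            exact (Real.sqrt_lt' hNa).2 (by linarith)
          · rw [Real.sq_sqrt (by positivity), Real.rpow_def_of_pos (by linarith)]
            congr 2; ring
      _ = ENNReal.ofReal (∫ t in Set.Ioi (1 : ℝ), t ^ (-2 : ℝ)) := by
          rw [ofReal_integral_eq_lintegral_ofReal
            (integrableOn_Ioi_rpow_of_lt (by norm_num) zero_lt_one)]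
          filter_upwards [self_mem_ae_restrict measurableSet_Ioi] with t ht
          exact Real.rpow_nonneg (zero_le_one.trans (le_of_lt ht)) _
      _ = 1 := by
          rw [integral_Ioi_rpow_of_lt (by norm_num) zero_lt_one]; norm_num
  calc _ ≤ (1 : ℝ≥0∞) + 1 := add_le_add h1 h2
    _ = 2 := one_add_one_eq_two

lemma exp_mul_sub_one_sub_le {s N : ℝ} (hs : 0 ≤ s) (hN : 0 ≤ N) :
    Real.exp (s * N) - 1 - s * N ≤ 4 * s ^ 2 * Real.exp (s ^ 2) * Real.exp (N ^ 2 / 2) := by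
  set x := s * N with hx
  have hx₀ : 0 ≤ x := mul_nonneg hs hN
  have h1 : Real.exp x - 1 ≤ x * Real.exp x := by
    have := Real.add_one_le_exp (-x)
    have h2 : Real.exp (-x) * Real.exp x = 1 := by rw [← Real.exp_add]; simp
    nlinarith [Real.exp_pos x]
  have h2 : Real.exp x - 1 - x ≤ x ^ 2 * Real.exp x := by nlinarith
  have h3 : Real.exp x ≤ Real.exp (s ^ 2) * Real.exp (N ^ 2 / 4) := by
    rw [← Real.exp_add]
    exact Real.exp_le_exp.2 (by nlinarith [sq_nonneg (s - N / 2)])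
  have h4 : N ^ 2 ≤ 4 * Real.exp (N ^ 2 / 4) := by
    linarith [Real.add_one_le_exp (N ^ 2 / 4)]
  have h5 : Real.exp (N ^ 2 / 2) = Real.exp (N ^ 2 / 4) * Real.exp (N ^ 2 / 4) := by
    rw [← Real.exp_add]; congr 1; ring
  calc _ ≤ x ^ 2 * Real.exp x := h2
    _ = s ^ 2 * (N ^ 2 * Real.exp x) := by rw [hx]; ring
    _ ≤ s ^ 2 * ((4 * Real.exp (N ^ 2 / 4)) * (Real.exp (s ^ 2) * Real.exp (N ^ 2 / 4))) := by
        gcongr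
    _ = _ := by rw [h5]; ring

/-- The norm of a random vector of law `ν` deviates by more than `σ s` with probability at most
`exp (-s²)`. -/
def HasGaussianTail {Ξ E : Type*} [MeasurableSpace Ξ] [NormedAddCommGroup E] (ν : Measure Ξ)
    (Y : Ξ → E) (σ : ℝ) : Prop :=
  ∀ s : ℝ, 0 < s → ν {x | σ * s < ‖Y x‖} ≤ ENNReal.ofReal (Real.exp (-s ^ 2))

section Adaptive

variable {Ξ E : Type*} [MeasurableSpace Ξ] [NormedAddCommGroup E] [InnerProductSpace ℝ E]
  [CompleteSpace E] [MeasurableSpace E] [BorelSpace E] [SecondCountableTopology E]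

lemma lintegral_cosh_add_le {ν : Measure Ξ} [IsProbabilityMeasure ν] {Y : Ξ → E}
    (hY : Measurable Y) (hint : Integrable Y ν) (hmean : ∫ x, Y x ∂ν = 0) {σ : ℝ} (hσ : 0 < σ)
    (htail : HasGaussianTail ν Y σ) {r : ℝ} (hr : 0 ≤ r) (u : E) :
    ∫⁻ x, ENNReal.ofReal (Real.cosh ‖u + r • Y x‖) ∂ν
      ≤ ENNReal.ofReal (Real.exp (9 * (r * σ) ^ 2)) * ENNReal.ofReal (Real.cosh ‖u‖) := by
  set N : Ξ → ℝ := fun x ↦ ‖Y x‖ / σ with hN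
  have hNm : Measurable N := by fun_prop
  have hE := lintegral_exp_sq_le_two (ν := ν) hNm (fun x ↦ by positivity) (fun s hs ↦ by
    refine le_trans (measure_mono fun x hx ↦ ?_) (htail s hs)
    have hx : s < ‖Y x‖ / σ := hx
    rw [lt_div_iff₀ hσ] at hx
    simpa [mul_comm] using hx)
  have hEint : Integrable (fun x ↦ Real.exp (N x ^ 2 / 2)) ν := by
    refine ⟨by fun_prop, ?_⟩
    rw [hasFiniteIntegral_iff_ofReal (Filter.Eventually.of_forall fun x ↦ (Real.exp_pos _).le)]
    exact lt_of_le_of_lt hE (by simp)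
  have hEle : ∫ x, Real.exp (N x ^ 2 / 2) ∂ν ≤ 2 := by
    rw [integral_eq_lintegral_of_nonneg_ae (Filter.Eventually.of_forall fun x ↦ (Real.exp_pos _).le)
      (by fun_prop)]
    exact ENNReal.toReal_le_of_le_ofReal (by norm_num) (by simpa using hE)
  set s := r * σ with hs
  have hs₀ : 0 ≤ s := by positivity
  set k := Real.sinh ‖u‖ / ‖u‖ with hk
  have hpt : ∀ x, Real.cosh ‖u + r • Y x‖ ≤ Real.cosh ‖u‖ + k * r * ⟪u, Y x⟫
      + Real.cosh ‖u‖ * (4 * s ^ 2 * Real.exp (s ^ 2)) * Real.exp (N x ^ 2 / 2) := by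
    intro x
    have h1 := cosh_norm_add_le u (r • Y x)
    have h2 : ‖r • Y x‖ = s * N x := by
      rw [norm_smul, Real.norm_of_nonneg hr, hs, hN]; field_simp
    have h3 := exp_mul_sub_one_sub_le hs₀ (show 0 ≤ N x by positivity)
    rw [inner_smul_right, h2] at h1
    have := mul_le_mul_of_nonneg_left h3 (Real.cosh_pos ‖u‖).le
    calc _ ≤ _ := h1
      _ ≤ _ := by rw [← hk]; linarith
  have hinner : Integrable (fun x ↦ ⟪u, Y x⟫) ν := hint.const_inner u
  have hdom : Integrable (fun x ↦ Real.cosh ‖u‖ + k * r * ⟪u, Y x⟫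
      + Real.cosh ‖u‖ * (4 * s ^ 2 * Real.exp (s ^ 2)) * Real.exp (N x ^ 2 / 2)) ν :=
    ((integrable_const _).add (hinner.const_mul _)).add (hEint.const_mul _)
  have hnn : ∀ x, 0 ≤ Real.cosh ‖u‖ + k * r * ⟪u, Y x⟫
      + Real.cosh ‖u‖ * (4 * s ^ 2 * Real.exp (s ^ 2)) * Real.exp (N x ^ 2 / 2) :=
    fun x ↦ (Real.cosh_pos _).le.trans (hpt x)
  calc _ ≤ ∫⁻ x, ENNReal.ofReal (Real.cosh ‖u‖ + k * r * ⟪u, Y x⟫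
      + Real.cosh ‖u‖ * (4 * s ^ 2 * Real.exp (s ^ 2)) * Real.exp (N x ^ 2 / 2)) ∂ν :=
        lintegral_mono fun x ↦ ENNReal.ofReal_le_ofReal (hpt x)
    _ = ENNReal.ofReal (∫ x, (Real.cosh ‖u‖ + k * r * ⟪u, Y x⟫
      + Real.cosh ‖u‖ * (4 * s ^ 2 * Real.exp (s ^ 2)) * Real.exp (N x ^ 2 / 2)) ∂ν) :=
        (ofReal_integral_eq_lintegral_ofReal hdom (Filter.Eventually.of_forall hnn)).symm
    _ ≤ ENNReal.ofReal (Real.exp (9 * s ^ 2) * Real.cosh ‖u‖) := by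
        refine ENNReal.ofReal_le_ofReal ?_
        have hlin : Integrable (fun x ↦ Real.cosh ‖u‖ + k * r * ⟪u, Y x⟫) ν :=
          (integrable_const _).add (hinner.const_mul _)
        rw [integral_add hlin (hEint.const_mul _), integral_add (integrable_const _)
          (hinner.const_mul _), integral_const_mul, integral_const_mul, integral_inner hint, hmean]
        simp only [integral_const, probReal_univ, smul_eq_mul, one_mul, inner_zero_right, mul_zero,
          add_zero]
        have h1 : 1 + 8 * s ^ 2 * Real.exp (s ^ 2) ≤ Real.exp (9 * s ^ 2) := by
          have e1 : Real.exp (9 * s ^ 2) = Real.exp (s ^ 2) * Real.exp (8 * s ^ 2) := by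
            rw [← Real.exp_add]; congr 1; ring
          have e2 := Real.add_one_le_exp (8 * s ^ 2)
          have e3 : 1 ≤ Real.exp (s ^ 2) := Real.one_le_exp (sq_nonneg s)
          rw [e1]
          nlinarith
        have hc := Real.cosh_pos ‖u‖
        have h2 : 0 ≤ Real.cosh ‖u‖ * (4 * s ^ 2 * Real.exp (s ^ 2)) := by positivity
        nlinarith [mul_le_mul_of_nonneg_left hEle h2]
    _ = _ := ENNReal.ofReal_mul (Real.exp_pos _).le

variable {Ω H : Type*} [mΩ : MeasurableSpace Ω] [MeasurableSpace H]

/-- Exponential moments of a sum of fresh samples, evaluated at a random point `X` that is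
independent of them. -/
lemma lintegral_cosh_sum_le {μ : Measure Ω} [IsProbabilityMeasure μ] {ν : Measure Ξ}
    [IsProbabilityMeasure ν] {𝓕 : ℕ → MeasurableSpace Ω} (h𝓕 : ∀ k, 𝓕 k ≤ mΩ) (hmono : Monotone 𝓕)
    {X : Ω → H} (hX : Measurable[𝓕 0] X) {ζ : ℕ → Ω → Ξ} (hζ : ∀ k, Measurable[𝓕 (k + 1)] (ζ k))
    (hlaw : ∀ k, μ.map (ζ k) = ν)
    (hind : ∀ k, Indep (𝓕 k) (MeasurableSpace.comap (ζ k) inferInstance) μ)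
    {Y : H → Ξ → E} (hY : Measurable (Function.uncurry Y)) {s : Set H} (hs : MeasurableSet s)
    (hint : ∀ x ∈ s, Integrable (Y x) ν) (hmean : ∀ x ∈ s, ∫ y, Y x y ∂ν = 0)
    {σ : ℝ} (hσ : 0 < σ) (htail : ∀ x ∈ s, HasGaussianTail ν (Y x) σ) {r : ℝ} (hr : 0 ≤ r) (k : ℕ) :
    ∫⁻ ω, s.indicator 1 (X ω) *
        ENNReal.ofReal (Real.cosh ‖∑ j ∈ Finset.range k, r • Y (X ω) (ζ j ω)‖) ∂μ
      ≤ ENNReal.ofReal (Real.exp (9 * k * (r * σ) ^ 2)) := by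
  have hζm : ∀ k, Measurable (ζ k) := fun k ↦ (hζ k).mono (h𝓕 _) le_rfl
  have hsum : ∀ k, Measurable[𝓕 k] fun ω ↦ ∑ j ∈ Finset.range k, r • Y (X ω) (ζ j ω) := by
    intro k
    refine Finset.measurable_sum _ fun j hj ↦ ?_
    have h1 : Measurable[𝓕 k] (ζ j) :=
      (hζ j).mono (hmono (Nat.succ_le_of_lt (Finset.mem_range.1 hj))) le_rfl
    have h2 : Measurable[𝓕 k] X := hX.mono (hmono (Nat.zero_le k)) le_rfl
    have h3 : Measurable[𝓕 k] fun ω ↦ (X ω, ζ j ω) := h2.prodMk h1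
    exact (hY.comp h3).const_smul r
  induction k with
  | zero =>
    simp only [Finset.range_zero, Finset.sum_empty, norm_zero, Real.cosh_zero, ENNReal.ofReal_one,
      mul_one, CharP.cast_eq_zero, mul_zero, zero_mul, Real.exp_zero]
    calc _ ≤ ∫⁻ _ω, (1 : ℝ≥0∞) ∂μ := lintegral_mono fun ω ↦ by
            by_cases h : X ω ∈ s <;> simp [h]
      _ = 1 := by simp
  | succ k ih =>
    set Z : Ω → H × E := fun ω ↦ (X ω, ∑ j ∈ Finset.range k, r • Y (X ω) (ζ j ω)) with hZ
    have hZm' : Measurable[𝓕 k] Z := (hX.mono (hmono (Nat.zero_le k)) le_rfl).prodMk (hsum k)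
    have hZm : Measurable Z := hZm'.mono (h𝓕 k) le_rfl
    have hindep : IndepFun Z (ζ k) μ := indep_of_indep_of_le_left (hind k) hZm'.comap_le
    have hprod := (indepFun_iff_map_prod_eq_prod_map_map hZm.aemeasurable
      (hζm k).aemeasurable).1 hindep
    set φ : (H × E) × Ξ → ℝ≥0∞ := fun p ↦ s.indicator 1 p.1.1 *
      ENNReal.ofReal (Real.cosh ‖p.1.2 + r • Y p.1.1 p.2‖) with hφ
    have hφm : Measurable φ := by
      have h1 : Measurable fun p : (H × E) × Ξ ↦ Y p.1.1 p.2 :=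
        hY.comp ((measurable_fst.comp measurable_fst).prodMk measurable_snd)
      have h2 : Measurable fun p : (H × E) × Ξ ↦ (s.indicator 1 p.1.1 : ℝ≥0∞) :=
        (measurable_one.indicator hs).comp (measurable_fst.comp measurable_fst)
      refine h2.mul (ENNReal.measurable_ofReal.comp (Real.continuous_cosh.measurable.comp ?_))
      exact ((measurable_snd.comp measurable_fst).add (h1.const_smul r)).norm
    calc _ = ∫⁻ ω, φ (Z ω, ζ k ω) ∂μ := by
          refine lintegral_congr fun ω ↦ ?_
          simp only [hφ, hZ, Finset.sum_range_succ]
      _ = ∫⁻ p, φ p ∂(μ.map fun ω ↦ (Z ω, ζ k ω)) :=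
          (lintegral_map hφm (hZm.prodMk (hζm k))).symm
      _ = ∫⁻ z, ∫⁻ y, φ (z, y) ∂ν ∂(μ.map Z) := by
          rw [hprod, hlaw k, lintegral_prod _ hφm.aemeasurable]
      _ ≤ ∫⁻ z, ENNReal.ofReal (Real.exp (9 * (r * σ) ^ 2)) *
            (s.indicator 1 z.1 * ENNReal.ofReal (Real.cosh ‖z.2‖)) ∂(μ.map Z) := by
          refine lintegral_mono fun z ↦ ?_
          by_cases hz : z.1 ∈ s
          · simp only [hφ, Set.indicator_of_mem hz, Pi.one_apply, one_mul]
            exact lintegral_cosh_add_le (hY.comp measurable_prodMk_left) (hint _ hz) (hmean _ hz)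
              hσ (htail _ hz) hr z.2
          · simp [hφ, Set.indicator_of_notMem hz]
      _ = ENNReal.ofReal (Real.exp (9 * (r * σ) ^ 2)) * ∫⁻ ω, s.indicator 1 (X ω) *
            ENNReal.ofReal (Real.cosh ‖∑ j ∈ Finset.range k, r • Y (X ω) (ζ j ω)‖) ∂μ := by
          have h2 : Measurable fun z : H × E ↦ (s.indicator 1 z.1 : ℝ≥0∞) *
              ENNReal.ofReal (Real.cosh ‖z.2‖) :=
            ((measurable_one.indicator hs).comp measurable_fst).mul
              (ENNReal.measurable_ofReal.comp
                (Real.continuous_cosh.measurable.comp measurable_snd.norm))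
          rw [lintegral_const_mul _ h2, lintegral_map h2 hZm]
      _ ≤ ENNReal.ofReal (Real.exp (9 * (r * σ) ^ 2)) *
            ENNReal.ofReal (Real.exp (9 * k * (r * σ) ^ 2)) := by gcongr
      _ = _ := by
          rw [← ENNReal.ofReal_mul (Real.exp_pos _).le, ← Real.exp_add]
          congr 2; push_cast; ring

/-- Dimension-free concentration of the sum of `n` fresh samples at a random point `X` that is
independent of them, on the event that `X` lies in the set `s` on which the samples are
sub-Gaussian. -/
lemma measure_norm_sum_gt_le {μ : Measure Ω} [IsProbabilityMeasure μ] {ν : Measure Ξ}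
    [IsProbabilityMeasure ν] {𝓕 : ℕ → MeasurableSpace Ω} (h𝓕 : ∀ k, 𝓕 k ≤ mΩ) (hmono : Monotone 𝓕)
    {X : Ω → H} (hX : Measurable[𝓕 0] X) {ζ : ℕ → Ω → Ξ} (hζ : ∀ k, Measurable[𝓕 (k + 1)] (ζ k))
    (hlaw : ∀ k, μ.map (ζ k) = ν)
    (hind : ∀ k, Indep (𝓕 k) (MeasurableSpace.comap (ζ k) inferInstance) μ)
    {Y : H → Ξ → E} (hY : Measurable (Function.uncurry Y)) {s : Set H} (hs : MeasurableSet s)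
    (hint : ∀ x ∈ s, Integrable (Y x) ν) (hmean : ∀ x ∈ s, ∫ y, Y x y ∂ν = 0)
    {n : ℕ} (hn : 1 ≤ n) {τ l : ℝ} (hτ : 0 < τ) (hl : 0 < l)
    (htail : ∀ x ∈ s, HasGaussianTail ν (Y x) (√n * (τ / √l))) :
    μ {ω | X ω ∈ s ∧ 13 * n * τ ≤ ‖∑ j ∈ Finset.range n, Y (X ω) (ζ j ω)‖}
      ≤ ENNReal.ofReal (2 * Real.exp (-(4 * l))) := by
  have hn' : (0 : ℝ) < n := by exact_mod_cast hn
  -- This `r` turns the moment bound into `exp (9 l)`, to be compared with `cosh (13 l)`.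
  set r : ℝ := l / (n * τ) with hr
  have hr₀ : 0 < r := by positivity
  have hσ : 0 < √(n : ℝ) * (τ / √l) := by positivity
  have hrσ : (r * (√(n : ℝ) * (τ / √l))) ^ 2 = l / n := by
    have h1 : √(n : ℝ) ^ 2 = n := Real.sq_sqrt hn'.le
    have h2 : √l ^ 2 = l := Real.sq_sqrt hl.le
    rw [hr, mul_pow, mul_pow, div_pow, div_pow, h1, h2]
    field_simp
  have hE := lintegral_cosh_sum_le h𝓕 hmono hX hζ hlaw hind hY hs hint hmean hσ htail hr₀.le n
  rw [hrσ, show 9 * (n : ℝ) * (l / n) = 9 * l by field_simp] at hE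
  set φ : Ω → ℝ≥0∞ := fun ω ↦ s.indicator 1 (X ω) *
    ENNReal.ofReal (Real.cosh ‖∑ j ∈ Finset.range n, r • Y (X ω) (ζ j ω)‖) with hφ
  have hζm : ∀ k, Measurable (ζ k) := fun k ↦ (hζ k).mono (h𝓕 _) le_rfl
  have hXm : Measurable X := hX.mono (h𝓕 0) le_rfl
  have hφm : Measurable φ := by
    refine ((measurable_one.indicator hs).comp hXm).mul (ENNReal.measurable_ofReal.comp
      (Real.continuous_cosh.measurable.comp (Measurable.norm ?_)))
    exact Finset.measurable_sum _ fun j _ ↦ (hY.comp (hXm.prodMk (hζm j))).const_smul r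
  have hc : (0 : ℝ) < Real.exp (13 * l) / 2 := by positivity
  have hmarkov := meas_ge_le_lintegral_div (μ := μ) hφm.aemeasurable
    (ε := ENNReal.ofReal (Real.exp (13 * l) / 2)) (by simpa using hc) (by simp)
  refine (measure_mono ?_).trans (hmarkov.trans ?_)
  · rintro ω ⟨h1, h2⟩
    have h3 : ‖∑ j ∈ Finset.range n, r • Y (X ω) (ζ j ω)‖
        = r * ‖∑ j ∈ Finset.range n, Y (X ω) (ζ j ω)‖ := by
      rw [← Finset.smul_sum, norm_smul, Real.norm_of_nonneg hr₀.le]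
    have h4 : 13 * l ≤ r * ‖∑ j ∈ Finset.range n, Y (X ω) (ζ j ω)‖ := by
      calc 13 * l = r * (13 * n * τ) := by rw [hr]; field_simp
        _ ≤ _ := by gcongr
    simp only [Set.mem_ofPred_eq, hφ, Set.indicator_of_mem h1, Pi.one_apply, one_mul, h3]
    refine ENNReal.ofReal_le_ofReal ?_
    rw [Real.cosh_eq]
    have h5 := Real.exp_le_exp.2 h4
    have h6 := Real.exp_pos (-(r * ‖∑ j ∈ Finset.range n, Y (X ω) (ζ j ω)‖))
    linarith
  · calc _ ≤ ENNReal.ofReal (Real.exp (9 * l)) / ENNReal.ofReal (Real.exp (13 * l) / 2) := by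
          gcongr
      _ = ENNReal.ofReal (Real.exp (9 * l) / (Real.exp (13 * l) / 2)) :=
          (ENNReal.ofReal_div_of_pos hc).symm
      _ = _ := by
          congr 1
          rw [show -(4 * l) = 9 * l - 13 * l by ring, Real.exp_sub]
          field_simp

end Adaptive

/-! ### Convex problems and their log barrier -/

/-- The gradient `∇f⁰(x) + η ∑ᵢ ∇fⁱ(x) / (-fⁱ(x))` of the log barrier. -/
def barrierGrad {d m : ℕ} (f : Fin (m + 1) → Space d → ℝ) (η : ℝ) (x : Space d) : Space d :=
  gradient (f 0) x + η • ∑ i : Fin m, (-f i.succ x)⁻¹ • gradient (f i.succ) x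

section Basic

variable {d m : ℕ} {f : Fin (m + 1) → Space d → ℝ} {L M : Fin (m + 1) → ℝ} {R β : ℝ}
  {x₀ : Space d}

lemma strictlyFeasible_subset : strictlyFeasible f ⊆ feasible f := fun _ hx i ↦ (hx i).le

lemma le_maxConst (a : Fin (m + 1) → ℝ) (i : Fin (m + 1)) : a i ≤ maxConst a :=
  Finset.le_sup' a (Finset.mem_univ i)

lemma maxConst_pos {a : Fin (m + 1) → ℝ} (ha : ∀ i, 0 < a i) : 0 < maxConst a :=
  (ha 0).trans_le (le_maxConst a 0)

lemma IsConvexProblem.continuous (h : IsConvexProblem L M R β f x₀) (i : Fin (m + 1)) :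
    Continuous (f i) :=
  continuousOn_univ.1 ((h.convex i).continuousOn isOpen_univ)

lemma IsConvexProblem.isClosed_feasible (h : IsConvexProblem L M R β f x₀) :
    IsClosed (feasible f) := by
  have : feasible f = ⋂ i : Fin m, {x | f i.succ x ≤ 0} := by ext; simp [feasible]
  rw [this]
  exact isClosed_iInter fun i ↦ isClosed_le (h.continuous _) continuous_const

lemma IsConvexProblem.isOpen_strictlyFeasible (h : IsConvexProblem L M R β f x₀) :
    IsOpen (strictlyFeasible f) := by
  have : strictlyFeasible f = ⋂ i : Fin m, {x | f i.succ x < 0} := by ext; simp [strictlyFeasible]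
  rw [this]
  exact isOpen_iInter_of_finite fun i ↦ isOpen_lt (h.continuous _) continuous_const

lemma IsConvexProblem.start_mem (h : IsConvexProblem L M R β f x₀) (hβ : 0 < β) :
    x₀ ∈ strictlyFeasible f := fun i ↦ by linarith [h.start i]

/-- The first-order inequality for a convex function. -/
lemma inner_gradient_le_sub {φ : Space d → ℝ} (hφ : ConvexOn ℝ Set.univ φ) {x : Space d}
    (hx : DifferentiableAt ℝ φ x) (y : Space d) : ⟪gradient φ x, y - x⟫ ≤ φ y - φ x := by
  set ψ : ℝ → ℝ := φ ∘ AffineMap.lineMap x y with hψ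
  have hψc : ConvexOn ℝ Set.univ ψ := by
    simpa using hφ.comp_affineMap (AffineMap.lineMap x y : ℝ →ᵃ[ℝ] Space d)
  have hd : HasDerivAt ψ ⟪gradient φ x, y - x⟫ 0 := by
    have h1 : HasFDerivAt φ (InnerProductSpace.toDual ℝ (Space d) (gradient φ x))
        (AffineMap.lineMap x y (0 : ℝ)) := by
      simpa using hx.hasGradientAt.hasFDerivAt
    have h2 := h1.comp_hasDerivAt (0 : ℝ) (AffineMap.hasDerivAt_lineMap (a := x) (b := y))
    simpa using h2
  have h := hψc.le_slope_of_hasDerivAt (Set.mem_univ 0) (Set.mem_univ 1) zero_lt_one hd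
  simpa [slope_def_field, hψ] using h

lemma IsConvexProblem.inner_gradient_le (h : IsConvexProblem L M R β f x₀) (i : Fin (m + 1))
    {x : Space d} (hx : x ∈ feasible f) (y : Space d) :
    ⟪gradient (f i) x, y - x⟫ ≤ f i y - f i x :=
  inner_gradient_le_sub (h.convex i) (h.differentiable i x hx) y

lemma IsConvexProblem.norm_gradient_le (h : IsConvexProblem L M R β f x₀) (hL : ∀ i, 0 < L i)
    (i : Fin (m + 1)) {x : Space d} (hx : x ∈ strictlyFeasible f) :
    ‖gradient (f i) x‖ ≤ L i := by
  have h1 := (h.differentiable i x (strictlyFeasible_subset hx)).hasGradientAt.hasFDerivAt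
  have h2 := h1.le_of_lip' (hL i).le (by
    filter_upwards [h.isOpen_strictlyFeasible.mem_nhds hx] with y hy
    simpa [Real.norm_eq_abs] using
      h.lipschitz i y (strictlyFeasible_subset hy) x (strictlyFeasible_subset hx))
  rwa [LinearIsometryEquiv.norm_map] at h2

/-- A segment that leaves the domain of the barrier does so at a feasible point at which some
constraint is active. -/
lemma IsConvexProblem.exists_active (h : IsConvexProblem L M R β f x₀) {x y : Space d}
    (hx : x ∈ strictlyFeasible f) (hy : y ∉ strictlyFeasible f) :
    ∃ s : ℝ, 0 ≤ s ∧ s ≤ 1 ∧ x + s • (y - x) ∈ feasible f ∧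
      ∃ i : Fin m, f i.succ (x + s • (y - x)) = 0 := by
  obtain ⟨j, hj⟩ : ∃ j : Fin m, 0 ≤ f j.succ y := by
    simpa [strictlyFeasible] using hy
  have hne : (Finset.univ : Finset (Fin m)).Nonempty := ⟨j, Finset.mem_univ j⟩
  set φ : ℝ → ℝ := fun s ↦ Finset.univ.sup' hne fun i : Fin m ↦ f i.succ (x + s • (y - x)) with hφ
  have hφc : Continuous φ := by
    refine Continuous.finset_sup'_apply hne fun i _ ↦ (h.continuous _).comp ?_
    fun_prop
  have h0 : φ 0 ≤ 0 := by
    simp only [hφ, zero_smul, add_zero]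
    exact Finset.sup'_le _ _ fun i _ ↦ (hx i).le
  have h1 : 0 ≤ φ 1 := by
    simp only [hφ, one_smul, add_sub_cancel]
    exact hj.trans (Finset.le_sup' (fun i : Fin m ↦ f i.succ y) (Finset.mem_univ j))
  obtain ⟨s, hs, hs0⟩ := intermediate_value_Icc zero_le_one hφc.continuousOn ⟨h0, h1⟩
  refine ⟨s, hs.1, hs.2, fun i ↦ ?_, ?_⟩
  · exact (Finset.le_sup' (fun i : Fin m ↦ f i.succ (x + s • (y - x))) (Finset.mem_univ i)).trans
      hs0.le
  · obtain ⟨i, -, hi⟩ := Finset.exists_mem_eq_sup' hne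
      fun i : Fin m ↦ f i.succ (x + s • (y - x))
    exact ⟨i, hi.symm.trans hs0⟩

/-- Along any ray from `x₀` a constraint becomes active within the distance `R`; its value
increases by at least `β` on the way. -/
lemma IsConvexProblem.le_lipschitz_mul_diam (h : IsConvexProblem L M R β f x₀) (hd : 1 ≤ d)
    (hR : 0 < R) (hβ : 0 < β) (hL : ∀ i, 0 < L i) : β ≤ maxConst L * R := by
  have hx₀ := h.start_mem hβ
  have hdim : Nontrivial (Space d) := by
    have : Nonempty (Fin d) := ⟨⟨0, hd⟩⟩
    infer_instance
  obtain ⟨e, he⟩ := exists_ne (0 : Space d)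
  have hen : 0 < ‖e‖ := norm_pos_iff.2 he
  set y : Space d := x₀ + (2 * R / ‖e‖) • e with hy
  have hyn : y ∉ strictlyFeasible f := by
    intro hy'
    have h1 := h.diam y (strictlyFeasible_subset hy') x₀ (strictlyFeasible_subset hx₀)
    rw [hy, add_sub_cancel_left, norm_smul, Real.norm_of_nonneg (by positivity),
      div_mul_cancel₀ _ hen.ne'] at h1
    linarith
  obtain ⟨s, -, -, hsf, i, hi⟩ := h.exists_active hx₀ hyn
  have h1 := h.lipschitz i.succ _ hsf x₀ (strictlyFeasible_subset hx₀)
  have h2 := h.diam _ hsf x₀ (strictlyFeasible_subset hx₀)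
  rw [hi] at h1
  have h3 := h.start i
  have h4 := le_abs_self (0 - f i.succ x₀)
  have h5 := le_maxConst L i.succ
  have h6 := maxConst_pos hL
  calc β ≤ L i.succ * ‖x₀ + s • (y - x₀) - x₀‖ := by linarith
    _ ≤ maxConst L * R := by gcongr

lemma IsConvexProblem.convex_strictlyFeasible (h : IsConvexProblem L M R β f x₀) :
    Convex ℝ (strictlyFeasible f) := by
  have : strictlyFeasible f = ⋂ i : Fin m, {x | f i.succ x < 0} := by ext; simp [strictlyFeasible]
  rw [this]
  refine convex_iInter fun i ↦ ?_
  simpa using (h.convex i.succ).convex_lt 0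

lemma inner_barrierGrad (η : ℝ) (x v : Space d) : ⟪barrierGrad f η x, v⟫ =
    ⟪gradient (f 0) x, v⟫ + η * ∑ i : Fin m, (-f i.succ x)⁻¹ * ⟪gradient (f i.succ) x, v⟫ := by
  simp [barrierGrad, inner_add_left, inner_smul_left, sum_inner]

/-- The log barrier lies above its tangents. -/
lemma IsConvexProblem.logBarrier_sub_le (h : IsConvexProblem L M R β f x₀) {η : ℝ} (hη : 0 ≤ η)
    {x y : Space d} (hx : x ∈ strictlyFeasible f) (hy : y ∈ strictlyFeasible f) :
    logBarrier f η x - logBarrier f η y ≤ ⟪barrierGrad f η x, x - y⟫ := by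
  have hxf := strictlyFeasible_subset hx
  rw [inner_barrierGrad, logBarrier, logBarrier]
  have h0 := h.inner_gradient_le 0 hxf y
  rw [← neg_sub, inner_neg_right] at h0
  have h1 : ∑ i : Fin m, (Real.log (-f i.succ y) - Real.log (-f i.succ x))
      ≤ ∑ i : Fin m, (-f i.succ x)⁻¹ * ⟪gradient (f i.succ) x, x - y⟫ := by
    refine Finset.sum_le_sum fun i _ ↦ ?_
    have hax : 0 < -f i.succ x := by linarith [hx i]
    have hay : 0 < -f i.succ y := by linarith [hy i]
    have h2 := h.inner_gradient_le i.succ hxf y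
    rw [← neg_sub, inner_neg_right] at h2
    rw [← Real.log_div hay.ne' hax.ne']
    calc Real.log (-f i.succ y / -f i.succ x) ≤ -f i.succ y / -f i.succ x - 1 :=
          Real.log_le_sub_one_of_pos (div_pos hay hax)
      _ = (-f i.succ x)⁻¹ * (f i.succ x - f i.succ y) := by
            rw [div_sub_one hax.ne', inv_mul_eq_div]; congr 1; ring
      _ ≤ _ := by gcongr; linarith
  rw [Finset.sum_sub_distrib] at h1
  nlinarith [mul_le_mul_of_nonneg_left h1 hη]

lemma IsConvexProblem.convexOn_logBarrier (h : IsConvexProblem L M R β f x₀) {η : ℝ}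
    (hη : 0 ≤ η) : ConvexOn ℝ (strictlyFeasible f) (logBarrier f η) := by
  refine ⟨h.convex_strictlyFeasible, fun x hx y hy a b ha hb hab ↦ ?_⟩
  set z := a • x + b • y with hz
  have hzm : z ∈ strictlyFeasible f := h.convex_strictlyFeasible hx hy ha hb hab
  have h1 := h.logBarrier_sub_le hη hzm hx
  have h2 := h.logBarrier_sub_le hη hzm hy
  have h3 : a * ⟪barrierGrad f η z, z - x⟫ + b * ⟪barrierGrad f η z, z - y⟫ = 0 := by
    rw [← real_inner_smul_right, ← real_inner_smul_right, ← inner_add_right]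
    have : a • (z - x) + b • (z - y) = 0 := by
      rw [smul_sub, smul_sub, sub_add_sub_comm, ← add_smul, hab, one_smul, ← hz, sub_self]
    rw [this, inner_zero_right]
  simp only [smul_eq_mul]
  have h4 : logBarrier f η z = a * logBarrier f η z + b * logBarrier f η z := by
    rw [← add_mul, hab, one_mul]
  nlinarith [mul_le_mul_of_nonneg_left h1 ha, mul_le_mul_of_nonneg_left h2 hb]

/-- The gradient of the barrier vanishes at its minimizer. -/
lemma IsConvexProblem.barrierGrad_eq_zero (h : IsConvexProblem L M R β f x₀) {η : ℝ}
    {xs : Space d} (hxs : IsBarrierMinimizer f η xs) : barrierGrad f η xs = 0 := by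
  have hf : ∀ i, HasFDerivAt (f i) (InnerProductSpace.toDual ℝ (Space d) (gradient (f i) xs)) xs :=
    fun i ↦ (h.differentiable i xs (strictlyFeasible_subset hxs.1)).hasGradientAt.hasFDerivAt
  have hB := (hf 0).sub ((HasFDerivAt.fun_sum (u := Finset.univ) fun (i : Fin m) _ ↦
    ((hf i.succ).neg.log (by simpa using (hxs.1 i).ne))).const_mul η)
  have hmin : IsLocalMin (logBarrier f η) xs := by
    filter_upwards [h.isOpen_strictlyFeasible.mem_nhds hxs.1] with y hy using hxs.2 y hy
  have h0 := hmin.hasFDerivAt_eq_zero hB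
  have h1 := congrArg (fun φ : Space d →L[ℝ] ℝ ↦ φ (barrierGrad f η xs)) h0
  have h2 : ⟪barrierGrad f η xs, barrierGrad f η xs⟫ = 0 := by
    rw [inner_barrierGrad]
    simpa [Finset.sum_neg_distrib, sub_eq_add_neg] using h1
  exact inner_self_eq_zero.1 h2

end Basic

/-! ### One step of the algorithm -/

lemma neg_log_one_sub_le {u : ℝ} (hu : u ≤ 0.52) :
    -Real.log (1 - u) ≤ u + 1.05 * u ^ 2 := by
  set φ : ℝ → ℝ := fun u ↦ u + 1.05 * u ^ 2 + Real.log (1 - u) with hφ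
  have hd : ∀ v : ℝ, v ≤ 0.52 →
      HasDerivAt φ (1 + 1.05 * (2 * v) + (-1) / (1 - v)) v := by
    intro v hv
    have h1 := ((hasDerivAt_id v).const_sub 1).log (by norm_num at hv ⊢; linarith)
    have h2 := (hasDerivAt_pow 2 v).const_mul (1.05 : ℝ)
    have h3 := ((hasDerivAt_id' v).add h2).add h1
    simp only [Nat.cast_ofNat, Nat.add_one_sub_one, pow_one] at h3
    exact h3
  have hd' : ∀ v : ℝ, v ≤ 0.52 →
      1 + 1.05 * (2 * v) + (-1) / (1 - v) = v * (1.1 - 2.1 * v) / (1 - v) := by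
    intro v hv
    have : 1 - v ≠ 0 := by norm_num at hv; linarith
    field_simp
    ring
  have h0 : φ 0 = 0 := by simp [hφ]
  suffices h : φ 0 ≤ φ u by
    rw [h0] at h
    simp only [hφ] at h
    linarith
  rcases le_total 0 u with h | h
  · have hmono : MonotoneOn φ (Set.Icc 0 u) := by
      refine monotoneOn_of_deriv_nonneg (convex_Icc 0 u) (fun v hv ↦
        (hd v (hv.2.trans hu)).continuousAt.continuousWithinAt) (fun v hv ↦ ?_) (fun v hv ↦ ?_)
      · rw [interior_Icc] at hv
        exact (hd v (hv.2.le.trans hu)).differentiableAt.differentiableWithinAt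
      · rw [interior_Icc] at hv
        have hv' : v ≤ 0.52 := hv.2.le.trans hu
        rw [(hd v hv').deriv, hd' v hv']
        norm_num at hv'
        have := hv.1
        exact div_nonneg (mul_nonneg this.le (by linarith)) (by linarith)
    exact hmono ⟨le_rfl, h⟩ ⟨h, le_rfl⟩ h
  · have hanti : AntitoneOn φ (Set.Icc u 0) := by
      have hle : ∀ v : ℝ, v ≤ 0 → v ≤ 0.52 := fun v hv ↦ hv.trans (by norm_num)
      refine antitoneOn_of_deriv_nonpos (convex_Icc u 0) (fun v hv ↦
        (hd v (hle v hv.2)).continuousAt.continuousWithinAt) (fun v hv ↦ ?_) (fun v hv ↦ ?_)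
      · rw [interior_Icc] at hv
        exact (hd v (hle v hv.2.le)).differentiableAt.differentiableWithinAt
      · rw [interior_Icc] at hv
        rw [(hd v (hle v hv.2.le)).deriv, hd' v (hle v hv.2.le)]
        have := hv.2
        exact div_nonpos_of_nonpos_of_nonneg
          (mul_nonpos_of_nonpos_of_nonneg this.le (by linarith)) (by linarith)
    exact hanti ⟨le_rfl, h⟩ ⟨h, le_rfl⟩ h

/-- The step size rule bounds the relative decrease `u` of the distance `α` to a constraint. Here
`A` and `θ` are the estimates of `α` and of the directional derivative used by the rule, and `r`
is the length of the step. -/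
lemma relative_decrease_bounds {α A M θ r t : ℝ} (hα : 0 < α) (hA : 0 < A) (hAα : A ≤ 1.01 * α)
    (hM : 0 < M) (hθ : 0 ≤ θ) (hr : 0 ≤ r) (hstep : r * (2 * θ + √(A * M)) ≤ A)
    (ht : |t| ≤ (θ + 0.01 * √(A * M)) * r) :
    (t + M * r ^ 2 / 2) / α ≤ 0.52 ∧
    M * r ^ 2 / (2 * α) + 1.05 * ((t + M * r ^ 2 / 2) / α) ^ 2
      ≤ 0.15 * r ^ 2 * (10 * (M / A) + 8 * (θ ^ 2 / A ^ 2)) := by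
  set w := √(A * M) with hw
  have hw₀ : 0 ≤ w := Real.sqrt_nonneg _
  have hw2 : w ^ 2 = A * M := Real.sq_sqrt (by positivity)
  -- In these variables the step size rule reads `p + q ≤ 1`, and the right-hand side of the second
  -- claim is `1.5 q² + 0.3 p²`.
  set p := 2 * θ * r / A with hp
  set q := w * r / A with hq
  have hp₀ : 0 ≤ p := by positivity
  have hq₀ : 0 ≤ q := by positivity
  have hpq : p + q ≤ 1 := by
    rw [hp, hq, ← add_div, div_le_one hA]; linarith
  have hMr : M * r ^ 2 / A = q ^ 2 := by
    rw [hq, div_pow, mul_pow, hw2]; field_simp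
  have hθr : θ ^ 2 * r ^ 2 / A ^ 2 = p ^ 2 / 4 := by
    rw [hp, div_pow]; ring
  set k := A / α with hk
  have hk₀ : 0 < k := by positivity
  have hk1 : k ≤ 1.01 := by rw [hk, div_le_iff₀ hα]; exact hAα
  have hmain : |(t + M * r ^ 2 / 2) / α| ≤ k * (p / 2 + 0.01 * q + q ^ 2 / 2) := by
    have e : k * (p / 2 + 0.01 * q + q ^ 2 / 2) = ((θ + 0.01 * w) * r + M * r ^ 2 / 2) / α := by
      rw [← hMr, hk, hp, hq]; field_simp
    rw [e, abs_div, abs_of_pos hα]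
    gcongr
    calc |t + M * r ^ 2 / 2| ≤ |t| + |M * r ^ 2 / 2| := abs_add_le _ _
      _ ≤ _ := by rw [abs_of_nonneg (show 0 ≤ M * r ^ 2 / 2 by positivity)]; linarith
  set u := (t + M * r ^ 2 / 2) / α with hu
  set B := p / 2 + 0.01 * q + q ^ 2 / 2 with hB
  have hB₀ : 0 ≤ B := by positivity
  have hq1 : q ≤ 1 := by linarith
  have hp1 : p ≤ 1 := by linarith
  have hu1 : |u| ≤ 1.01 * B := hmain.trans (by gcongr)
  constructor
  · refine (le_abs_self u).trans (hu1.trans ?_)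
    have : B ≤ 0.51 := by rw [hB]; nlinarith
    linarith
  · have hu2 : u ^ 2 ≤ (1.01 * B) ^ 2 := sq_le_sq' (by linarith [(abs_le.1 hu1).1])
      (by linarith [(abs_le.1 hu1).2])
    have e1 : M * r ^ 2 / (2 * α) = k * q ^ 2 / 2 := by
      rw [← hMr, hk]; field_simp
    have e2 : 0.15 * r ^ 2 * (10 * (M / A) + 8 * (θ ^ 2 / A ^ 2))
        = 1.5 * (M * r ^ 2 / A) + 1.2 * (θ ^ 2 * r ^ 2 / A ^ 2) := by ring
    rw [e1, e2, hMr, hθr]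
    have hkq : k * q ^ 2 / 2 ≤ 1.01 * q ^ 2 / 2 := by gcongr
    have hB2 : B ^ 2 ≤ p ^ 2 / 4 + 0.01 * p * q + 0.77 * q ^ 2 := by
      have a1 : q ^ 2 * q ≤ q ^ 2 := mul_le_of_le_one_right (sq_nonneg q) hq1
      have a2 : q ^ 2 * p ≤ q ^ 2 := mul_le_of_le_one_right (sq_nonneg q) hp1
      have a3 : q ^ 2 * q ^ 2 ≤ q ^ 2 := mul_le_of_le_one_right (sq_nonneg q) (by nlinarith)
      have e : B ^ 2 = p ^ 2 / 4 + 0.01 * p * q + q ^ 2 * p / 2 + 0.0001 * q ^ 2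
          + 0.01 * (q ^ 2 * q) + q ^ 2 * q ^ 2 / 4 := by rw [hB]; ring
      rw [e]
      linarith [sq_nonneg q]
    have hpq2 : p * q ≤ (p ^ 2 + q ^ 2) / 2 := by linarith [two_mul_le_add_sq p q]
    have hu3 : u ^ 2 ≤ 1.0201 * B ^ 2 := by rw [mul_pow] at hu2; norm_num at hu2 ⊢; exact hu2
    have hB3 : B ^ 2 ≤ p ^ 2 / 4 + 0.01 * ((p ^ 2 + q ^ 2) / 2) + 0.77 * q ^ 2 := by
      rw [mul_assoc] at hB2; linarith
    linarith [sq_nonneg p, sq_nonneg q]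

section Step

variable {d m : ℕ} {Ξ : Type*} {f : Fin (m + 1) → Space d → ℝ} {L : Fin (m + 1) → ℝ} {R β : ℝ}
  {x₀ : Space d}

/-- The estimates that a batch `s` yields at `x` are close to the quantities they stand for:
up to one percent for the slacks `-fⁱ(x)`, the directional derivatives and the Lipschitz constant
`Lc`, and up to `E` for the gradient of the barrier. -/
structure Alg.IsReliable (P : Alg d m Ξ) (f : Fin (m + 1) → Space d → ℝ) (Lc E : ℝ)
    (x : Space d) (s : ℕ → Ξ) : Prop where
  le_αLow : ∀ i : Fin m, 0.99 * -f i.succ x ≤ P.αLow i x s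
  αLow_le : ∀ i : Fin m, P.αLow i x s ≤ 1.01 * -f i.succ x
  inner_le : ∀ i : Fin m, |⟪gradient (f i.succ) x, P.g x s⟫|
    ≤ (P.θHat i x s + 0.01 * √(P.αLow i x s * P.M i.succ)) * ‖P.g x s‖
  θHat_nonneg : ∀ i : Fin m, 0 ≤ P.θHat i x s
  θHat_le : ∀ i : Fin m, P.θHat i x s ≤ 1.01 * Lc
  grad_err : ‖P.g x s - barrierGrad f P.η x‖ ≤ E

variable {P : Alg d m Ξ} {Lc E : ℝ} {x : Space d} {s : ℕ → Ξ}

lemma Alg.IsReliable.αLow_pos (hP : P.IsReliable f Lc E x s) (hx : x ∈ strictlyFeasible f)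
    (i : Fin m) : 0 < P.αLow i x s := by
  have := hP.le_αLow i
  have := hx i
  norm_num at *
  linarith

lemma Alg.IsReliable.M2Hat_ge (hP : P.IsReliable f Lc E x s) (hx : x ∈ strictlyFeasible f)
    (hη : 0 < P.η) (hM : ∀ i, 0 < P.M i) : P.M 0 ≤ P.M2Hat x s := by
  have h1 : 0 ≤ ∑ i : Fin m, P.M i.succ / P.αLow i x s :=
    Finset.sum_nonneg fun i _ ↦ div_nonneg (hM _).le (hP.αLow_pos hx i).le
  have h2 : 0 ≤ ∑ i : Fin m, P.θHat i x s ^ 2 / P.αLow i x s ^ 2 :=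
    Finset.sum_nonneg fun i _ ↦ by positivity
  have h3 : 0 ≤ 10 * P.η * ∑ i : Fin m, P.M i.succ / P.αLow i x s := by positivity
  have h4 : 0 ≤ 8 * P.η * ∑ i : Fin m, P.θHat i x s ^ 2 / P.αLow i x s ^ 2 := by positivity
  rw [Alg.M2Hat]
  linarith

lemma Alg.IsReliable.M2Hat_pos (hP : P.IsReliable f Lc E x s) (hx : x ∈ strictlyFeasible f)
    (hη : 0 < P.η) (hM : ∀ i, 0 < P.M i) : 0 < P.M2Hat x s :=
  (hM 0).trans_le (hP.M2Hat_ge hx hη hM)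

lemma Alg.IsReliable.le_γ (hP : P.IsReliable f Lc E x s) (hm : 1 ≤ m) {a : ℝ}
    (h1 : ∀ i : Fin m, a * (2 * P.θHat i x s + √(P.αLow i x s * P.M i.succ)) * ‖P.g x s‖
      ≤ P.αLow i x s)
    (hpos : ∀ i : Fin m, 0 < 2 * P.θHat i x s + √(P.αLow i x s * P.M i.succ))
    (h2 : a ≤ 1 / P.M2Hat x s) : a ≤ P.γ x s := by
  have : Nonempty (Fin m) := ⟨⟨0, hm⟩⟩
  rw [Alg.γ]
  split_ifs with hg
  · exact h2
  · have hgn : 0 < ‖P.g x s‖ := norm_pos_iff.2 hg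
    refine le_min ?_ h2
    rw [mul_one_div, le_div_iff₀ hgn]
    refine le_ciInf fun i ↦ ?_
    rw [abs_of_nonneg (hP.θHat_nonneg i), le_div_iff₀ (hpos i)]
    linarith [h1 i]

lemma Alg.IsReliable.scale_pos (hP : P.IsReliable f Lc E x s) (hx : x ∈ strictlyFeasible f)
    (hM : ∀ i, 0 < P.M i) (i : Fin m) :
    0 < 2 * P.θHat i x s + √(P.αLow i x s * P.M i.succ) := by
  have h1 := hP.αLow_pos hx i
  have h2 := hM i.succ
  have h3 := hP.θHat_nonneg i
  positivity

lemma Alg.IsReliable.γ_pos (hP : P.IsReliable f Lc E x s) (hm : 1 ≤ m)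
    (hx : x ∈ strictlyFeasible f) (hη : 0 < P.η) (hM : ∀ i, 0 < P.M i) : 0 < P.γ x s := by
  have : Nonempty (Fin m) := ⟨⟨0, hm⟩⟩
  have hM2 := hP.M2Hat_pos hx hη hM
  rw [Alg.γ]
  split_ifs with hg
  · positivity
  · have hgn : 0 < ‖P.g x s‖ := norm_pos_iff.2 hg
    refine lt_min (mul_pos ?_ (by positivity)) (by positivity)
    obtain ⟨i, hi⟩ := exists_eq_ciInf_of_finite (f := fun i : Fin m ↦
      P.αLow i x s / (2 * |P.θHat i x s| + √(P.αLow i x s * P.M i.succ)))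
    rw [← hi, abs_of_nonneg (hP.θHat_nonneg i)]
    exact div_pos (hP.αLow_pos hx i) (hP.scale_pos hx hM i)

lemma Alg.IsReliable.γ_mul_M2Hat_le (hP : P.IsReliable f Lc E x s)
    (hx : x ∈ strictlyFeasible f) (hη : 0 < P.η) (hM : ∀ i, 0 < P.M i) :
    P.γ x s * P.M2Hat x s ≤ 1 := by
  have hM2 := hP.M2Hat_pos hx hη hM
  rw [← le_div_iff₀ hM2, Alg.γ]
  split_ifs with hg
  · exact le_rfl
  · exact min_le_right _ _

lemma Alg.IsReliable.γ_mul_norm_le (hP : P.IsReliable f Lc E x s)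
    (hx : x ∈ strictlyFeasible f) (hM : ∀ i, 0 < P.M i) (i : Fin m) :
    P.γ x s * ‖P.g x s‖ * (2 * P.θHat i x s + √(P.αLow i x s * P.M i.succ)) ≤ P.αLow i x s := by
  have hs := hP.scale_pos hx hM i
  rw [← le_div_iff₀ hs, Alg.γ]
  split_ifs with hg
  · rw [hg, norm_zero, mul_zero]
    exact div_nonneg (hP.αLow_pos hx i).le hs.le
  · have hgn : 0 < ‖P.g x s‖ := norm_pos_iff.2 hg
    refine (mul_le_mul_of_nonneg_right (min_le_left _ _) hgn.le).trans ?_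
    rw [one_div, mul_assoc, inv_mul_cancel₀ hgn.ne', mul_one]
    refine (ciInf_le (Set.finite_range _).bddBelow i).trans_eq ?_
    rw [abs_of_nonneg (hP.θHat_nonneg i)]

/-- The relative decrease of the `i`-th slack along a step of length at most `γ`, as long as the
target is feasible, which is where smoothness is available. -/
lemma IsConvexProblem.slack_step (h : IsConvexProblem L P.M R β f x₀)
    (hP : P.IsReliable f Lc E x s) (hx : x ∈ strictlyFeasible f) (hM : ∀ i, 0 < P.M i)
    {t : ℝ} (ht₀ : 0 ≤ t) (ht : t ≤ P.γ x s) (hf : x - t • P.g x s ∈ feasible f) (i : Fin m) :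
    0.48 * -f i.succ x ≤ -f i.succ (x - t • P.g x s) ∧
    Real.log (-f i.succ x) - Real.log (-f i.succ (x - t • P.g x s))
      ≤ -(t * ((-f i.succ x)⁻¹ * ⟪gradient (f i.succ) x, P.g x s⟫))
        + 0.15 * (t * ‖P.g x s‖) ^ 2 * (10 * (P.M i.succ / P.αLow i x s)
          + 8 * (P.θHat i x s ^ 2 / P.αLow i x s ^ 2)) := by
  have hα : 0 < -f i.succ x := by linarith [hx i]
  have hA := hP.αLow_pos hx i
  have hs := hP.scale_pos hx hM i
  set g := P.g x s with hg
  have hrle : t * ‖g‖ * (2 * P.θHat i x s + √(P.αLow i x s * P.M i.succ)) ≤ P.αLow i x s :=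
    le_trans (by gcongr) (hP.γ_mul_norm_le hx hM i)
  have hti : |-(t * ⟪gradient (f i.succ) x, g⟫)|
      ≤ (P.θHat i x s + 0.01 * √(P.αLow i x s * P.M i.succ)) * (t * ‖g‖) := by
    rw [abs_neg, abs_mul, abs_of_nonneg ht₀]
    calc _ ≤ t * ((P.θHat i x s + 0.01 * √(P.αLow i x s * P.M i.succ)) * ‖g‖) := by
          gcongr; exact hP.inner_le i
      _ = _ := by ring
  obtain ⟨hu, hω⟩ := relative_decrease_bounds hα hA (hP.αLow_le i) (hM i.succ)
    (hP.θHat_nonneg i) (by positivity) hrle hti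
  set u := (-(t * ⟪gradient (f i.succ) x, g⟫) + P.M i.succ * (t * ‖g‖) ^ 2 / 2) / -f i.succ x
    with hu'
  have hsm := h.smooth i.succ _ hf x (strictlyFeasible_subset hx)
  have e : x - t • g - x = -(t • g) := by abel
  rw [e, inner_neg_right, real_inner_smul_right, norm_neg, norm_smul, Real.norm_of_nonneg ht₀]
    at hsm
  have hαu : -f i.succ x * (1 - u) ≤ -f i.succ (x - t • g) := by
    have : -f i.succ x * u = -(t * ⟪gradient (f i.succ) x, g⟫)
        + P.M i.succ * (t * ‖g‖) ^ 2 / 2 := by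
      rw [hu', mul_div_cancel₀ _ hα.ne']
    rw [mul_sub, this]
    linarith
  have h1u : 0.48 ≤ 1 - u := by norm_num at hu ⊢; linarith
  have h1u' : 0 < 1 - u := lt_of_lt_of_le (by norm_num) h1u
  constructor
  · calc 0.48 * -f i.succ x ≤ (1 - u) * -f i.succ x := by gcongr
      _ ≤ _ := by linarith
  · have hlog : Real.log (-f i.succ x) + Real.log (1 - u)
        ≤ Real.log (-f i.succ (x - t • g)) := by
      rw [← Real.log_mul hα.ne' h1u'.ne']
      exact Real.log_le_log (by positivity) hαu
    have h2 := neg_log_one_sub_le hu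
    have h3 : u = -(t * ((-f i.succ x)⁻¹ * ⟪gradient (f i.succ) x, g⟫))
        + P.M i.succ * (t * ‖g‖) ^ 2 / (2 * -f i.succ x) := by
      rw [hu', add_div]; ring
    linarith

/-- The algorithm never leaves the domain of the barrier. -/
lemma IsConvexProblem.next_mem (h : IsConvexProblem L P.M R β f x₀)
    (hP : P.IsReliable f Lc E x s) (hm : 1 ≤ m) (hx : x ∈ strictlyFeasible f) (hη : 0 < P.η)
    (hM : ∀ i, 0 < P.M i) : x - P.γ x s • P.g x s ∈ strictlyFeasible f := by
  by_contra hn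
  -- Otherwise the step passes through a feasible point with an active constraint, contrary to the
  -- bound for the slacks at feasible points of the step.
  obtain ⟨t, ht₀, ht₁, hf, i, hi⟩ := h.exists_active hx hn
  have hγ := hP.γ_pos hm hx hη hM
  have e : x + t • (x - P.γ x s • P.g x s - x) = x - (t * P.γ x s) • P.g x s := by
    rw [sub_sub_cancel_left, smul_neg, smul_smul]; abel
  rw [e] at hf hi
  have h1 := (h.slack_step hP hx hM (t := t * P.γ x s) (by positivity)
    (mul_le_of_le_one_left hγ.le ht₁) hf i).1
  rw [hi] at h1
  have := hx i
  norm_num at h1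
  linarith

/-- The part of the smoothness estimate `M̂₂(x)` that is due to the constraints. -/
def Alg.curvature (P : Alg d m Ξ) (x : Space d) (s : ℕ → Ξ) : ℝ :=
  P.η * ∑ i : Fin m, (10 * (P.M i.succ / P.αLow i x s)
    + 8 * (P.θHat i x s ^ 2 / P.αLow i x s ^ 2))

lemma Alg.M2Hat_eq (P : Alg d m Ξ) (x : Space d) (s : ℕ → Ξ) :
    P.M2Hat x s = P.M 0 + P.curvature x s := by
  rw [Alg.M2Hat, Alg.curvature, Finset.sum_add_distrib, ← Finset.mul_sum, ← Finset.mul_sum]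
  ring

lemma Alg.IsReliable.curvature_nonneg (hP : P.IsReliable f Lc E x s)
    (hx : x ∈ strictlyFeasible f) (hη : 0 < P.η) (hM : ∀ i, 0 < P.M i) :
    0 ≤ P.curvature x s := by
  have := hP.M2Hat_ge hx hη hM
  rw [Alg.M2Hat_eq] at this
  linarith

/-- Change of the logarithmic potential of a subset of the constraints in one step. -/
lemma IsConvexProblem.sum_log_step (h : IsConvexProblem L P.M R β f x₀)
    (hP : P.IsReliable f Lc E x s) (hm : 1 ≤ m) (hx : x ∈ strictlyFeasible f) (hη : 0 < P.η)
    (hM : ∀ i, 0 < P.M i) (I : Finset (Fin m)) :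
    P.η * ∑ i ∈ I, (Real.log (-f i.succ x) - Real.log (-f i.succ (x - P.γ x s • P.g x s)))
      ≤ -(P.γ x s * (P.η * ∑ i ∈ I, (-f i.succ x)⁻¹ * ⟪gradient (f i.succ) x, P.g x s⟫))
        + 0.15 * (P.γ x s * ‖P.g x s‖) ^ 2 * P.curvature x s := by
  have hγ := hP.γ_pos hm hx hη hM
  have hn := strictlyFeasible_subset (h.next_mem hP hm hx hη hM)
  have h1 := Finset.sum_le_sum fun i (_ : i ∈ I) ↦
    (h.slack_step hP hx hM hγ.le le_rfl hn i).2
  rw [Finset.sum_add_distrib, Finset.sum_neg_distrib, ← Finset.mul_sum, ← Finset.mul_sum] at h1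
  have h2 : ∑ i ∈ I, (10 * (P.M i.succ / P.αLow i x s)
      + 8 * (P.θHat i x s ^ 2 / P.αLow i x s ^ 2)) ≤ ∑ i : Fin m, (10 * (P.M i.succ / P.αLow i x s)
      + 8 * (P.θHat i x s ^ 2 / P.αLow i x s ^ 2)) := by
    refine Finset.sum_le_univ_sum_of_nonneg fun i ↦ ?_
    have := hP.αLow_pos hx i
    have := hM i.succ
    positivity
  calc _ ≤ P.η * (-(P.γ x s * ∑ i ∈ I, (-f i.succ x)⁻¹ * ⟪gradient (f i.succ) x, P.g x s⟫)
        + 0.15 * (P.γ x s * ‖P.g x s‖) ^ 2 * ∑ i : Fin m, (10 * (P.M i.succ / P.αLow i x s)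
        + 8 * (P.θHat i x s ^ 2 / P.αLow i x s ^ 2))) := by
        refine mul_le_mul_of_nonneg_left (h1.trans ?_) hη.le
        gcongr
    _ = _ := by rw [Alg.curvature]; ring

/-- Descent of the barrier. The constraints contribute less than a third of the curvature that
the step size accounts for. -/
lemma IsConvexProblem.logBarrier_step (h : IsConvexProblem L P.M R β f x₀)
    (hP : P.IsReliable f Lc E x s) (hm : 1 ≤ m) (hx : x ∈ strictlyFeasible f) (hη : 0 < P.η)
    (hM : ∀ i, 0 < P.M i) :
    logBarrier f P.η (x - P.γ x s • P.g x s) ≤ logBarrier f P.η x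
      - P.γ x s * ⟪barrierGrad f P.η x, P.g x s⟫
      + (P.γ x s * ‖P.g x s‖) ^ 2 / 2 * (P.M 0 + 0.3 * P.curvature x s) := by
  have hγ := hP.γ_pos hm hx hη hM
  have hn := strictlyFeasible_subset (h.next_mem hP hm hx hη hM)
  have h1 := h.sum_log_step hP hm hx hη hM Finset.univ
  rw [Finset.sum_sub_distrib] at h1
  have hsm := h.smooth 0 _ hn x (strictlyFeasible_subset hx)
  have e : x - P.γ x s • P.g x s - x = -(P.γ x s • P.g x s) := by abel
  rw [e, inner_neg_right, real_inner_smul_right, norm_neg, norm_smul, Real.norm_of_nonneg hγ.le]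
    at hsm
  rw [inner_barrierGrad, logBarrier, logBarrier]
  linarith

end Step

/-! ### The safety margin is preserved -/

section Margin

variable {d m : ℕ} {Ξ : Type*} {f : Fin (m + 1) → Space d → ℝ} {L : Fin (m + 1) → ℝ} {R β : ℝ}
  {x₀ : Space d}

/-- An upper bound for all products of the quotients `η / (-fⁱ(x))` over nonempty sets of
constraints. The bound for singletons is the one of interest; the others make it stable. -/
def HasMargin (f : Fin (m + 1) → Space d → ℝ) (η Λ : ℝ) (x : Space d) : Prop :=
  ∀ I : Finset (Fin m), I.Nonempty →
    ∏ i ∈ I, η / -f i.succ x ≤ (2 / 5 * Λ ^ (m + 1 - I.card)) ^ I.card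

lemma HasMargin.div_le {η Λ : ℝ} {x : Space d} (h : HasMargin f η Λ x) (i : Fin m) :
    η / -f i.succ x ≤ 2 / 5 * Λ ^ m := by
  simpa using h {i} (Finset.singleton_nonempty i)

/-- If the product over `I` is close to its upper bound, then the bound for the sets
`insert j I` forces the quotients outside of `I` to be negligible. -/
lemma dominant_of_lt_prod {z : Fin m → ℝ} (hz : ∀ i, 0 < z i) {Λ : ℝ} (hΛ : 8 * m + 4 ≤ Λ)
    (hinv : ∀ I : Finset (Fin m), I.Nonempty →
      ∏ i ∈ I, z i ≤ (2 / 5 * Λ ^ (m + 1 - I.card)) ^ I.card)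
    {I : Finset (Fin m)} (hI : I.Nonempty)
    (hlt : (0.48 * (2 / 5 * Λ ^ (m + 1 - I.card))) ^ I.card < ∏ i ∈ I, z i) :
    (m : ℝ) ≤ ∑ i ∈ I, z i ∧
      2.25 * (1 + ∑ i ∈ Iᶜ, z i) * Λ ≤ (8 * m + 4) * ∑ i ∈ I, z i := by
  set k := I.card with hk
  have hk1 : 1 ≤ k := hI.card_pos
  have hkm : k ≤ m := by simpa using Finset.card_le_univ I
  have hm1 : (1 : ℝ) ≤ m := by exact_mod_cast hk1.trans hkm
  have hΛ12 : 12 ≤ Λ := by linarith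
  have hΛ0 : 0 < Λ := by linarith
  set b := 2 / 5 * Λ ^ (m + 1 - k) with hb
  have hb0 : 0 < b := by positivity
  have hbΛ : 2 / 5 * Λ ≤ b := by
    rw [hb]
    gcongr
    calc Λ = Λ ^ 1 := (pow_one Λ).symm
      _ ≤ Λ ^ (m + 1 - k) := pow_le_pow_right₀ (by linarith) (by omega)
  -- Some factor of the product is large, hence so is the sum over `I`.
  obtain ⟨i, hiI, hi⟩ : ∃ i ∈ I, 0.48 * b < z i := by
    by_contra! hcon
    have := Finset.prod_le_prod (fun i (_ : i ∈ I) ↦ (hz i).le) hcon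
    rw [Finset.prod_const] at this
    exact absurd hlt (not_lt.2 this)
  have hS : 0.48 * b ≤ ∑ i ∈ I, z i :=
    hi.le.trans (Finset.single_le_sum (fun i _ ↦ (hz i).le) hiI)
  set S := ∑ i ∈ I, z i with hS'
  have hSb : 0.48 * (2 / 5 * Λ) ≤ S := le_trans (by gcongr) hS
  refine ⟨by norm_num at hSb; linarith, ?_⟩
  -- Divide the upper bound for the product over `insert j I` by the lower bound for that over `I`.
  have hout : ∀ j ∈ Iᶜ, z j * Λ ≤ b / 5 := by
    intro j hj
    have hjI : j ∉ I := Finset.mem_compl.1 hj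
    have hins := hinv (insert j I) (Finset.insert_nonempty j I)
    rw [Finset.prod_insert hjI, Finset.card_insert_of_notMem hjI, ← hk] at hins
    have hkm' : k + 1 ≤ m := by
      have := Finset.card_le_univ (insert j I)
      rwa [Finset.card_insert_of_notMem hjI, Fintype.card_fin] at this
    set b' := 2 / 5 * Λ ^ (m + 1 - (k + 1)) with hb'
    have hbb : b = b' * Λ := by
      rw [hb, hb', show m + 1 - k = m + 1 - (k + 1) + 1 by omega, pow_succ]; ring
    have hb'0 : 0 < b' := by positivity
    have h1 : z j * (0.48 * b) ^ k ≤ b' ^ (k + 1) := le_trans (by gcongr; exact (hz j).le) hins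
    have h2 : z j * (0.48 * Λ) ^ k ≤ b' := by
      have e : z j * (0.48 * b) ^ k = z j * (0.48 * Λ) ^ k * b' ^ k := by
        rw [show 0.48 * b = 0.48 * Λ * b' by rw [hbb]; ring, mul_pow, mul_assoc]
      rw [e, pow_succ'] at h1
      exact le_of_mul_le_mul_right h1 (by positivity)
    have h3 : (5 : ℝ) ≤ (0.48 * Λ) ^ k := by
      calc (5 : ℝ) ≤ 0.48 * Λ := by norm_num; linarith
        _ = (0.48 * Λ) ^ 1 := (pow_one _).symm
        _ ≤ _ := pow_le_pow_right₀ (by norm_num; linarith) hk1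
    have h4 : z j * 5 ≤ b' := le_trans (by gcongr; exact (hz j).le) h2
    rw [hbb]
    nlinarith
  have hsum : (∑ j ∈ Iᶜ, z j) * Λ ≤ (m - k : ℝ) * (b / 5) := by
    rw [Finset.sum_mul]
    refine (Finset.sum_le_sum hout).trans_eq ?_
    rw [Finset.sum_const, Finset.card_compl, Fintype.card_fin, nsmul_eq_mul, Nat.cast_sub hkm]
  have hk1' : (1 : ℝ) ≤ k := by exact_mod_cast hk1
  have hmain : 2.25 * Λ + 2.25 * ((m - k : ℝ) * (b / 5)) ≤ (8 * m + 4) * (0.48 * b) := by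
    rcases hkm.eq_or_lt with hkm | hkm
    · rw [hkm, sub_self, zero_mul, mul_zero, add_zero]
      norm_num at hbΛ ⊢
      nlinarith
    · have hm2 : (2 : ℝ) ≤ m := by exact_mod_cast (by omega : 2 ≤ m)
      norm_num at hbΛ ⊢
      nlinarith
  calc _ = 2.25 * Λ + 2.25 * ((∑ j ∈ Iᶜ, z j) * Λ) := by ring
    _ ≤ 2.25 * Λ + 2.25 * ((m - k : ℝ) * (b / 5)) := by gcongr
    _ ≤ (8 * m + 4) * (0.48 * b) := hmain
    _ ≤ _ := by gcongr

variable {P : Alg d m Ξ} {E ρ Λ : ℝ} {x : Space d} {s : ℕ → Ξ}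

/-- The part of the barrier gradient due to a set `I` of constraints with small slack is large,
because each of these gradients has a component of definite size in the direction `x - x₀`. -/
lemma IsConvexProblem.le_norm_sum_gradient (h : IsConvexProblem L P.M R β f x₀) (hR : 0 < R)
    (hβ : 0 < β) {η : ℝ} (hη : 0 < η) (hηρ : η ≤ ρ) (hx : x ∈ strictlyFeasible f)
    {I : Finset (Fin m)} (hI : (m : ℝ) ≤ ∑ i ∈ I, η / -f i.succ x) :
    (β - ρ) / R * ∑ i ∈ I, η / -f i.succ x
      ≤ ‖η • ∑ i ∈ I, (-f i.succ x)⁻¹ • gradient (f i.succ) x‖ := by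
  set S := ∑ i ∈ I, η / -f i.succ x with hS
  set v := η • ∑ i ∈ I, (-f i.succ x)⁻¹ • gradient (f i.succ) x with hv
  have h1 : β * S - I.card * η ≤ ⟪v, x - x₀⟫ := by
    have e : ⟪v, x - x₀⟫ = ∑ i ∈ I, η / -f i.succ x * ⟪gradient (f i.succ) x, x - x₀⟫ := by
      rw [hv, real_inner_smul_left, sum_inner, Finset.mul_sum]
      refine Finset.sum_congr rfl fun i _ ↦ ?_
      rw [real_inner_smul_left, div_eq_mul_inv, mul_assoc]
    rw [e, hS, Finset.mul_sum, ← nsmul_eq_mul, ← Finset.sum_const, ← Finset.sum_sub_distrib]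
    refine Finset.sum_le_sum fun i _ ↦ ?_
    have hα : 0 < -f i.succ x := by linarith [hx i]
    have h2 := h.inner_gradient_le i.succ (strictlyFeasible_subset hx) x₀
    rw [← neg_sub, inner_neg_right] at h2
    have h3 := h.start i
    calc β * (η / -f i.succ x) - η = η / -f i.succ x * (β - -f i.succ x) := by
          rw [mul_sub, div_mul_cancel₀ _ hα.ne', mul_comm]
      _ ≤ _ := by gcongr; linarith
  have h2 : (I.card : ℝ) * η ≤ S * ρ := by
    have : (I.card : ℝ) ≤ m := by exact_mod_cast (by simpa using Finset.card_le_univ I)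
    calc (I.card : ℝ) * η ≤ m * ρ := by gcongr
      _ ≤ S * ρ := by gcongr; linarith
  have h3 : ⟪v, x - x₀⟫ ≤ ‖v‖ * R := (real_inner_le_norm _ _).trans (by
    gcongr
    exact h.diam x (strictlyFeasible_subset hx) x₀ (strictlyFeasible_subset (h.start_mem hβ)))
  rw [div_mul_eq_mul_div, div_le_iff₀ hR]
  nlinarith

lemma IsConvexProblem.norm_grad_add_le (h : IsConvexProblem L P.M R β f x₀) (hL : ∀ i, 0 < L i)
    {η : ℝ} (hη : 0 < η) (hx : x ∈ strictlyFeasible f) (I : Finset (Fin m)) :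
    ‖gradient (f 0) x + η • ∑ i ∈ I, (-f i.succ x)⁻¹ • gradient (f i.succ) x‖
      ≤ maxConst L * (1 + ∑ i ∈ I, η / -f i.succ x) := by
  rw [Finset.smul_sum, mul_add, mul_one, Finset.mul_sum]
  refine (norm_add_le _ _).trans (add_le_add
    ((h.norm_gradient_le hL 0 hx).trans (le_maxConst L 0))
    ((norm_sum_le _ _).trans (Finset.sum_le_sum fun i _ ↦ ?_)))
  have hα : 0 < -f i.succ x := by linarith [hx i]
  rw [smul_smul, norm_smul, ← div_eq_mul_inv, Real.norm_of_nonneg (by positivity), mul_comm]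
  gcongr
  exact (h.norm_gradient_le hL i.succ hx).trans (le_maxConst L i.succ)

/-- The margin is preserved: where the product over `I` comes close to its upper bound, the
constraints in `I` dominate the gradient of the barrier, and the step increases the product of
their slacks. -/
lemma IsConvexProblem.hasMargin_next (h : IsConvexProblem L P.M R β f x₀)
    (hP : P.IsReliable f (maxConst L) E x s) (hm : 1 ≤ m) (hx : x ∈ strictlyFeasible f)
    (hη : 0 < P.η) (hM : ∀ i, 0 < P.M i) (hL : ∀ i, 0 < L i) (hR : 0 < R) (hβ : 0 < β)
    (hηρ : P.η ≤ ρ) (hE : E ≤ 0.02 * maxConst L) (hΛ : 8 * m + 4 ≤ Λ)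
    (hΛl : (β - ρ) / R * Λ = maxConst L * (8 * m + 4)) (hinv : HasMargin f P.η Λ x) :
    HasMargin f P.η Λ (x - P.γ x s • P.g x s) := by
  have hLc := maxConst_pos hL
  have hγ := hP.γ_pos hm hx hη hM
  have hx' := h.next_mem hP hm hx hη hM
  set x' := x - P.γ x s • P.g x s with hx'def
  have hα : ∀ i : Fin m, 0 < -f i.succ x := fun i ↦ by linarith [hx i]
  have hα' : ∀ i : Fin m, 0 < -f i.succ x' := fun i ↦ by linarith [hx' i]
  intro I hI
  by_contra! hcon
  have hΛ0 : 0 < Λ := by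
    have : (0 : ℝ) ≤ m := Nat.cast_nonneg m
    linarith
  set b := 2 / 5 * Λ ^ (m + 1 - I.card) with hb
  -- A step leaves at least the fraction `0.48` of each slack, so that the product was already close
  -- to its bound before the step.
  have hlt : (0.48 * b) ^ I.card < ∏ i ∈ I, P.η / -f i.succ x := by
    have h1 : ∏ i ∈ I, (0.48 * (P.η / -f i.succ x')) ≤ ∏ i ∈ I, P.η / -f i.succ x := by
      refine Finset.prod_le_prod (fun i _ ↦ ?_) fun i _ ↦ ?_
      · have := hα' i
        positivity
      · have h2 := (h.slack_step hP hx hM hγ.le le_rfl (strictlyFeasible_subset hx') i).1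
        have := hα i
        have := hα' i
        rw [← mul_div_assoc, div_le_div_iff₀ (hα' i) (hα i)]
        nlinarith
    rw [Finset.prod_mul_distrib, Finset.prod_const] at h1
    rw [mul_pow]
    exact lt_of_lt_of_le (by gcongr) h1
  obtain ⟨hS, hdom⟩ := dominant_of_lt_prod (z := fun i ↦ P.η / -f i.succ x)
    (fun i ↦ div_pos hη (hα i)) hΛ hinv hI hlt
  set S := ∑ i ∈ I, P.η / -f i.succ x with hSdef
  set W := maxConst L * (1 + ∑ i ∈ Iᶜ, P.η / -f i.succ x) with hW
  have hWL : maxConst L ≤ W := by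
    rw [hW]
    have : 0 ≤ ∑ i ∈ Iᶜ, P.η / -f i.succ x :=
      Finset.sum_nonneg fun i _ ↦ (div_pos hη (hα i)).le
    nlinarith
  -- The part `v` of the barrier gradient that is due to `I` outweighs the remaining part `w`; hence
  -- the step has a definite component along `-v` and does not increase the product over `I`.
  set v := P.η • ∑ i ∈ I, (-f i.succ x)⁻¹ • gradient (f i.succ) x with hv
  set w := gradient (f 0) x + P.η • ∑ i ∈ Iᶜ, (-f i.succ x)⁻¹ • gradient (f i.succ) x with hw
  have hwW : ‖w‖ ≤ W := h.norm_grad_add_le hL hη hx Iᶜ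
  have hvS : (β - ρ) / R * S ≤ ‖v‖ := h.le_norm_sum_gradient hR hβ hη hηρ hx hS
  have hvW : 2.25 * W ≤ ‖v‖ := by
    refine le_trans (le_of_mul_le_mul_right ?_ hΛ0) hvS
    calc 2.25 * W * Λ = maxConst L * (2.25 * (1 + ∑ i ∈ Iᶜ, P.η / -f i.succ x) * Λ) := by
          rw [hW]; ring
      _ ≤ maxConst L * ((8 * m + 4) * S) := by gcongr
      _ = (β - ρ) / R * Λ * S := by rw [hΛl]; ring
      _ = _ := by ring
  have hsplit : barrierGrad f P.η x = w + v := by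
    rw [barrierGrad, hw, hv, add_assoc, ← smul_add, add_comm (∑ i ∈ Iᶜ, _),
      Finset.sum_add_sum_compl]
  set g := P.g x s with hg
  have herr : ‖g - (w + v)‖ ≤ E := by rw [← hsplit]; exact hP.grad_err
  have hgn : 1.23 * W ≤ ‖g‖ := by
    have h1 : ‖v‖ ≤ ‖g‖ + ‖w‖ + ‖g - (w + v)‖ := by
      calc ‖v‖ = ‖g - w - (g - (w + v))‖ := by congr 1; abel
        _ ≤ ‖g - w‖ + ‖g - (w + v)‖ := norm_sub_le _ _
        _ ≤ _ := by gcongr; exact norm_sub_le _ _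
    norm_num at hvW hE ⊢
    linarith
  have hinner : 0.15 * ‖g‖ ^ 2 ≤ ⟪v, g⟫ := by
    have e : ⟪v, g⟫ = ‖g‖ ^ 2 - ⟪w, g⟫ - ⟪g - (w + v), g⟫ := by
      have e1 : ⟪g - (w + v), g⟫ = ⟪g, g⟫ - (⟪w, g⟫ + ⟪v, g⟫) :=
        (inner_sub_left g (w + v) g).trans (congrArg _ (inner_add_left w v g))
      rw [e1, real_inner_self_eq_norm_sq]; ring
    have h1 : ⟪w, g⟫ ≤ W * ‖g‖ := (real_inner_le_norm _ _).trans (by gcongr)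
    have h2 : ⟪g - (w + v), g⟫ ≤ E * ‖g‖ := (real_inner_le_norm _ _).trans (by gcongr)
    rw [e]
    have h3 : W + E ≤ 0.85 * ‖g‖ := by norm_num at hgn hE ⊢; linarith
    norm_num at h3 ⊢
    nlinarith [norm_nonneg g]
  have hlog := h.sum_log_step hP hm hx hη hM I
  rw [← hg, ← hx'def] at hlog
  have e : P.η * ∑ i ∈ I, (-f i.succ x)⁻¹ * ⟪gradient (f i.succ) x, g⟫ = ⟪v, g⟫ := by
    rw [hv, real_inner_smul_left, sum_inner]
    simp only [real_inner_smul_left]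
  rw [e] at hlog
  have hcurv : P.γ x s * P.curvature x s ≤ 1 := by
    have h1 := hP.γ_mul_M2Hat_le hx hη hM
    rw [Alg.M2Hat_eq, mul_add] at h1
    have := mul_pos hγ (hM 0)
    linarith
  have hneg : P.η * ∑ i ∈ I, (Real.log (-f i.succ x) - Real.log (-f i.succ x')) ≤ 0 := by
    have h1 : 0.15 * (P.γ x s * ‖g‖) ^ 2 * P.curvature x s ≤ P.γ x s * (0.15 * ‖g‖ ^ 2) := by
      calc _ = P.γ x s * (0.15 * ‖g‖ ^ 2) * (P.γ x s * P.curvature x s) := by ring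
        _ ≤ P.γ x s * (0.15 * ‖g‖ ^ 2) * 1 := by gcongr
        _ = _ := mul_one _
    have h2 := mul_le_mul_of_nonneg_left hinner hγ.le
    linarith
  have hneg' : ∑ i ∈ I, (Real.log (-f i.succ x) - Real.log (-f i.succ x')) ≤ 0 := by
    by_contra! hc
    linarith [mul_pos hη hc]
  have hprod : ∏ i ∈ I, P.η / -f i.succ x' ≤ ∏ i ∈ I, P.η / -f i.succ x := by
    rw [← Real.log_le_log_iff (Finset.prod_pos fun i _ ↦ div_pos hη (hα' i))
      (Finset.prod_pos fun i _ ↦ div_pos hη (hα i)),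
      Real.log_prod fun i _ ↦ (div_pos hη (hα' i)).ne',
      Real.log_prod fun i _ ↦ (div_pos hη (hα i)).ne', ← sub_nonpos, ← Finset.sum_sub_distrib]
    refine le_trans (le_of_eq (Finset.sum_congr rfl fun i _ ↦ ?_)) hneg'
    rw [Real.log_div hη.ne' (hα' i).ne', Real.log_div hη.ne' (hα i).ne']
    ring
  linarith [hinv I hI]

lemma IsConvexProblem.hasMargin_start {M : Fin (m + 1) → ℝ} (h : IsConvexProblem L M R β f x₀)
    {η : ℝ} (hη : 0 < η) (hηβ : η ≤ β / 2) (hΛ : 8 * m + 4 ≤ Λ) :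
    HasMargin f η Λ x₀ := by
  intro I hI
  have hΛ4 : 4 ≤ Λ := by
    have : (0 : ℝ) ≤ m := Nat.cast_nonneg m
    linarith
  have hkm : I.card ≤ m := by simpa using Finset.card_le_univ I
  have h1 : ∏ i ∈ I, η / -f i.succ x₀ ≤ 1 := by
    refine Finset.prod_le_one (fun i _ ↦ ?_) fun i _ ↦ ?_
    · exact div_nonneg hη.le (by linarith [h.start i])
    · rw [div_le_one (by linarith [h.start i])]
      linarith [h.start i]
  refine h1.trans (one_le_pow₀ ?_)
  have : Λ ≤ Λ ^ (m + 1 - I.card) := by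
    calc Λ = Λ ^ 1 := (pow_one Λ).symm
      _ ≤ _ := pow_le_pow_right₀ (by linarith) (by omega)
  linarith

end Margin

/-! ### Lower bound for the step sizes -/

section StepSize

lemma cConst_pos {m : ℕ} {L R β ρ : ℝ} (hL : 0 < L) (hR : 0 < R) (hρ : ρ < β) :
    0 < cConst m L R β ρ := by
  have : 0 < β - ρ := by linarith
  rw [cConst]
  positivity

lemma CConst_pos {m : ℕ} {L M R β ρ η : ℝ} (hL : 0 < L) (hM : 0 < M) (hR : 0 < R) (hη : 0 < η)
    (hρ : ρ < β) : 0 < CConst m L M R β ρ η := by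
  have hc := cConst_pos (m := m) hL hR hρ
  rw [CConst]
  have : 0 < max (4 + 5 * M * cConst m L R β ρ * η / L ^ 2)
      (1 + √(M * cConst m L R β ρ * η / (4 * L ^ 2))) :=
    lt_max_of_lt_left (by positivity)
  positivity

lemma CConst_mul_le {m : ℕ} {L M R β ρ η : ℝ} (hL : 0 < L) (hM : 0 < M) (hR : 0 < R) (hη : 0 < η)
    (hρ : ρ < β) :
    CConst m L M R β ρ η * (2 * (cConst m L R β ρ + m)
      * (4 * L ^ 2 + 5 * M * cConst m L R β ρ * η)) ≤ cConst m L R β ρ ^ 2 := by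
  have hc := cConst_pos (m := m) hL hR hρ
  set c := cConst m L R β ρ with hcdef
  have hK : 0 < 4 + 5 * M * c * η / L ^ 2 := by positivity
  have h1 : CConst m L M R β ρ η
      ≤ c / (2 * L ^ 2 * (1 + m / c)) * (1 / (4 + 5 * M * c * η / L ^ 2)) := by
    rw [CConst, ← hcdef]
    gcongr
    exact le_max_left _ _
  refine (mul_le_mul_of_nonneg_right h1 (by positivity)).trans_eq ?_
  field_simp

variable {d m : ℕ} {Ξ : Type*} {f : Fin (m + 1) → Space d → ℝ} {L : Fin (m + 1) → ℝ} {R β : ℝ}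
  {x₀ : Space d} {P : Alg d m Ξ} {E ρ : ℝ} {x : Space d} {s : ℕ → Ξ}

lemma IsConvexProblem.norm_g_le (h : IsConvexProblem L P.M R β f x₀)
    (hP : P.IsReliable f (maxConst L) E x s) (hx : x ∈ strictlyFeasible f) (hη : 0 < P.η)
    (hL : ∀ i, 0 < L i) (hE : E ≤ 0.02 * maxConst L) {c : ℝ} (hc : 0 < c)
    (hmargin : ∀ i : Fin m, 5 * c * P.η ≤ -f i.succ x) :
    ‖P.g x s‖ ≤ 1.02 * maxConst L * (1 + m / c) := by
  have hLc := maxConst_pos hL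
  have h1 := h.norm_grad_add_le hL hη hx Finset.univ
  rw [← barrierGrad] at h1
  have h2 : ∑ i : Fin m, P.η / -f i.succ x ≤ m / c := by
    calc _ ≤ ∑ i : Fin m, 1 / c := by
          refine Finset.sum_le_sum fun i _ ↦ ?_
          have hα : 0 < -f i.succ x := by linarith [hx i]
          rw [div_le_div_iff₀ hα hc]
          have := hmargin i
          nlinarith [mul_pos hc hη]
      _ = _ := by simp [div_eq_mul_inv]
  have h3 : ‖P.g x s‖ ≤ ‖barrierGrad f P.η x‖ + ‖P.g x s - barrierGrad f P.η x‖ := by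
    calc _ = ‖barrierGrad f P.η x + (P.g x s - barrierGrad f P.η x)‖ := by congr 1; abel
      _ ≤ _ := norm_add_le _ _
  have h4 := hP.grad_err
  have h5 : maxConst L * (1 + ∑ i : Fin m, P.η / -f i.succ x) ≤ maxConst L * (1 + m / c) := by
    gcongr
  have h6 : 0 ≤ maxConst L * (m / c) := by positivity
  norm_num at hE ⊢
  linarith

/-- As long as the slacks are at least `5 c η`, the step size exceeds `C η` by the factor `4.5`,
which is what the convergence analysis consumes. -/
lemma IsConvexProblem.le_step (h : IsConvexProblem L P.M R β f x₀)
    (hP : P.IsReliable f (maxConst L) E x s) (hm : 1 ≤ m) (hx : x ∈ strictlyFeasible f)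
    (hη : 0 < P.η) (hM : ∀ i, 0 < P.M i) (hL : ∀ i, 0 < L i) (hR : 0 < R) (hρ : ρ < β)
    (hE : E ≤ 0.02 * maxConst L)
    (hmargin : ∀ i : Fin m, 5 * cConst m (maxConst L) R β ρ * P.η ≤ -f i.succ x) :
    4.5 * (CConst m (maxConst L) (maxConst P.M) R β ρ P.η * P.η) ≤ P.γ x s := by
  have hLc := maxConst_pos hL
  have hMc := maxConst_pos hM
  have hc := cConst_pos (m := m) hLc hR hρ
  have hC := CConst_pos (m := m) hLc hMc hR hη hρ
  have hCle := CConst_mul_le (m := m) hLc hMc hR hη hρ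
  have hg := h.norm_g_le hP hx hη hL hE hc hmargin
  set c := cConst m (maxConst L) R β ρ with hcdef
  set C := CConst m (maxConst L) (maxConst P.M) R β ρ P.η with hCdef
  set Lc := maxConst L with hLcdef
  set Mc := maxConst P.M with hMcdef
  set η := P.η with hηdef
  have hm1 : (1 : ℝ) ≤ m := by exact_mod_cast hm
  have hA : ∀ i, 4.95 * c * η ≤ P.αLow i x s := fun i ↦ by
    have h1 := hP.le_αLow i
    have h2 := hmargin i
    norm_num at h1 h2 ⊢
    linarith
  refine hP.le_γ hm (fun i ↦ ?_) (hP.scale_pos hx hM) ?_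
  · have hAi := hP.αLow_pos hx i
    set A := P.αLow i x s with hAdef
    have hθ := hP.θHat_le i
    have hθ0 := hP.θHat_nonneg i
    have hMi : P.M i.succ ≤ Mc := le_maxConst P.M i.succ
    -- AM-GM for `A Mc / Lc` and `Lc`.
    have hsqrt : √(A * P.M i.succ) ≤ (A * Mc / Lc + Lc) / 2 := by
      calc √(A * P.M i.succ) ≤ √(((A * Mc / Lc + Lc) / 2) ^ 2) := by
            refine Real.sqrt_le_sqrt ?_
            have h1 : A * P.M i.succ ≤ A * Mc := by gcongr
            have h2 : A * Mc / Lc * Lc = A * Mc := div_mul_cancel₀ _ hLc.ne'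
            nlinarith [sq_nonneg (A * Mc / Lc - Lc)]
        _ = _ := Real.sqrt_sq (by positivity)
    have hag : 4.5 * (C * η) * ‖P.g x s‖ * (Lc * (4 * Lc ^ 2 + 5 * Mc * c * η))
        ≤ 2.295 * c * η * Lc ^ 2 := by
      calc _ ≤ 4.5 * (C * η) * (1.02 * Lc * (1 + m / c)) *
            (Lc * (4 * Lc ^ 2 + 5 * Mc * c * η)) := by gcongr
        _ = 2.295 * η * Lc ^ 2 / c * (C * (2 * (c + m) * (4 * Lc ^ 2 + 5 * Mc * c * η))) := by
            field_simp; ring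
        _ ≤ 2.295 * η * Lc ^ 2 / c * c ^ 2 := by gcongr
        _ = _ := by field_simp
    set a := 4.5 * (C * η) * ‖P.g x s‖ with ha
    have ha0 : 0 ≤ a := by positivity
    have hAi' := hA i
    have h1 : a * Lc ≤ 0.574 * (c * η) := by
      have : a * Lc * (4 * Lc ^ 2) ≤ 0.574 * (c * η) * (4 * Lc ^ 2) := by
        have : 0 ≤ a * (Lc * (5 * Mc * c * η)) := by positivity
        have : 0 ≤ c * η * Lc ^ 2 := by positivity
        norm_num at hag ⊢
        linarith
      exact le_of_mul_le_mul_right this (by positivity)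
    have h2 : a * (Mc / Lc) ≤ 0.459 := by
      have h3 : a * (Lc * (5 * Mc * c * η)) ≤ 2.295 * c * η * Lc ^ 2 := by
        have : 0 ≤ a * (Lc * (4 * Lc ^ 2)) := by positivity
        linarith
      have h4 : a * (Mc / Lc) * (5 * c * η * Lc ^ 2) ≤ 0.459 * (5 * c * η * Lc ^ 2) := by
        calc _ = a * (Lc * (5 * Mc * c * η)) := by field_simp
          _ ≤ _ := h3
          _ = _ := by ring
      exact le_of_mul_le_mul_right h4 (by positivity)
    calc 4.5 * (C * η) * (2 * P.θHat i x s + √(A * P.M i.succ)) * ‖P.g x s‖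
        = a * (2 * P.θHat i x s + √(A * P.M i.succ)) := by rw [ha]; ring
      _ ≤ a * (2 * (1.01 * Lc) + (A * Mc / Lc + Lc) / 2) := by gcongr
      _ = 2.52 * (a * Lc) + a * (Mc / Lc) * A / 2 := by ring
      _ ≤ 2.52 * (0.574 * (c * η)) + 0.459 * A / 2 := by gcongr
      _ ≤ A := by norm_num at hAi' ⊢; linarith
  · have hM2 := hP.M2Hat_pos hx hη hM
    rw [le_div_iff₀ hM2]
    have hs1 : ∑ i : Fin m, P.M i.succ / P.αLow i x s ≤ m * (Mc / (4.95 * c * η)) := by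
      calc _ ≤ ∑ i : Fin m, Mc / (4.95 * c * η) := Finset.sum_le_sum fun i _ ↦ by
            gcongr
            · exact le_maxConst P.M i.succ
            · exact hA i
        _ = _ := by simp
    have hs2 : ∑ i : Fin m, P.θHat i x s ^ 2 / P.αLow i x s ^ 2
        ≤ m * ((1.01 * Lc) ^ 2 / (4.95 * c * η) ^ 2) := by
      calc _ ≤ ∑ i : Fin m, (1.01 * Lc) ^ 2 / (4.95 * c * η) ^ 2 := Finset.sum_le_sum fun i _ ↦ by
            have := hP.θHat_nonneg i
            gcongr
            · exact hP.θHat_le i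
            · exact hA i
        _ = _ := by simp
    have hM2le : P.M2Hat x s ≤ Mc + 10 * η * (m * (Mc / (4.95 * c * η)))
        + 8 * η * (m * ((1.01 * Lc) ^ 2 / (4.95 * c * η) ^ 2)) := by
      rw [Alg.M2Hat]
      gcongr
      exact le_maxConst P.M 0
    have e : c ^ 2 * η * (Mc + 10 * η * (m * (Mc / (4.95 * c * η)))
        + 8 * η * (m * ((1.01 * Lc) ^ 2 / (4.95 * c * η) ^ 2)))
        = c ^ 2 * η * Mc + 10 / 4.95 * (m * Mc * c * η)
          + 8 * 1.01 ^ 2 / 4.95 ^ 2 * (m * Lc ^ 2) := by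
      field_simp
    have h1 : 2.25 * (c ^ 2 * η * P.M2Hat x s) ≤ (c + m) * (4 * Lc ^ 2 + 5 * Mc * c * η) := by
      have h2 : c ^ 2 * η * P.M2Hat x s ≤ c ^ 2 * η * Mc + 10 / 4.95 * (m * Mc * c * η)
          + 8 * 1.01 ^ 2 / 4.95 ^ 2 * (m * Lc ^ 2) := by
        rw [← e]
        gcongr
      have p1 : 0 ≤ c ^ 2 * η * Mc := by positivity
      have p2 : 0 ≤ m * Mc * c * η := by positivity
      have p3 : 0 ≤ m * Lc ^ 2 := by positivity
      have p4 : 0 ≤ c * Lc ^ 2 := by positivity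
      norm_num at h2 ⊢
      linarith
    set Q := (c + m) * (4 * Lc ^ 2 + 5 * Mc * c * η) with hQ
    have hQ0 : 0 < Q := by positivity
    have h3 : C * (2 * Q) ≤ c ^ 2 := by
      calc C * (2 * Q) = C * (2 * (c + m) * (4 * Lc ^ 2 + 5 * Mc * c * η)) := by rw [hQ]; ring
        _ ≤ _ := hCle
    refine le_of_mul_le_mul_right ?_ (show 0 < 2 * Q by positivity)
    calc 4.5 * (C * η) * P.M2Hat x s * (2 * Q) = 4.5 * (C * (2 * Q)) * (η * P.M2Hat x s) := by ring
      _ ≤ 4.5 * c ^ 2 * (η * P.M2Hat x s) := by gcongr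
      _ = 2 * (2.25 * (c ^ 2 * η * P.M2Hat x s)) := by ring
      _ ≤ 2 * Q := by gcongr
      _ = _ := by ring

end StepSize

/-! ### Small noise makes the estimates reliable -/

section Noise

variable {d m : ℕ} {Ξ : Type*} {f : Fin (m + 1) → Space d → ℝ} {L : Fin (m + 1) → ℝ} {R β : ℝ}
  {x₀ : Space d}

/-- The averaged measurements of the batch `s` at `x` have errors of at most `ε η²` in the values
of the constraints and `ε η` in the gradients. -/
structure Alg.IsAccurate (P : Alg d m Ξ) (f : Fin (m + 1) → Space d → ℝ) (ε : ℝ) (x : Space d)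
    (s : ℕ → Ξ) : Prop where
  value : ∀ i : Fin m, |P.Fn i.succ x s - f i.succ x| ≤ ε * P.η ^ 2
  grad : ∀ i, ‖P.Gn i x s - gradient (f i) x‖ ≤ ε * P.η

/-- The confidence corrections in `αLow` and `θHat` are at most `ε η²` and `ε η`. -/
structure Alg.HasSmallCorrections (P : Alg d m Ξ) (ε : ℝ) : Prop where
  value_nonneg : ∀ i : Fin m, 0 ≤ P.σ i.succ / √P.n * √(Real.log (1 / P.δ))
  value_le : ∀ i : Fin m, P.σ i.succ / √P.n * √(Real.log (1 / P.δ)) ≤ ε * P.η ^ 2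
  grad_nonneg : ∀ i : Fin m, 0 ≤ P.b i.succ + P.σg i.succ / √P.n * √(Real.log (1 / P.δ))
  grad_le : ∀ i : Fin m, P.b i.succ + P.σg i.succ / √P.n * √(Real.log (1 / P.δ)) ≤ ε * P.η

/-- The amplification of the relative noise level in the estimator of the barrier gradient, at
points whose slacks are at least `5 c η`. -/
def noiseFactor (m : ℕ) (Lc c : ℝ) : ℝ := 1 + 2 * m / (5 * c) + 2 * m * Lc / (5 * c) ^ 2

/-- The noise level `ε` is small compared with the constants of the problem, when the slacks are
at least `5 c η`. -/
structure IsSmallNoise (L M : Fin (m + 1) → ℝ) (R η c ε : ℝ) : Prop where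
  nonneg : 0 ≤ ε
  slack : 2 * ε * η ≤ 0.01 * (5 * c)
  smooth : ∀ i, ε ^ 2 * η ≤ 0.00009 * (5 * c) * M i
  lipschitz : 2 * ε * η ≤ 0.01 * maxConst L
  grad : ε * η * noiseFactor m (maxConst L) c ≤ 0.02 * maxConst L
  gap : ε * noiseFactor m (maxConst L) c *
    (8 * R + 1.02 * maxConst L * (1 + m / c) / M 0) ≤ 1 / 30

variable {P : Alg d m Ξ} {x : Space d} {s : ℕ → Ξ} {c ε : ℝ}

lemma noiseFactor_pos {Lc : ℝ} (hL : 0 < Lc) (hc : 0 < c) : 0 < noiseFactor m Lc c := by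
  rw [noiseFactor]; positivity

lemma abs_inner_normalized_mul {E : Type*} [NormedAddCommGroup E] [InnerProductSpace ℝ E]
    (u g : E) : |⟪u, ‖g‖⁻¹ • g⟫| * ‖g‖ = |⟪u, g⟫| := by
  rcases eq_or_ne g 0 with rfl | hg
  · simp
  · have : 0 < ‖g‖ := norm_pos_iff.2 hg
    rw [real_inner_smul_right, abs_mul, abs_of_pos (inv_pos.2 this)]
    field_simp

lemma abs_inner_normalized_le {E : Type*} [NormedAddCommGroup E] [InnerProductSpace ℝ E]
    (u g : E) : |⟪u, ‖g‖⁻¹ • g⟫| ≤ ‖u‖ := by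
  refine (abs_real_inner_le_norm _ _).trans (mul_le_of_le_one_right (norm_nonneg u) ?_)
  rw [norm_smul, norm_inv, norm_norm]
  exact inv_mul_le_one

lemma norm_inv_smul_sub_le {E : Type*} [NormedAddCommGroup E] [NormedSpace ℝ E] {A α η ε Lc a : ℝ}
    {u v : E} (hη : 0 < η) (ha : 0 < a) (hα : a * η ≤ α) (hA : 0.99 * α ≤ A)
    (hAα : |A - α| ≤ ε * η ^ 2) (huv : ‖u - v‖ ≤ ε * η) (hv : ‖v‖ ≤ Lc) :
    η * ‖A⁻¹ • u - α⁻¹ • v‖ ≤ ε * η * (2 / a + 2 * Lc / a ^ 2) := by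
  have hα0 : 0 < α := lt_of_lt_of_le (by positivity) hα
  have hA0 : 0 < A := lt_of_lt_of_le (by positivity) hA
  have hAa : a * η / 2 ≤ A := by norm_num at hA; linarith
  have hLc : 0 ≤ Lc := (norm_nonneg v).trans hv
  have hε : 0 ≤ ε * η := (norm_nonneg _).trans huv
  have e : A⁻¹ • u - α⁻¹ • v = A⁻¹ • (u - v) + (A⁻¹ - α⁻¹) • v := by
    rw [smul_sub, sub_smul]; abel
  have h1 : ‖A⁻¹ • (u - v)‖ ≤ (a * η / 2)⁻¹ * (ε * η) := by
    rw [norm_smul, Real.norm_of_nonneg (by positivity)]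
    gcongr
  have h2 : ‖(A⁻¹ - α⁻¹) • v‖ ≤ ε * η ^ 2 / (a * η / 2 * (a * η)) * Lc := by
    rw [norm_smul, Real.norm_eq_abs, inv_sub_inv hA0.ne' hα0.ne', abs_div, abs_mul,
      abs_of_pos hA0, abs_of_pos hα0, abs_sub_comm]
    have := (abs_nonneg _).trans hAα
    gcongr
  calc η * ‖A⁻¹ • u - α⁻¹ • v‖
      ≤ η * ((a * η / 2)⁻¹ * (ε * η) + ε * η ^ 2 / (a * η / 2 * (a * η)) * Lc) := by
        rw [e]
        gcongr
        exact (norm_add_le _ _).trans (add_le_add h1 h2)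
    _ = _ := by field_simp

lemma IsConvexProblem.isReliable (h : IsConvexProblem L P.M R β f x₀)
    (hacc : P.IsAccurate f ε x s) (hcor : P.HasSmallCorrections ε) (hx : x ∈ strictlyFeasible f)
    (hη : 0 < P.η) (hM : ∀ i, 0 < P.M i) (hL : ∀ i, 0 < L i) (hc : 0 < c)
    (hmargin : ∀ i : Fin m, 5 * c * P.η ≤ -f i.succ x) (hε : IsSmallNoise L P.M R P.η c ε) :
    P.IsReliable f (maxConst L) (ε * P.η * noiseFactor m (maxConst L) c) x s := by
  have hα : ∀ i : Fin m, 0 < -f i.succ x := fun i ↦ by linarith [hx i]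
  have hval : ∀ i : Fin m, 2 * (ε * P.η ^ 2) ≤ 0.01 * -f i.succ x := fun i ↦ by
    calc 2 * (ε * P.η ^ 2) = 2 * ε * P.η * P.η := by ring
      _ ≤ 0.01 * (5 * c) * P.η := mul_le_mul_of_nonneg_right hε.slack hη.le
      _ = 0.01 * (5 * c * P.η) := by ring
      _ ≤ _ := by gcongr; exact hmargin i
  have hgrad : ∀ i, ‖gradient (f i) x‖ ≤ maxConst L := fun i ↦
    (h.norm_gradient_le hL i hx).trans (le_maxConst L i)
  have hlow : ∀ i : Fin m, 0.99 * -f i.succ x ≤ P.αLow i x s := fun i ↦ by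
    have h1 := (abs_le.1 (hacc.value i)).2
    have h2 := hcor.value_le i
    have h3 := hval i
    rw [Alg.αLow]
    linarith
  have hlip := hε.lipschitz
  refine ⟨hlow, fun i ↦ ?_, fun i ↦ ?_, fun i ↦ ?_, fun i ↦ ?_, ?_⟩
  · have h1 := (abs_le.1 (hacc.value i)).1
    have h2 := hcor.value_nonneg i
    have h3 := hval i
    have h4 := hα i
    rw [Alg.αLow]
    linarith
  · have h1 : |⟪gradient (f i.succ) x, P.g x s⟫|
        ≤ |⟪P.Gn i.succ x s, P.g x s⟫| + ε * P.η * ‖P.g x s‖ := by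
      have e : ⟪gradient (f i.succ) x, P.g x s⟫ = ⟪P.Gn i.succ x s, P.g x s⟫
          - ⟪P.Gn i.succ x s - gradient (f i.succ) x, P.g x s⟫ := by
        rw [inner_sub_left]; ring
      rw [e]
      refine (abs_sub _ _).trans (add_le_add le_rfl ((abs_real_inner_le_norm _ _).trans ?_))
      gcongr
      exact hacc.grad i.succ
    have h2 : ε * P.η ≤ 0.01 * √(P.αLow i x s * P.M i.succ) := by
      have h3 : (100 * (ε * P.η)) ^ 2 ≤ P.αLow i x s * P.M i.succ := by
        calc (100 * (ε * P.η)) ^ 2 = 10000 * P.η * (ε ^ 2 * P.η) := by ring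
          _ ≤ 10000 * P.η * (0.00009 * (5 * c) * P.M i.succ) :=
              mul_le_mul_of_nonneg_left (hε.smooth _) (by positivity)
          _ = 0.9 * (5 * c * P.η) * P.M i.succ := by ring
          _ ≤ P.αLow i x s * P.M i.succ := by
              refine mul_le_mul_of_nonneg_right ?_ (hM _).le
              have h4 := hlow i
              have h5 := hmargin i
              have h6 := hα i
              linarith
      have h4 := Real.le_sqrt_of_sq_le h3
      linarith
    rw [← abs_inner_normalized_mul (P.Gn i.succ x s)] at h1
    have h3 : |⟪P.Gn i.succ x s, ‖P.g x s‖⁻¹ • P.g x s⟫| ≤ P.θHat i x s := by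
      have := hcor.grad_nonneg i
      rw [Alg.θHat]
      linarith
    calc _ ≤ (|⟪P.Gn i.succ x s, ‖P.g x s‖⁻¹ • P.g x s⟫| + ε * P.η) * ‖P.g x s‖ := by linarith
      _ ≤ _ := by gcongr
  · have h1 := hcor.grad_nonneg i
    have h2 := abs_nonneg ⟪P.Gn i.succ x s, ‖P.g x s‖⁻¹ • P.g x s⟫
    rw [Alg.θHat]
    linarith
  · have h1 := abs_inner_normalized_le (P.Gn i.succ x s) (P.g x s)
    have h2 := hcor.grad_le i
    have h3 : ‖P.Gn i.succ x s‖ ≤ maxConst L + ε * P.η := by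
      calc ‖P.Gn i.succ x s‖
          = ‖gradient (f i.succ) x + (P.Gn i.succ x s - gradient (f i.succ) x)‖ := by
            congr 1; abel
        _ ≤ _ := (norm_add_le _ _).trans (add_le_add (hgrad _) (hacc.grad _))
    rw [Alg.θHat]
    linarith
  · have hterm : ∀ i : Fin m, P.η * ‖(-P.Fn i.succ x s)⁻¹ • P.Gn i.succ x s
        - (-f i.succ x)⁻¹ • gradient (f i.succ) x‖
        ≤ ε * P.η * (2 / (5 * c) + 2 * maxConst L / (5 * c) ^ 2) := fun i ↦ by
      refine norm_inv_smul_sub_le hη (by positivity) (hmargin i) ?_ ?_ (hacc.grad _) (hgrad _)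
      · have h1 := (abs_le.1 (hacc.value i)).2
        have h3 := hval i
        have h4 := hε.nonneg
        have h5 := hα i
        linarith
      · rw [neg_sub_neg, abs_sub_comm]
        exact hacc.value i
    have e : P.g x s - barrierGrad f P.η x = (P.Gn 0 x s - gradient (f 0) x)
        + ∑ i : Fin m, P.η • ((-P.Fn i.succ x s)⁻¹ • P.Gn i.succ x s
          - (-f i.succ x)⁻¹ • gradient (f i.succ) x) := by
      rw [Alg.g, barrierGrad, ← Finset.smul_sum, Finset.sum_sub_distrib, smul_sub]
      abel
    rw [e]
    calc _ ≤ ε * P.η + ∑ i : Fin m, ε * P.η * (2 / (5 * c) + 2 * maxConst L / (5 * c) ^ 2) := by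
          refine (norm_add_le _ _).trans (add_le_add (hacc.grad 0) ?_)
          refine (norm_sum_le _ _).trans (Finset.sum_le_sum fun i _ ↦ ?_)
          rw [norm_smul, Real.norm_of_nonneg hη.le]
          exact hterm i
      _ = _ := by
          rw [Finset.sum_const, Finset.card_univ, Fintype.card_fin, nsmul_eq_mul, noiseFactor]
          ring

end Noise

/-! ### Convergence of the averaged iterate -/

/-- The four inequalities that drive the convergence: `D` and `D'` are the squared distances to
the minimizer before and after a step, `Δ` and `Δ'` the optimality gaps, `G` is the norm of the
gradient estimator and `E` its error. The step size `γ` is compared with `1 / M₀` because the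
smoothness constant `M₀` of the objective, unlike the curvature `X` of the constraints, enters the
step size rule without a safety factor. -/
lemma descent_bounds {γ G D D' Δ Δ' E R M₀ X r : ℝ} (hγ : 0 < γ) (hG : 0 ≤ G)
    (hΔ' : 0 ≤ Δ') (hE : 0 ≤ E) (hR : 0 ≤ R) (hM₀ : 0 < M₀) (hX : 0 ≤ X)
    (hγM : γ * (M₀ + X) ≤ 1) (hγG : γ * G ≤ R) (hr : r ^ 2 = D)
    (hdist : D' ≤ D - 2 * γ * Δ + 2 * γ * E * R + (γ * G) ^ 2)
    (hdesc : Δ' ≤ Δ - γ * G ^ 2 + γ * E * G + (γ * G) ^ 2 / 2 * (M₀ + 0.3 * X))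
    (hconv : Δ ≤ G * r + E * R) :
    D' ≤ D - 2 * γ * Δ' + γ * (4 * E * R) ∧
    (γ * M₀ ≤ 1 / 2 → γ * Δ ≤ 2 * (D - D') + γ * (7 * E * R)) ∧
    γ * Δ ≤ 2 * D + γ * (3 * E * R) ∧
    γ * Δ ≤ 2 * (D - D') + (Δ - Δ') / M₀ + γ * (8 * E * R + E * G / M₀) := by
  have hγX : 0 ≤ γ * X := by positivity
  have hγM0 : γ * M₀ ≤ 1 := by linarith
  have hEG : γ * E * (γ * G) ≤ γ * E * R := by gcongr
  have hER : 0 ≤ γ * E * R := by positivity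
  have hbase : ∀ q : ℝ, γ * (M₀ + 0.3 * X) ≤ q →
      (1 - q / 2) * (γ * G ^ 2) ≤ Δ - Δ' + γ * E * G := by
    intro q hq
    have h1 : (γ * G) ^ 2 / 2 * (M₀ + 0.3 * X) ≤ γ * G ^ 2 / 2 * q := by
      calc _ = γ * G ^ 2 / 2 * (γ * (M₀ + 0.3 * X)) := by ring
        _ ≤ _ := by gcongr
    linarith
  have h1 : γ * G ^ 2 / 2 ≤ Δ - Δ' + γ * E * G := by
    have := hbase 1 (by norm_num; linarith)
    linarith
  have hsq : (γ * G) ^ 2 ≤ 2 * γ * (Δ - Δ') + 2 * (γ * E * R) := by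
    have := mul_le_mul_of_nonneg_left h1 hγ.le
    linarith
  have hA : D' ≤ D - 2 * γ * Δ' + γ * (4 * E * R) := by linarith
  have hγΔ' : 0 ≤ γ * Δ' := by positivity
  refine ⟨hA, fun hS ↦ ?_, ?_, ?_⟩
  · have h2 := hbase (2 / 3) (by norm_num; linarith)
    have h3 := mul_le_mul_of_nonneg_left h2 hγ.le
    have h4 : (γ * G) ^ 2 ≤ 1.5 * (γ * Δ) + 1.5 * (γ * E * R) := by norm_num; linarith
    norm_num at h4
    linarith
  · have h2 := mul_le_mul_of_nonneg_left hconv hγ.le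
    have h3 : γ * (G * r) ≤ (γ * G) ^ 2 / 4 + D := by
      rw [← hr]; nlinarith [sq_nonneg (γ * G / 2 - r)]
    linarith
  · have h2 : 0 ≤ Δ - Δ' + γ * E * G :=
      le_trans (by positivity) h1
    have h3 : γ * (Δ - Δ' + γ * E * G) ≤ (Δ - Δ' + γ * E * G) / M₀ := by
      rw [le_div_iff₀ hM₀]
      nlinarith
    have h4 : (Δ - Δ' + γ * E * G) / M₀ = (Δ - Δ') / M₀ + γ * (E * G / M₀) := by
      rw [add_div]; ring
    have h5 : 0 ≤ γ * (γ * E * G) := by positivity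
    linarith

/-- Summation of the descent inequalities. Only the first step with `γ M₀ > 1 / 2` needs the crude
bound `γ Δ ≤ 2 D`; from then on the gap itself, weighted by `1 / M₀`, serves as a potential, and
before that the squared distance does. -/
lemma sum_gap_le {γ D Δ : ℕ → ℝ} {M₀ e : ℝ} {T : ℕ} (hM₀ : 0 < M₀) (he : 0 ≤ e)
    (hγ : ∀ t < T, 0 < γ t) (hD : ∀ t ≤ T, 0 ≤ D t) (hΔ : ∀ t ≤ T, 0 ≤ Δ t)
    (h1 : ∀ t < T, D (t + 1) ≤ D t - 2 * γ t * Δ (t + 1) + γ t * e)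
    (h2 : ∀ t < T, γ t * M₀ ≤ 1 / 2 → γ t * Δ t ≤ 2 * (D t - D (t + 1)) + γ t * e)
    (h3 : ∀ t < T, γ t * Δ t ≤ 2 * D t + γ t * e)
    (h4 : ∀ t < T, γ t * Δ t ≤ 2 * (D t - D (t + 1)) + (Δ t - Δ (t + 1)) / M₀ + γ t * e) :
    ∑ t ∈ Finset.range T, γ t * Δ t ≤ 4 * D 0 + 3 * e * ∑ t ∈ Finset.range T, γ t := by
  suffices hmain : ∀ n t : ℕ, t + n ≤ T →
      ∑ j ∈ Finset.range n, γ (t + j) * Δ (t + j)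
        ≤ 2 * D t + Δ t / M₀ + e * ∑ j ∈ Finset.range n, γ (t + j) ∧
      ∑ j ∈ Finset.range n, γ (t + j) * Δ (t + j)
        ≤ 4 * D t + 3 * e * ∑ j ∈ Finset.range n, γ (t + j) by
    simpa using (hmain T 0 (by omega)).2
  intro n
  induction n with
  | zero =>
    intro t ht
    have hDt := hD t (by omega)
    have hΔt := hΔ t (by omega)
    simp only [Finset.range_zero, Finset.sum_empty, mul_zero, add_zero]
    exact ⟨by positivity, by positivity⟩
  | succ n ih =>
    intro t ht
    have htT : t < T := by omega
    obtain ⟨ih1, ih2⟩ := ih (t + 1) (by omega)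
    have e1 : ∀ φ : ℕ → ℝ, ∑ j ∈ Finset.range (n + 1), φ (t + j)
        = φ t + ∑ j ∈ Finset.range n, φ (t + 1 + j) := by
      intro φ
      rw [Finset.sum_range_succ', add_zero, add_comm]
      congr 1
      exact Finset.sum_congr rfl fun j _ ↦ by congr 1; omega
    rw [e1 γ, e1 fun j ↦ γ j * Δ j]
    have hγt := hγ t htT
    have hγe : 0 ≤ γ t * e := by positivity
    have hΓ : 0 ≤ e * ∑ j ∈ Finset.range n, γ (t + 1 + j) :=
      mul_nonneg he (Finset.sum_nonneg fun j hj ↦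
        (hγ _ (by have := Finset.mem_range.1 hj; omega)).le)
    have h1t := h1 t htT
    have h4t := h4 t htT
    have hΔ1 := hΔ (t + 1) (by omega)
    have hγΔ : 0 ≤ γ t * Δ (t + 1) := by positivity
    constructor
    · rw [sub_div] at h4t
      linarith
    · rcases le_or_gt (γ t * M₀) (1 / 2) with hS | hS
      · have h2t := h2 t htT hS
        linarith
      · have h3t := h3 t htT
        have h5 : Δ (t + 1) / M₀ ≤ 2 * (γ t * Δ (t + 1)) := by
          rw [div_le_iff₀ hM₀]
          nlinarith
        linarith

section Convergence

variable {d m : ℕ} {Ξ : Type*} {f : Fin (m + 1) → Space d → ℝ} {L : Fin (m + 1) → ℝ} {R β : ℝ}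
  {x₀ xs : Space d} {P : Alg d m Ξ} {ε ρ : ℝ}

lemma HasMargin.le_slack {Lc η : ℝ} {x : Space d} (hx : x ∈ strictlyFeasible f)
    (hLc : 0 < Lc) (hR : 0 < R) (hρ : ρ < β)
    (h : HasMargin f η (4 * (2 * m + 1) * Lc / ((β - ρ) / R)) x) (i : Fin m) :
    5 * cConst m Lc R β ρ * η ≤ -f i.succ x := by
  have hα : 0 < -f i.succ x := by linarith [hx i]
  have hl : 0 < (β - ρ) / R := div_pos (by linarith) hR
  have h1 := h.div_le i
  rw [div_le_iff₀ hα] at h1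
  have hc := cConst_pos (m := m) hLc hR hρ
  have e : 5 * cConst m Lc R β ρ * (2 / 5 * (4 * (2 * m + 1) * Lc / ((β - ρ) / R)) ^ m) = 1 := by
    have h2 : (β - ρ) / R / (4 * Lc * (2 * m + 1)) * (4 * (2 * m + 1) * Lc / ((β - ρ) / R))
        = 1 := by
      have h3 : β - ρ ≠ 0 := (sub_pos.2 hρ).ne'
      field_simp
    rw [cConst]
    calc _ = ((β - ρ) / R / (4 * Lc * (2 * m + 1)) *
          (4 * (2 * m + 1) * Lc / ((β - ρ) / R))) ^ m := by rw [mul_pow]; ring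
      _ = 1 := by rw [h2, one_pow]
  calc 5 * cConst m Lc R β ρ * η
      ≤ 5 * cConst m Lc R β ρ * (2 / 5 * (4 * (2 * m + 1) * Lc / ((β - ρ) / R)) ^ m
        * -f i.succ x) := by gcongr
    _ = -f i.succ x := by rw [← mul_assoc, e, one_mul]

/-- If all measurements made at feasible iterates are accurate, then all iterates are strictly
feasible with a uniform margin. -/
lemma IsConvexProblem.iter_mem (h : IsConvexProblem L P.M R β f x₀) (hd : 1 ≤ d) (hm : 1 ≤ m)
    (hη : 0 < P.η) (hM : ∀ i, 0 < P.M i) (hL : ∀ i, 0 < L i) (hR : 0 < R) (hβ : 0 < β)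
    (hηρ : P.η ≤ ρ) (hρβ : ρ ≤ β / 2)
    (hε : IsSmallNoise L P.M R P.η (cConst m (maxConst L) R β ρ) ε)
    (hcor : P.HasSmallCorrections ε) {S : ℕ → ℕ → Ξ} {T : ℕ}
    (hacc : ∀ t < T, P.iter x₀ S t ∈ feasible f → P.IsAccurate f ε (P.iter x₀ S t) (S t)) :
    ∀ t ≤ T, P.iter x₀ S t ∈ strictlyFeasible f ∧
      HasMargin f P.η (4 * (2 * m + 1) * maxConst L / ((β - ρ) / R)) (P.iter x₀ S t) := by
  have hLc := maxConst_pos hL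
  have hρ : ρ < β := by linarith
  have hc := cConst_pos (m := m) hLc hR hρ
  have hl : 0 < (β - ρ) / R := div_pos (by linarith) hR
  have hlL : (β - ρ) / R ≤ maxConst L := by
    rw [div_le_iff₀ hR]
    linarith [h.le_lipschitz_mul_diam hd hR hβ hL]
  have hΛ : 8 * (m : ℝ) + 4 ≤ 4 * (2 * m + 1) * maxConst L / ((β - ρ) / R) := by
    rw [le_div_iff₀ hl]
    calc (8 * (m : ℝ) + 4) * ((β - ρ) / R) ≤ (8 * m + 4) * maxConst L := by gcongr
      _ = _ := by ring
  intro t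
  induction t with
  | zero =>
    intro _
    exact ⟨h.start_mem hβ, h.hasMargin_start hη (by linarith) hΛ⟩
  | succ t ih =>
    intro ht
    obtain ⟨hx, hmar⟩ := ih (by omega)
    have hP := h.isReliable (hacc t (by omega) (strictlyFeasible_subset hx)) hcor hx hη hM hL hc
      (hmar.le_slack hx hLc hR hρ) hε
    refine ⟨h.next_mem hP hm hx hη hM, h.hasMargin_next hP hm hx hη hM hL hR hβ hηρ hε.grad hΛ ?_
      hmar⟩
    rw [mul_div_cancel₀ _ hl.ne']
    ring

/-- The gap of the barrier at the averaged iterate is at most `η`. -/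
lemma IsConvexProblem.average_gap_le (h : IsConvexProblem L P.M R β f x₀) (hd : 1 ≤ d)
    (hm : 1 ≤ m) (hη : 0 < P.η) (hM : ∀ i, 0 < P.M i) (hL : ∀ i, 0 < L i) (hR : 0 < R)
    (hβ : 0 < β) (hηρ : P.η ≤ ρ) (hρβ : ρ ≤ β / 2)
    (hε : IsSmallNoise L P.M R P.η (cConst m (maxConst L) R β ρ) ε)
    (hcor : P.HasSmallCorrections ε) (hxs : IsBarrierMinimizer f P.η xs) {S : ℕ → ℕ → Ξ} {T : ℕ}
    (hT : 1 ≤ T) (hTC : ‖x₀ - xs‖ ^ 2 /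
      (CConst m (maxConst L) (maxConst P.M) R β ρ P.η * P.η ^ 2) ≤ T)
    (hacc : ∀ t < T, P.iter x₀ S t ∈ feasible f → P.IsAccurate f ε (P.iter x₀ S t) (S t)) :
    P.average x₀ S T ∈ strictlyFeasible f ∧
      logBarrier f P.η (P.average x₀ S T) - logBarrier f P.η xs ≤ P.η := by
  have hLc := maxConst_pos hL
  have hρ : ρ < β := by linarith
  have hc := cConst_pos (m := m) hLc hR hρ
  have hC := CConst_pos (m := m) hLc (maxConst_pos hM) hR hη hρ
  have hinv := h.iter_mem hd hm hη hM hL hR hβ hηρ hρβ hε hcor hacc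
  set c := cConst m (maxConst L) R β ρ with hcdef
  set C := CConst m (maxConst L) (maxConst P.M) R β ρ P.η with hCdef
  set X := P.iter x₀ S with hX
  set γ : ℕ → ℝ := P.step x₀ S with hγdef
  set E := ε * P.η * noiseFactor m (maxConst L) c with hEdef
  have hmem : ∀ t ≤ T, X t ∈ strictlyFeasible f := fun t ht ↦ (hinv t ht).1
  have hslack : ∀ t ≤ T, ∀ i : Fin m, 5 * c * P.η ≤ -f i.succ (X t) := fun t ht ↦
    (hinv t ht).2.le_slack (hmem t ht) hLc hR hρ
  have hrel : ∀ t < T, P.IsReliable f (maxConst L) E (X t) (S t) := fun t ht ↦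
    h.isReliable (hacc t ht (strictlyFeasible_subset (hmem t ht.le))) hcor (hmem t ht.le) hη hM hL
      hc (hslack t ht.le) hε
  have hγpos : ∀ t < T, 0 < γ t := fun t ht ↦ (hrel t ht).γ_pos hm (hmem t ht.le) hη hM
  have hγlow : ∀ t < T, 4.5 * (C * P.η) ≤ γ t := fun t ht ↦
    h.le_step (hrel t ht) hm (hmem t ht.le) hη hM hL hR hρ hε.grad (hslack t ht.le)
  have hE0 : 0 ≤ E := by
    have := hε.nonneg
    have := noiseFactor_pos (m := m) hLc hc
    positivity
  set K := 1.02 * maxConst L * (1 + m / c) with hK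
  set e := 8 * E * R + E * K / P.M 0 with he
  have he0 : 0 ≤ e := by
    have := hM 0
    positivity
  have he30 : e ≤ P.η / 30 := by
    calc e = P.η * (ε * noiseFactor m (maxConst L) c * (8 * R + K / P.M 0)) := by
          rw [he, hEdef]; ring
      _ ≤ P.η * (1 / 30) := by gcongr; exact hε.gap
      _ = _ := by ring
  have hstep : ∀ t < T,
      ‖X (t + 1) - xs‖ ^ 2 ≤ ‖X t - xs‖ ^ 2
        - 2 * γ t * (logBarrier f P.η (X (t + 1)) - logBarrier f P.η xs) + γ t * e ∧
      (γ t * P.M 0 ≤ 1 / 2 → γ t * (logBarrier f P.η (X t) - logBarrier f P.η xs)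
        ≤ 2 * (‖X t - xs‖ ^ 2 - ‖X (t + 1) - xs‖ ^ 2) + γ t * e) ∧
      γ t * (logBarrier f P.η (X t) - logBarrier f P.η xs)
        ≤ 2 * ‖X t - xs‖ ^ 2 + γ t * e ∧
      γ t * (logBarrier f P.η (X t) - logBarrier f P.η xs)
        ≤ 2 * (‖X t - xs‖ ^ 2 - ‖X (t + 1) - xs‖ ^ 2)
          + ((logBarrier f P.η (X t) - logBarrier f P.η xs)
            - (logBarrier f P.η (X (t + 1)) - logBarrier f P.η xs)) / P.M 0 + γ t * e := by
    intro t ht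
    have hx := hmem t ht.le
    have hxf := strictlyFeasible_subset hx
    have hx' := hmem (t + 1) ht
    have hP := hrel t ht
    have hγt := hγpos t ht
    have hnext : X (t + 1) = X t - γ t • P.g (X t) (S t) := rfl
    have hM2 : γ t * (P.M 0 + P.curvature (X t) (S t)) ≤ 1 := by
      rw [← Alg.M2Hat_eq]
      exact hP.γ_mul_M2Hat_le hx hη hM
    have hdesc : logBarrier f P.η (X (t + 1)) ≤ logBarrier f P.η (X t)
        - γ t * ⟪barrierGrad f P.η (X t), P.g (X t) (S t)⟫
        + (γ t * ‖P.g (X t) (S t)‖) ^ 2 / 2 * (P.M 0 + 0.3 * P.curvature (X t) (S t)) :=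
      h.logBarrier_step hP hm hx hη hM
    have hconv := h.logBarrier_sub_le hη.le hx hxs.1
    have hRt : ‖X t - xs‖ ≤ R := h.diam _ hxf _ (strictlyFeasible_subset hxs.1)
    have hγG : γ t * ‖P.g (X t) (S t)‖ ≤ R := by
      have := h.diam _ hxf _ (strictlyFeasible_subset hx')
      rwa [hnext, sub_sub_cancel, norm_smul, Real.norm_of_nonneg hγt.le] at this
    have hgK := h.norm_g_le hP hx hη hL hε.grad hc (hslack t ht.le)
    set g := P.g (X t) (S t) with hg
    set B := barrierGrad f P.η (X t) with hB
    have hBg : ‖g - B‖ ≤ E := hP.grad_err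
    have hin1 : ⟪B, X t - xs⟫ ≤ ⟪g, X t - xs⟫ + E * R := by
      have e1 : ⟪B, X t - xs⟫ = ⟪g, X t - xs⟫ - ⟪g - B, X t - xs⟫ := by rw [inner_sub_left]; ring
      have h1 : |⟪g - B, X t - xs⟫| ≤ E * R := (abs_real_inner_le_norm _ _).trans (by gcongr)
      linarith [(abs_le.1 h1).1]
    have hin2 : ‖g‖ ^ 2 - E * ‖g‖ ≤ ⟪B, g⟫ := by
      have e1 : ⟪B, g⟫ = ‖g‖ ^ 2 - ⟪g - B, g⟫ := by
        rw [inner_sub_left, real_inner_self_eq_norm_sq]; ring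
      have h1 : ⟪g - B, g⟫ ≤ E * ‖g‖ := (real_inner_le_norm _ _).trans (by gcongr)
      linarith
    have hdist : ‖X (t + 1) - xs‖ ^ 2 = ‖X t - xs‖ ^ 2 - 2 * γ t * ⟪g, X t - xs⟫
        + (γ t * ‖g‖) ^ 2 := by
      rw [hnext, sub_right_comm, norm_sub_sq_real, norm_smul, Real.norm_of_nonneg hγt.le,
        real_inner_smul_right, real_inner_comm]
      ring
    obtain ⟨b1, b2, b3, b4⟩ := descent_bounds (D := ‖X t - xs‖ ^ 2) (D' := ‖X (t + 1) - xs‖ ^ 2)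
      (Δ := logBarrier f P.η (X t) - logBarrier f P.η xs)
      (Δ' := logBarrier f P.η (X (t + 1)) - logBarrier f P.η xs) (E := E) hγt (norm_nonneg g)
      (sub_nonneg.2 (hxs.2 _ hx')) hE0 hR.le (hM 0) (hP.curvature_nonneg hx hη hM) hM2 hγG rfl
      (by
        rw [hdist]
        have := mul_le_mul_of_nonneg_left (hconv.trans hin1) hγt.le
        linarith)
      (by
        have := mul_le_mul_of_nonneg_left hin2 hγt.le
        linarith)
      (by
        have := real_inner_le_norm g (X t - xs)
        linarith)
    have hM0 := hM 0
    have hER : 0 ≤ E * R := by positivity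
    have hEK : 0 ≤ E * K / P.M 0 := by positivity
    have c1 : γ t * (8 * E * R + E * ‖g‖ / P.M 0) ≤ γ t * e := by
      rw [he]; gcongr
    have c2 : γ t * (7 * E * R) ≤ γ t * e := mul_le_mul_of_nonneg_left (by linarith) hγt.le
    have c3 : γ t * (4 * E * R) ≤ γ t * e := mul_le_mul_of_nonneg_left (by linarith) hγt.le
    have c4 : γ t * (3 * E * R) ≤ γ t * e := mul_le_mul_of_nonneg_left (by linarith) hγt.le
    exact ⟨b1.trans (by linarith), fun hS ↦ (b2 hS).trans (by linarith), b3.trans (by linarith),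
      b4.trans (by linarith)⟩
  have hsum := sum_gap_le (T := T) (γ := γ) (D := fun t ↦ ‖X t - xs‖ ^ 2)
    (Δ := fun t ↦ logBarrier f P.η (X t) - logBarrier f P.η xs) (hM 0) he0 hγpos
    (fun t _ ↦ by positivity) (fun t ht ↦ sub_nonneg.2 (hxs.2 _ (hmem t ht)))
    (fun t ht ↦ (hstep t ht).1) (fun t ht ↦ (hstep t ht).2.1) (fun t ht ↦ (hstep t ht).2.2.1)
    (fun t ht ↦ (hstep t ht).2.2.2)
  simp only [show X 0 = x₀ from rfl] at hsum
  set Γ := ∑ t ∈ Finset.range T, γ t with hΓ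
  -- Each of the at least `‖x₀ - xs‖² / (C η²)` steps contributes at least `4.5 C η`.
  have hΓlow : 4.5 * (‖x₀ - xs‖ ^ 2) ≤ P.η * Γ := by
    have h1 : (T : ℝ) * (4.5 * (C * P.η)) ≤ Γ := by
      rw [hΓ, ← nsmul_eq_mul]
      have := Finset.card_nsmul_le_sum (Finset.range T) γ (4.5 * (C * P.η))
        fun t ht ↦ hγlow t (Finset.mem_range.1 ht)
      simpa using this
    rw [div_le_iff₀ (by positivity)] at hTC
    calc 4.5 * ‖x₀ - xs‖ ^ 2 ≤ 4.5 * (T * (C * P.η ^ 2)) := by gcongr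
      _ = P.η * (T * (4.5 * (C * P.η))) := by ring
      _ ≤ _ := by gcongr
  have hΓpos : 0 < Γ :=
    Finset.sum_pos (fun t ht ↦ hγpos t (Finset.mem_range.1 ht)) ⟨0, Finset.mem_range.2 hT⟩
  have hw0 : ∀ t ∈ Finset.range T, 0 ≤ γ t := fun t ht ↦ (hγpos t (Finset.mem_range.1 ht)).le
  have hwm : ∀ t ∈ Finset.range T, X t ∈ strictlyFeasible f := fun t ht ↦
    hmem t (Finset.mem_range.1 ht).le
  have hav : P.average x₀ S T = (Finset.range T).centerMass γ X := rfl
  rw [hav]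
  refine ⟨h.convex_strictlyFeasible.centerMass_mem hw0 hΓpos hwm, ?_⟩
  have hJ := (h.convexOn_logBarrier hη.le).map_centerMass_le hw0 hΓpos hwm
  have hcm : (Finset.range T).centerMass γ (logBarrier f P.η ∘ X)
      = (∑ t ∈ Finset.range T, γ t * logBarrier f P.η (X t)) / Γ := inv_mul_eq_div _ _
  rw [hcm, le_div_iff₀ hΓpos] at hJ
  simp only [mul_sub, Finset.sum_sub_distrib, ← Finset.sum_mul] at hsum
  rw [← hΓ] at hsum
  have h3e : 3 * e * Γ ≤ P.η / 10 * Γ := by gcongr; linarith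
  -- The initial distance contributes at most `(4 / 4.5) η`, the noise at most `η / 10`.
  refine le_of_mul_le_mul_right ?_ hΓpos
  norm_num at hΓlow
  have hD0 : 0 ≤ ‖x₀ - xs‖ ^ 2 := by positivity
  have hηΓ : 0 < P.η * Γ := by positivity
  linarith

/-- At the minimizer of the barrier the quotients `η / (-fⁱ)` are Lagrange multipliers, so that
the duality gap is `m η` and the slacks are bounded from below. -/
lemma IsConvexProblem.minimizer_bounds {M : Fin (m + 1) → ℝ} (h : IsConvexProblem L M R β f x₀)
    (hd : 1 ≤ d) (hm : 1 ≤ m) {η : ℝ} (hη : 0 < η) (hL : ∀ i, 0 < L i) (hR : 0 < R) (hβ : 0 < β)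
    (hηβ : η ≤ β / 2) (hxs : IsBarrierMinimizer f η xs) :
    (∀ y ∈ feasible f, f 0 xs - f 0 y ≤ η * m) ∧
      ∀ i : Fin m, η * β / (2 * m * maxConst L * R) ≤ -f i.succ xs := by
  have hLc := maxConst_pos hL
  have hxf := strictlyFeasible_subset hxs.1
  have hα : ∀ i : Fin m, 0 < -f i.succ xs := fun i ↦ by linarith [hxs.1 i]
  have hm1 : (1 : ℝ) ≤ m := by exact_mod_cast hm
  have hKKT : ∀ y, ⟪gradient (f 0) xs, y - xs⟫
      + η * ∑ i : Fin m, (-f i.succ xs)⁻¹ * ⟪gradient (f i.succ) xs, y - xs⟫ = 0 := fun y ↦ by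
    rw [← inner_barrierGrad, h.barrierGrad_eq_zero hxs, inner_zero_left]
  have hterm : ∀ (y : Space d) (i : Fin m), (-f i.succ xs)⁻¹ * ⟪gradient (f i.succ) xs, y - xs⟫
      ≤ 1 + (-f i.succ xs)⁻¹ * f i.succ y := fun y i ↦ by
    have h1 := h.inner_gradient_le i.succ hxf y
    have h2 := mul_le_mul_of_nonneg_left h1 (inv_pos.2 (hα i)).le
    have h3 : (-f i.succ xs)⁻¹ * -f i.succ xs = 1 := inv_mul_cancel₀ (hα i).ne'
    linarith
  constructor
  · intro y hy
    have h1 := h.inner_gradient_le 0 hxf y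
    have h2 : ∑ i : Fin m, (-f i.succ xs)⁻¹ * ⟪gradient (f i.succ) xs, y - xs⟫ ≤ m := by
      calc _ ≤ ∑ i : Fin m, (1 : ℝ) := Finset.sum_le_sum fun i _ ↦ (hterm y i).trans (by
            have := mul_nonneg (inv_pos.2 (hα i)).le (neg_nonneg.2 (hy i))
            linarith)
        _ = m := by simp
    have h3 := mul_le_mul_of_nonneg_left h2 hη.le
    linarith [hKKT y]
  · intro i
    have hLR := h.le_lipschitz_mul_diam hd hR hβ hL
    have h1 : ∑ j : Fin m, (-f j.succ xs)⁻¹ * ⟪gradient (f j.succ) xs, x₀ - xs⟫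
        ≤ m - (-f i.succ xs)⁻¹ * β := by
      calc _ ≤ ∑ j : Fin m, (1 - (-f j.succ xs)⁻¹ * β) :=
            Finset.sum_le_sum fun j _ ↦ (hterm x₀ j).trans (by
              have := mul_le_mul_of_nonneg_left (h.start j) (inv_pos.2 (hα j)).le
              linarith)
        _ = m - ∑ j : Fin m, (-f j.succ xs)⁻¹ * β := by
            rw [Finset.sum_sub_distrib]; simp
        _ ≤ _ := by
          have := Finset.single_le_sum (f := fun j : Fin m ↦ (-f j.succ xs)⁻¹ * β)
            (fun j _ ↦ mul_nonneg (inv_pos.2 (hα j)).le hβ.le) (Finset.mem_univ i)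
          linarith
    have h2 : ⟪gradient (f 0) xs, x₀ - xs⟫ ≤ maxConst L * R := by
      refine (real_inner_le_norm _ _).trans ?_
      gcongr
      · exact (h.norm_gradient_le hL 0 hxs.1).trans (le_maxConst L 0)
      · exact h.diam _ (strictlyFeasible_subset (h.start_mem hβ)) _ hxf
    have h3 : η * ((-f i.succ xs)⁻¹ * β) ≤ maxConst L * R + η * m := by
      have := mul_le_mul_of_nonneg_left h1 hη.le
      linarith [hKKT x₀]
    have h4 : maxConst L * R + η * m ≤ 2 * m * maxConst L * R := by
      have h5 : η * m ≤ maxConst L * R * m := by gcongr; linarith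
      have h6 : maxConst L * R ≤ maxConst L * R * m := le_mul_of_one_le_right (by positivity) hm1
      linarith
    rw [div_le_iff₀ (by positivity)]
    have h5 : η * β = η * ((-f i.succ xs)⁻¹ * β) * -f i.succ xs := by
      rw [mul_assoc, mul_right_comm, inv_mul_cancel₀ (hα i).ne', one_mul]
    rw [h5, mul_comm (-f i.succ xs)]
    exact mul_le_mul_of_nonneg_right (h3.trans h4) (hα i).le

/-- A point with small barrier gap is a good point. -/
lemma IsConvexProblem.isGoodPoint {M : Fin (m + 1) → ℝ} (h : IsConvexProblem L M R β f x₀)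
    (hd : 1 ≤ d) (hm : 1 ≤ m) {η βhat : ℝ} (hη : 0 < η) (hL : ∀ i, 0 < L i) (hR : 0 < R)
    (hβ : 0 < β) (hηβ : η ≤ β / 2) (hxs : IsBarrierMinimizer f η xs)
    (hβhat : ∀ i : Fin m, ∀ x ∈ feasible f, |f i.succ x| ≤ βhat) {x : Space d}
    (hx : x ∈ strictlyFeasible f) (hgap : logBarrier f η x - logBarrier f η xs ≤ η) :
    IsGoodPoint f η (accuracy m (maxConst L) R β βhat η) xs x := by
  have hLc := maxConst_pos hL
  have hm1 : (1 : ℝ) ≤ m := by exact_mod_cast hm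
  obtain ⟨h1, h2⟩ := h.minimizer_bounds hd hm hη hL hR hβ hηβ hxs
  refine ⟨hx, hgap, fun y hy ↦ ?_⟩
  have h3 : ∑ i : Fin m, (Real.log (-f i.succ x) - Real.log (-f i.succ xs))
      ≤ m * Real.log (2 * m * maxConst L * R * βhat / (η * β)) := by
    calc _ ≤ ∑ _i : Fin m, Real.log (2 * m * maxConst L * R * βhat / (η * β)) := by
          refine Finset.sum_le_sum fun i _ ↦ ?_
          have hα : 0 < -f i.succ x := by linarith [hx i]
          have hαs : 0 < -f i.succ xs := by linarith [hxs.1 i]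
          have h4 : -f i.succ x ≤ βhat :=
            (neg_le_abs _).trans (hβhat i x (strictlyFeasible_subset hx))
          have hβhat0 : 0 < βhat := hα.trans_le h4
          rw [← Real.log_div hα.ne' hαs.ne']
          refine Real.log_le_log (div_pos hα hαs) ?_
          calc -f i.succ x / -f i.succ xs
              ≤ βhat / (η * β / (2 * m * maxConst L * R)) := by gcongr; exact h2 i
            _ = _ := by field_simp
      _ = _ := by simp
  rw [Finset.sum_sub_distrib] at h3
  have h4 := mul_le_mul_of_nonneg_left h3 hη.le
  have h5 := h1 y hy
  rw [logBarrier, logBarrier] at hgap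
  rw [accuracy]
  linarith

end Convergence

/-! ### The measurements are accurate with high probability -/

section Measurability

variable {d m : ℕ} {Ξ Ω : Type*} [MeasurableSpace Ξ] {P : Alg d m Ξ}

lemma Alg.measurable_Fn (hF : ∀ i, Measurable (Function.uncurry (P.F i))) (i : Fin (m + 1)) :
    Measurable fun p : Space d × (ℕ → Ξ) ↦ P.Fn i p.1 p.2 := by
  refine (Finset.measurable_sum _ fun j _ ↦ (hF i).comp (measurable_fst.prodMk ?_)).div_const _
  exact (measurable_pi_apply j).comp measurable_snd

lemma Alg.measurable_Gn (hG : ∀ i, Measurable (Function.uncurry (P.G i))) (i : Fin (m + 1)) :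
    Measurable fun p : Space d × (ℕ → Ξ) ↦ P.Gn i p.1 p.2 := by
  refine (Finset.measurable_sum _ fun j _ ↦ (hG i).comp (measurable_fst.prodMk ?_)).const_smul
    (P.n : ℝ)⁻¹
  exact (measurable_pi_apply j).comp measurable_snd

lemma Alg.measurable_g (hF : ∀ i, Measurable (Function.uncurry (P.F i)))
    (hG : ∀ i, Measurable (Function.uncurry (P.G i))) :
    Measurable fun p : Space d × (ℕ → Ξ) ↦ P.g p.1 p.2 :=
  (measurable_Gn hG 0).add ((Finset.measurable_sum _ fun (i : Fin m) _ ↦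
    ((measurable_Fn hF i.succ).neg.inv).smul (measurable_Gn hG i.succ)).const_smul P.η)

lemma Alg.measurable_γ (hF : ∀ i, Measurable (Function.uncurry (P.F i)))
    (hG : ∀ i, Measurable (Function.uncurry (P.G i))) :
    Measurable fun p : Space d × (ℕ → Ξ) ↦ P.γ p.1 p.2 := by
  have hg := measurable_g hF hG
  have hα : ∀ i : Fin m, Measurable fun p : Space d × (ℕ → Ξ) ↦ P.αLow i p.1 p.2 := fun i ↦
    (measurable_Fn hF i.succ).neg.sub_const _
  have hθ : ∀ i : Fin m, Measurable fun p : Space d × (ℕ → Ξ) ↦ P.θHat i p.1 p.2 := fun i ↦ by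
    have h1 : Measurable fun p : Space d × (ℕ → Ξ) ↦ |⟪P.Gn i.succ p.1 p.2,
        ‖P.g p.1 p.2‖⁻¹ • P.g p.1 p.2⟫| :=
      ((measurable_Gn hG i.succ).inner (hg.norm.inv.smul hg)).abs
    exact (h1.add_const _).add_const _
  have hM2 : Measurable fun p : Space d × (ℕ → Ξ) ↦ P.M2Hat p.1 p.2 := by
    refine (Measurable.const_add ?_ _).add ?_
    · exact (Finset.measurable_sum _ fun i _ ↦ (hα i).const_div _).const_mul _
    · exact (Finset.measurable_sum _ fun i _ ↦ ((hθ i).pow_const 2).div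
        ((hα i).pow_const 2)).const_mul _
  refine Measurable.ite (hg (measurableSet_singleton 0)) (hM2.const_div 1) ?_
  refine Measurable.min ((Measurable.iInf fun i ↦ ?_).mul (hg.norm.const_div 1)) (hM2.const_div 1)
  exact (hα i).div (((hθ i).abs.const_mul 2).add ((hα i).mul_const _).sqrt)

/-- The σ-algebra generated by the samples drawn before the `k`-th sample of iteration `t`. -/
abbrev past (ξ : ℕ → ℕ → Ω → Ξ) (t k : ℕ) : MeasurableSpace Ω :=
  ⨆ p ∈ {p : ℕ × ℕ | p.1 < t ∨ p.1 = t ∧ p.2 < k},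
    MeasurableSpace.comap (ξ p.1 p.2) inferInstance

variable {ξ : ℕ → ℕ → Ω → Ξ}

lemma measurable_past {t k s j : ℕ} (h : s < t ∨ s = t ∧ j < k) :
    Measurable[past ξ t k] (ξ s j) := by
  refine Measurable.mono (comap_measurable (ξ s j)) ?_ le_rfl
  exact le_iSup₂_of_le (f := fun (p : ℕ × ℕ) (_ : p ∈ {p : ℕ × ℕ | p.1 < t ∨ p.1 = t ∧ p.2 < k}) ↦
    MeasurableSpace.comap (ξ p.1 p.2) inferInstance) (s, j) h le_rfl

lemma past_le [mΩ : MeasurableSpace Ω] (hξ : ∀ t j, Measurable (ξ t j)) (t k : ℕ) :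
    past ξ t k ≤ mΩ :=
  iSup₂_le fun p _ ↦ (hξ p.1 p.2).comap_le

lemma past_mono {t k t' k' : ℕ} (h : ∀ p : ℕ × ℕ, p.1 < t ∨ p.1 = t ∧ p.2 < k →
    p.1 < t' ∨ p.1 = t' ∧ p.2 < k') : past ξ t k ≤ past ξ t' k' :=
  biSup_mono fun p hp ↦ h p hp

lemma indep_past [MeasurableSpace Ω] {μ : Measure Ω} {ν : Measure Ξ} (h : IsIIDSample μ ν ξ)
    (t k : ℕ) :
    Indep (past ξ t k) (MeasurableSpace.comap (ξ t k) inferInstance) μ := by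
  have h1 := indep_iSup_of_disjoint (m := fun p : ℕ × ℕ ↦
    MeasurableSpace.comap (ξ p.1 p.2) inferInstance) (fun p ↦ (h.measurable p.1 p.2).comap_le)
    ((iIndepFun_iff_iIndep _ _ _).1 h.indep)
    (S := {p : ℕ × ℕ | p.1 < t ∨ p.1 = t ∧ p.2 < k}) (T := {(t, k)})
    (by rw [Set.disjoint_singleton_right]; simp)
  simpa [past] using h1

/-- The iterate at which the batch of iteration `t` is drawn depends on the previous batches
only. -/
lemma Alg.measurable_iter (hF : ∀ i, Measurable (Function.uncurry (P.F i)))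
    (hG : ∀ i, Measurable (Function.uncurry (P.G i))) (x₀ : Space d) (t : ℕ) :
    Measurable[past ξ t 0] fun ω ↦ P.iter x₀ (fun t j ↦ ξ t j ω) t := by
  induction t with
  | zero => exact measurable_const
  | succ t ih =>
    have h1 : Measurable[past ξ (t + 1) 0] fun ω ↦ P.iter x₀ (fun t j ↦ ξ t j ω) t :=
      ih.mono (past_mono fun p hp ↦ by omega) le_rfl
    have h2 : Measurable[past ξ (t + 1) 0] fun ω j ↦ ξ t j ω :=
      @measurable_pi_lambda _ _ _ (past ξ (t + 1) 0) _ _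
        fun j ↦ measurable_past (Or.inl (Nat.lt_succ_self t))
    have h3 : Measurable[past ξ (t + 1) 0] fun ω ↦
        (P.iter x₀ (fun t j ↦ ξ t j ω) t, fun j ↦ ξ t j ω) := h1.prodMk h2
    have h4 : Measurable fun p : Space d × (ℕ → Ξ) ↦ p.1 - P.γ p.1 p.2 • P.g p.1 p.2 :=
      measurable_fst.sub ((measurable_γ hF hG).smul (measurable_g hF hG))
    exact h4.comp h3

end Measurability

section Probability

variable {d m : ℕ} {Ξ Ω : Type*} [MeasurableSpace Ξ] [MeasurableSpace Ω] {P : Alg d m Ξ}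
  {f : Fin (m + 1) → Space d → ℝ} {L : Fin (m + 1) → ℝ} {R β : ℝ} {x₀ xs : Space d}
  {μ : Measure Ω} [IsProbabilityMeasure μ] {ν : Measure Ξ} [IsProbabilityMeasure ν]
  {ξ : ℕ → ℕ → Ω → Ξ}

lemma hasGaussianTail_of_real {E : Type*} [NormedAddCommGroup E] [MeasurableSpace E]
    [OpensMeasurableSpace E] {Y : Ξ → E} (hY : Measurable Y) {σ σ' : ℝ}
    (h : ∀ δ : ℝ, 0 < δ → δ < 1 → 1 - δ ≤ ν.real {ξ | ‖Y ξ‖ ≤ σ * √(Real.log (1 / δ))})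
    (hσ : σ ≤ σ') : HasGaussianTail ν Y σ' := by
  intro s hs
  have h1 := h (Real.exp (-s ^ 2)) (Real.exp_pos _) (by rw [Real.exp_lt_one_iff]; nlinarith)
  rw [one_div, ← Real.exp_neg, neg_neg, Real.log_exp, Real.sqrt_sq hs.le] at h1
  have hm : MeasurableSet {ξ | ‖Y ξ‖ ≤ σ * s} := measurableSet_le hY.norm measurable_const
  have h2 : ν.real {ξ | ‖Y ξ‖ ≤ σ * s}ᶜ ≤ Real.exp (-s ^ 2) := by
    rw [probReal_compl_eq_one_sub hm]; linarith
  refine (measure_mono fun x hx ↦ ?_).trans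
    ((ENNReal.le_ofReal_iff_toReal_le (measure_ne_top _ _) (Real.exp_pos _).le).2 h2)
  have hx : σ' * s < ‖Y x‖ := hx
  exact not_le.2 (lt_of_le_of_lt (by gcongr) hx)

/-- Concentration of the sum of the centered measurements of one batch. -/
lemma prob_sum_ge_le {E : Type*} [NormedAddCommGroup E] [InnerProductSpace ℝ E] [CompleteSpace E]
    [MeasurableSpace E] [BorelSpace E] [SecondCountableTopology E]
    (hF : ∀ i, Measurable (Function.uncurry (P.F i)))
    (hG : ∀ i, Measurable (Function.uncurry (P.G i))) (hξ : IsIIDSample μ ν ξ)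
    {s : Set (Space d)} (hs : MeasurableSet s) {Y : Space d → Ξ → E}
    (hY : Measurable (Function.uncurry Y)) (hint : ∀ x ∈ s, Integrable (Y x) ν)
    (hmean : ∀ x ∈ s, ∫ y, Y x y ∂ν = 0) {σ τ l : ℝ}
    (htail : ∀ x ∈ s, ∀ δ : ℝ, 0 < δ → δ < 1 →
      1 - δ ≤ ν.real {ξ | ‖Y x ξ‖ ≤ σ * √(Real.log (1 / δ))})
    {n : ℕ} (hn : 1 ≤ n) (hτ : 0 < τ) (hl : 0 < l) (hσ : σ / √n ≤ τ / √l) (t : ℕ) :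
    μ.real {ω | P.iter x₀ (fun t j ↦ ξ t j ω) t ∈ s ∧ 13 * n * τ ≤
      ‖∑ j ∈ Finset.range n, Y (P.iter x₀ (fun t j ↦ ξ t j ω) t) (ξ t j ω)‖}
      ≤ 2 * Real.exp (-(4 * l)) := by
  have hn' : (0 : ℝ) < √n := Real.sqrt_pos.2 (by exact_mod_cast hn)
  rw [div_le_iff₀' hn'] at hσ
  have h1 := measure_norm_sum_gt_le (μ := μ) (𝓕 := fun k ↦ past ξ t k)
    (past_le hξ.measurable t) (fun j k hjk ↦ past_mono fun p hp ↦ by omega)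
    (P.measurable_iter hF hG x₀ t) (fun k ↦ measurable_past (Or.inr ⟨rfl, Nat.lt_succ_self k⟩))
    (hξ.law t) (indep_past hξ t) hY hs hint hmean hn hτ hl
    (fun x hx ↦ hasGaussianTail_of_real (hY.comp measurable_prodMk_left) (htail x hx) hσ)
  exact ENNReal.toReal_le_of_le_ofReal (by positivity) h1

/-- In each iteration that takes place at a feasible point, the measurements are accurate up to
an event whose probability is small compared with `δ`. -/
lemma prob_not_isAccurate_le (h : IsConvexProblem L P.M R β f x₀)
    (hor : IsOracle ν f P.F P.G P.σ P.σg P.b) (hξ : IsIIDSample μ ν ξ) (hn : 1 ≤ P.n)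
    {ε : ℝ} (hε : 0 < ε) (hη : 0 < P.η) {l : ℝ} (hl : 0 < l)
    (hb : ∀ i, P.b i ≤ ε / 14 * P.η)
    (hσ : ∀ i : Fin m, P.σ i.succ / √P.n ≤ ε / 14 * P.η ^ 2 / √l)
    (hσg : ∀ i, P.σg i / √P.n ≤ ε / 14 * P.η / √l) (t : ℕ) :
    μ.real {ω | P.iter x₀ (fun t j ↦ ξ t j ω) t ∈ feasible f ∧
      ¬ P.IsAccurate f ε (P.iter x₀ (fun t j ↦ ξ t j ω) t) (fun j ↦ ξ t j ω)}
      ≤ (2 * m + 1) * (2 * Real.exp (-(4 * l))) := by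
  have hF := hor.measurable_value
  have hG := hor.measurable_grad
  have hs : MeasurableSet (feasible f) := h.isClosed_feasible.measurableSet
  have hn0 : (0 : ℝ) < P.n := by exact_mod_cast hn
  set X : Ω → Space d := fun ω ↦ P.iter x₀ (fun t j ↦ ξ t j ω) t with hX
  -- Of the admissible errors `ε η²` and `ε η`, the random fluctuation takes the share `13 / 14`;
  -- the bias of the gradients takes the rest.
  set badF : Fin m → Set Ω := fun i ↦ {ω | X ω ∈ feasible f ∧ 13 * P.n * (ε / 14 * P.η ^ 2) ≤
    ‖∑ j ∈ Finset.range P.n, (P.F i.succ (X ω) (ξ t j ω) - f i.succ (X ω))‖} with hbadF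
  set badG : Fin (m + 1) → Set Ω := fun i ↦ {ω | X ω ∈ feasible f ∧ 13 * P.n * (ε / 14 * P.η) ≤
    ‖∑ j ∈ Finset.range P.n, (P.G i (X ω) (ξ t j ω) - ∫ y, P.G i (X ω) y ∂ν)‖} with hbadG
  have hF1 : ∀ i, μ.real (badF i) ≤ 2 * Real.exp (-(4 * l)) := fun i ↦ by
    refine prob_sum_ge_le (Y := fun x y ↦ P.F i.succ x y - f i.succ x) hF hG hξ hs ?_ ?_ ?_ ?_ hn
      (by positivity) hl (hσ i) t
    · exact (hF i.succ).sub ((h.continuous i.succ).measurable.comp measurable_fst)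
    · exact fun x hx ↦ (hor.integrable_value i.succ x hx).sub (integrable_const _)
    · intro x hx
      rw [integral_sub (hor.integrable_value i.succ x hx) (integrable_const _),
        hor.unbiased_value i.succ x hx]
      simp
    · exact fun x hx ↦ hor.tail_value i.succ x hx
  have hG1 : ∀ i, μ.real (badG i) ≤ 2 * Real.exp (-(4 * l)) := fun i ↦ by
    refine prob_sum_ge_le (Y := fun x y ↦ P.G i x y - ∫ y, P.G i x y ∂ν) hF hG hξ hs ?_ ?_ ?_ ?_ hn
      (by positivity) hl (hσg i) t
    · exact (hG i).sub
        ((hG i).stronglyMeasurable.integral_prod_right'.measurable.comp measurable_fst)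
    · exact fun x hx ↦ (hor.integrable_grad i x hx).sub (integrable_const _)
    · intro x hx
      rw [integral_sub (hor.integrable_grad i x hx) (integrable_const _)]
      simp
    · exact fun x hx ↦ hor.tail_grad i x hx
  have hsub : {ω | X ω ∈ feasible f ∧ ¬ P.IsAccurate f ε (X ω) (fun j ↦ ξ t j ω)}
      ⊆ (⋃ i, badF i) ∪ ⋃ i, badG i := by
    rintro ω ⟨hω, hacc⟩
    by_contra hcon
    simp only [Set.mem_union, Set.mem_iUnion, not_or, not_exists] at hcon
    refine hacc ⟨fun i ↦ ?_, fun i ↦ ?_⟩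
    · have h1 : ‖∑ j ∈ Finset.range P.n, (P.F i.succ (X ω) (ξ t j ω) - f i.succ (X ω))‖
          < 13 * P.n * (ε / 14 * P.η ^ 2) := by
        by_contra! hc
        exact hcon.1 i ⟨hω, hc⟩
      have e : P.Fn i.succ (X ω) (fun j ↦ ξ t j ω) - f i.succ (X ω)
          = (∑ j ∈ Finset.range P.n, (P.F i.succ (X ω) (ξ t j ω) - f i.succ (X ω))) / P.n := by
        rw [Alg.Fn, Finset.sum_sub_distrib]
        simp only [Finset.sum_const, Finset.card_range, nsmul_eq_mul]
        field_simp
      rw [e, abs_div, abs_of_pos hn0, div_le_iff₀ hn0, ← Real.norm_eq_abs]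
      have : 0 ≤ ε * P.η ^ 2 * P.n := by positivity
      linarith
    · have h1 : ‖∑ j ∈ Finset.range P.n, (P.G i (X ω) (ξ t j ω) - ∫ y, P.G i (X ω) y ∂ν)‖
          < 13 * P.n * (ε / 14 * P.η) := by
        by_contra! hc
        exact hcon.2 i ⟨hω, hc⟩
      have e : P.Gn i (X ω) (fun j ↦ ξ t j ω) - gradient (f i) (X ω)
          = (P.n : ℝ)⁻¹ •
              (∑ j ∈ Finset.range P.n, (P.G i (X ω) (ξ t j ω) - ∫ y, P.G i (X ω) y ∂ν))
            + ((∫ y, P.G i (X ω) y ∂ν) - gradient (f i) (X ω)) := by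
        rw [Alg.Gn, Finset.sum_sub_distrib, smul_sub]
        simp only [Finset.sum_const, Finset.card_range, ← Nat.cast_smul_eq_nsmul ℝ]
        rw [smul_smul, inv_mul_cancel₀ hn0.ne', one_smul]
        abel
      rw [e]
      refine (norm_add_le _ _).trans ?_
      rw [norm_smul, norm_inv, Real.norm_of_nonneg hn0.le, inv_mul_eq_div]
      have h2 := (hor.bias_grad i (X ω) hω).trans (hb i)
      have h3 : ‖∑ j ∈ Finset.range P.n, (P.G i (X ω) (ξ t j ω) - ∫ y, P.G i (X ω) y ∂ν)‖ / P.n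
          ≤ 13 * (ε / 14 * P.η) := by
        rw [div_le_iff₀ hn0]
        linarith
      linarith
  calc _ ≤ μ.real ((⋃ i, badF i) ∪ ⋃ i, badG i) := measureReal_mono hsub
    _ ≤ (∑ i, μ.real (badF i)) + ∑ i, μ.real (badG i) :=
        (measureReal_union_le _ _).trans
          (add_le_add (measureReal_iUnion_fintype_le _) (measureReal_iUnion_fintype_le _))
    _ ≤ (∑ _i : Fin m, 2 * Real.exp (-(4 * l)))
          + ∑ _i : Fin (m + 1), 2 * Real.exp (-(4 * l)) :=
        add_le_add (Finset.sum_le_sum fun i _ ↦ hF1 i) (Finset.sum_le_sum fun i _ ↦ hG1 i)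
    _ = _ := by
        simp only [Finset.sum_const, Finset.card_univ, Fintype.card_fin, nsmul_eq_mul]
        push_cast
        ring

/-- Convergence with high probability when the noise of the averaged measurements is small. -/
lemma prob_isGoodPoint (h : IsConvexProblem L P.M R β f x₀) (hd : 1 ≤ d) (hm : 1 ≤ m)
    (hM : ∀ i, 0 < P.M i) (hL : ∀ i, 0 < L i) (hR : 0 < R) (hβ : 0 < β) {ρ ε βhat δhat : ℝ}
    (hη : 0 < P.η) (hηρ : P.η ≤ ρ) (hρβ : ρ ≤ β / 2)
    (hε : IsSmallNoise L P.M R P.η (cConst m (maxConst L) R β ρ) ε) (hε0 : 0 < ε)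
    (hβhat : ∀ i : Fin m, ∀ x ∈ feasible f, |f i.succ x| ≤ βhat)
    (hxs : IsBarrierMinimizer f P.η xs) (hor : IsOracle ν f P.F P.G P.σ P.σg P.b)
    (hσ0 : ∀ i, 0 ≤ P.σ i) (hσg0 : ∀ i, 0 ≤ P.σg i) (hb0 : ∀ i, 0 ≤ P.b i)
    (hb : ∀ i, P.b i ≤ ε / 14 * P.η) (hξ : IsIIDSample μ ν ξ) {T : ℕ} (hT : 1 ≤ T)
    (hn : 1 ≤ P.n) (hTC : ‖x₀ - xs‖ ^ 2 /
      (CConst m (maxConst L) (maxConst P.M) R β ρ P.η * P.η ^ 2) ≤ T)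
    (hδ0 : 0 < P.δ) (hδ2 : P.δ ≤ 1 / 2) (hδ : P.δ ≤ δhat / (m * T))
    (hσ : ∀ i : Fin m, P.σ i.succ / √P.n ≤ ε / 14 * P.η ^ 2 / √(Real.log (1 / P.δ)))
    (hσg : ∀ i, P.σg i / √P.n ≤ ε / 14 * P.η / √(Real.log (1 / P.δ))) :
    1 - δhat ≤ μ.real {ω | IsGoodPoint f P.η (accuracy m (maxConst L) R β βhat P.η) xs
      (P.average x₀ (fun t j ↦ ξ t j ω) T)} := by
  have hl : 0 < Real.log (1 / P.δ) := Real.log_pos (by rw [lt_div_iff₀ hδ0]; linarith)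
  have hsl : 0 < √(Real.log (1 / P.δ)) := Real.sqrt_pos.2 hl
  have hcor : P.HasSmallCorrections ε := by
    refine ⟨fun i ↦ ?_, fun i ↦ ?_, fun i ↦ ?_, fun i ↦ ?_⟩
    · have := hσ0 i.succ
      positivity
    · have h1 := (le_div_iff₀ hsl).1 (hσ i)
      have : 0 ≤ ε * P.η ^ 2 := by positivity
      linarith
    · have := hσg0 i.succ
      have := hb0 i.succ
      positivity
    · have h1 := (le_div_iff₀ hsl).1 (hσg i.succ)
      have h2 := hb i.succ
      have : 0 ≤ ε * P.η := by positivity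
      linarith
  set good := {ω | IsGoodPoint f P.η (accuracy m (maxConst L) R β βhat P.η) xs
      (P.average x₀ (fun t j ↦ ξ t j ω) T)} with hgood
  set bad : ℕ → Set Ω := fun t ↦ {ω | P.iter x₀ (fun t j ↦ ξ t j ω) t ∈ feasible f ∧
      ¬ P.IsAccurate f ε (P.iter x₀ (fun t j ↦ ξ t j ω) t) (fun j ↦ ξ t j ω)} with hbad
  have hcover : (Set.univ : Set Ω) ⊆ good ∪ ⋃ t ∈ Finset.range T, bad t := by
    intro ω _
    by_cases hω : ω ∈ ⋃ t ∈ Finset.range T, bad t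
    · exact Or.inr hω
    · left
      simp only [Set.mem_iUnion, Finset.mem_range, not_exists] at hω
      have hacc : ∀ t < T, P.iter x₀ (fun t j ↦ ξ t j ω) t ∈ feasible f →
          P.IsAccurate f ε (P.iter x₀ (fun t j ↦ ξ t j ω) t) (fun j ↦ ξ t j ω) :=
        fun t ht hf ↦ by
          by_contra hc
          exact hω t ht ⟨hf, hc⟩
      obtain ⟨h1, h2⟩ := h.average_gap_le hd hm hη hM hL hR hβ hηρ hρβ hε hcor hxs hT hTC hacc
      exact h.isGoodPoint hd hm hη hL hR hβ (hηρ.trans hρβ) hxs hβhat h1 h2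
  have hbadle : ∀ t ∈ Finset.range T, μ.real (bad t)
      ≤ (2 * m + 1) * (2 * Real.exp (-(4 * Real.log (1 / P.δ)))) := fun t _ ↦
    prob_not_isAccurate_le h hor hξ hn hε0 hη hl hb hσ hσg t
  have hexp : Real.exp (-(4 * Real.log (1 / P.δ))) = P.δ ^ 4 := by
    rw [one_div, Real.log_inv, mul_neg, neg_neg, show (4 : ℝ) = ((4 : ℕ) : ℝ) by norm_num,
      Real.exp_nat_mul, Real.exp_log hδ0]
  -- Since `δ ≤ 1 / 2`, three of the four powers of `δ` absorb the factor `2 (2 m + 1) ≤ 6 m`.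
  have hsum : μ.real (⋃ t ∈ Finset.range T, bad t) ≤ δhat := by
    have hm1 : (1 : ℝ) ≤ m := by exact_mod_cast hm
    have hT1 : (1 : ℝ) ≤ T := by exact_mod_cast hT
    have hδ' : P.δ * (m * T) ≤ δhat := (le_div_iff₀ (by positivity)).1 hδ
    have hδ3 : P.δ ^ 3 ≤ (1 / 2) ^ 3 := by gcongr
    calc _ ≤ ∑ t ∈ Finset.range T, μ.real (bad t) := measureReal_biUnion_finset_le _ _
      _ ≤ ∑ t ∈ Finset.range T, (2 * m + 1) * (2 * P.δ ^ 4) := by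
          rw [← hexp]; exact Finset.sum_le_sum hbadle
      _ = T * (2 * m + 1) * (2 * (P.δ * P.δ ^ 3)) := by
          rw [Finset.sum_const, Finset.card_range, nsmul_eq_mul]; ring
      _ ≤ T * (3 * m) * (2 * (P.δ * (1 / 2) ^ 3)) := by gcongr; linarith
      _ = 3 / 4 * (P.δ * (m * T)) := by ring
      _ ≤ δhat := by
          have : 0 ≤ P.δ * (m * T) := by positivity
          linarith
  have h1 : (1 : ℝ) ≤ μ.real good + μ.real (⋃ t ∈ Finset.range T, bad t) := by
    calc (1 : ℝ) = μ.real Set.univ := probReal_univ.symm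
      _ ≤ _ := (measureReal_mono hcover).trans (measureReal_union_le _ _)
  linarith

end Probability

/-! ### Uniform constants and oracle complexity -/

section Constants

variable {m : ℕ}

lemma cConst_anti {Lc R β ρ ρ' : ℝ} (hL : 0 < Lc) (hR : 0 < R) (hρ : ρ' ≤ ρ) (hρβ : ρ ≤ β) :
    cConst m Lc R β ρ ≤ cConst m Lc R β ρ' := by
  have : 0 ≤ β - ρ := by linarith
  rw [cConst, cConst]
  gcongr

lemma noiseFactor_anti {Lc c c' : ℝ} (hL : 0 < Lc) (hc : 0 < c) (h : c ≤ c') :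
    noiseFactor m Lc c' ≤ noiseFactor m Lc c := by
  rw [noiseFactor, noiseFactor]
  gcongr

/-- The admissible noise level depends on the constants of the problem only. -/
lemma exists_isSmallNoise {L M : Fin (m + 1) → ℝ} (hL : ∀ i, 0 < L i) (hM : ∀ i, 0 < M i)
    {R β c₀ : ℝ} (hR : 0 < R) (hβ : 0 < β) (hc₀ : 0 < c₀) :
    ∃ ε : ℝ, 0 < ε ∧ ∀ η c : ℝ, 0 < η → η ≤ β → c₀ ≤ c → IsSmallNoise L M R η c ε := by
  have hLc := maxConst_pos hL
  have key : ∀ (φ : ℝ → ℝ) (r : ℝ), Continuous φ → φ 0 < r →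
      ∀ᶠ ε in nhdsWithin (0 : ℝ) (Set.Ioi 0), φ ε < r := fun φ r hφ hr ↦
    ((hφ.tendsto 0).eventually_lt_const hr).filter_mono nhdsWithin_le_nhds
  set N := noiseFactor m (maxConst L) c₀ with hN
  have hN0 : 0 < N := noiseFactor_pos hLc hc₀
  have h1 := key (fun ε ↦ 2 * ε * β) (0.01 * (5 * c₀)) (by fun_prop)
    (by simp only [mul_zero, zero_mul]; positivity)
  have h2 : ∀ᶠ ε in nhdsWithin (0 : ℝ) (Set.Ioi 0), ∀ i,
      ε ^ 2 * β < 0.00009 * (5 * c₀) * M i :=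
    Filter.eventually_all.2 fun i ↦ key (fun ε ↦ ε ^ 2 * β) _ (by fun_prop) (by
      have := hM i
      simp only [ne_eq, OfNat.ofNat_ne_zero, not_false_eq_true, zero_pow, zero_mul]
      positivity)
  have h3 := key (fun ε ↦ 2 * ε * β) (0.01 * maxConst L) (by fun_prop)
    (by simp only [mul_zero, zero_mul]; positivity)
  have h4 := key (fun ε ↦ ε * β * N) (0.02 * maxConst L) (by fun_prop)
    (by simp only [zero_mul]; positivity)
  have h5 := key (fun ε ↦ ε * N * (8 * R + 1.02 * maxConst L * (1 + m / c₀) / M 0)) (1 / 30)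
    (by fun_prop) (by simp only [zero_mul]; positivity)
  obtain ⟨ε, ⟨⟨⟨⟨⟨h1, h2⟩, h3⟩, h4⟩, h5⟩, h0⟩⟩ :=
    ((((h1.and h2).and h3).and h4).and h5 |>.and self_mem_nhdsWithin).exists
  have h0 : 0 < ε := h0
  refine ⟨ε, h0, fun η c hη hηβ hc ↦ ?_⟩
  have hc0 : 0 < c := hc₀.trans_le hc
  have hNc := noiseFactor_anti (m := m) hLc hc₀ hc
  have hNc0 := noiseFactor_pos (m := m) hLc hc0
  have hM0 := hM 0
  refine ⟨h0.le, ?_, fun i ↦ ?_, ?_, ?_, ?_⟩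
  · calc 2 * ε * η ≤ 2 * ε * β := by gcongr
      _ ≤ 0.01 * (5 * c₀) := h1.le
      _ ≤ _ := by gcongr
  · have := hM i
    calc ε ^ 2 * η ≤ ε ^ 2 * β := by gcongr
      _ ≤ 0.00009 * (5 * c₀) * M i := (h2 i).le
      _ ≤ _ := by gcongr
  · exact le_trans (by gcongr) h3.le
  · exact le_trans (by gcongr) h4.le
  · exact le_trans (by gcongr) h5.le

/-- A positive lower bound for `C` that is uniform in `ρ` and `η`. -/
lemma exists_le_CConst {Lc Mc R β : ℝ} (hL : 0 < Lc) (hM : 0 < Mc) (hR : 0 < R) (hβ : 0 < β) :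
    ∃ C₀ : ℝ, 0 < C₀ ∧ ∀ η ρ : ℝ, 0 < η → η ≤ ρ → ρ ≤ β / 2 → C₀ ≤ CConst m Lc Mc R β ρ η := by
  set c₀ := cConst m Lc R β (β / 2) with hc₀
  set c₁ := cConst m Lc R β 0 with hc₁
  have hc₀0 : 0 < c₀ := cConst_pos hL hR (by linarith)
  have hmax : 0 < max (4 + 5 * Mc * c₁ * β / Lc ^ 2) (1 + √(Mc * c₁ * β / (4 * Lc ^ 2))) :=
    lt_max_of_lt_right (by positivity)
  refine ⟨c₀ / (2 * Lc ^ 2 * (1 + m / c₀)) * (1 / max (4 + 5 * Mc * c₁ * β / Lc ^ 2)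
    (1 + √(Mc * c₁ * β / (4 * Lc ^ 2)))), by positivity, fun η ρ hη hηρ hρ ↦ ?_⟩
  have h0 : c₀ ≤ cConst m Lc R β ρ := cConst_anti hL hR hρ (by linarith)
  have h1 : cConst m Lc R β ρ ≤ c₁ := cConst_anti hL hR (by linarith) (by linarith)
  have hηβ : η ≤ β := by linarith
  rw [CConst]
  set c := cConst m Lc R β ρ with hc
  have hc0 : 0 < c := hc₀0.trans_le h0
  have hc₁0 : 0 < c₁ := hc0.trans_le h1
  have hmax' : 0 < max (4 + 5 * Mc * c * η / Lc ^ 2) (1 + √(Mc * c * η / (4 * Lc ^ 2))) :=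
    lt_max_of_lt_right (by positivity)
  gcongr

lemma div_sqrt_le {σ A l η κ R : ℝ} {n : ℕ} (hl : 0 < l) (hη : 0 < η)
    (hR : 0 < R) (hA : 0 < A) (hσ : 0 ≤ σ) (hσA : σ * R ≤ κ * √A) (hn : A * l / η ^ 4 ≤ n) :
    σ / √n ≤ κ * (η ^ 2 / (R * √l)) := by
  have h1 : √A * √l / η ^ 2 ≤ √n := by
    rw [← Real.sqrt_mul hA.le]
    calc √(A * l) / η ^ 2 = √(A * l / η ^ 4) := by
          rw [Real.sqrt_div (by positivity), show η ^ 4 = (η ^ 2) ^ 2 by ring,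
            Real.sqrt_sq (by positivity)]
      _ ≤ √n := Real.sqrt_le_sqrt hn
  have hsl : 0 < √l := Real.sqrt_pos.2 hl
  have hsA : 0 < √A := Real.sqrt_pos.2 hA
  calc σ / √n ≤ σ / (√A * √l / η ^ 2) := by gcongr
    _ = σ * R * (η ^ 2 / (√A * R * √l)) := by field_simp
    _ ≤ κ * √A * (η ^ 2 / (√A * R * √l)) := by gcongr
    _ = _ := by field_simp

/-- The number of oracle calls. The constant `K₁` bounds `η² T`; the summand `2 β ^ 4` makes up for
rounding up in `n`, since `log (1 / δ)` is bounded from below. -/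
lemma oracle_calls_le {A β K₁ η δhat δ : ℝ} {T n : ℕ} (hA : 0 < A) (hβ : 0 < β)
    (hK₁ : 0 < K₁) (hη : 0 < η) (hηβ : η ≤ β) (hδhat : 0 < δhat) (hδhat1 : δhat < 1)
    (hm : 1 ≤ m) (hT : 1 ≤ T) (hTK : T ≤ K₁ / η ^ 2) (hδ : δ = min (1 / 2) (δhat / (m * T)))
    (hn : n = ⌈A * Real.log (1 / δ) / η ^ 4⌉₊) :
    (n : ℝ) * T ≤ (2 * (A + 2 * β ^ 4) * K₁ + 2 * m * K₁ + β + 1) *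
      Real.log ((2 * (A + 2 * β ^ 4) * K₁ + 2 * m * K₁ + β + 1) / (η * δhat)) / η ^ 6 := by
  have hm1 : (1 : ℝ) ≤ m := by exact_mod_cast hm
  have hT1 : (1 : ℝ) ≤ T := by exact_mod_cast hT
  have hδ0 : 0 < δ := by rw [hδ]; exact lt_min (by norm_num) (by positivity)
  have hδ2 : δ ≤ 1 / 2 := by rw [hδ]; exact min_le_left _ _
  have hl2 : 1 / 2 ≤ Real.log (1 / δ) := by
    calc (1 : ℝ) / 2 ≤ Real.log 2 := by linarith [Real.log_two_gt_d9]
      _ ≤ Real.log (1 / δ) := Real.log_le_log (by norm_num) (by rw [le_div_iff₀ hδ0]; linarith)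
  set l := Real.log (1 / δ) with hl
  set K := 2 * (A + 2 * β ^ 4) * K₁ + 2 * m * K₁ + β + 1 with hK
  have hK1 : 1 ≤ K := by
    have : 0 ≤ 2 * (A + 2 * β ^ 4) * K₁ + 2 * m * K₁ + β := by positivity
    linarith
  have hδinv : 1 / δ ≤ 2 * m * K₁ / (η ^ 2 * δhat) := by
    have h1 : δhat / (2 * (m * T)) ≤ δ := by
      rw [hδ]
      refine le_min ?_ ?_
      · rw [div_le_div_iff₀ (by positivity) (by norm_num)]
        have : 1 ≤ (m : ℝ) * T := one_le_mul_of_one_le_of_one_le hm1 hT1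
        linarith
      · have : 0 ≤ (m : ℝ) * T := by positivity
        exact div_le_div_of_nonneg_left hδhat.le (by positivity) (by linarith)
    calc 1 / δ ≤ 1 / (δhat / (2 * (m * T))) := by gcongr
      _ = 2 * m * T / δhat := by field_simp
      _ ≤ 2 * m * (K₁ / η ^ 2) / δhat := by gcongr
      _ = _ := by field_simp
  have hlle : l ≤ 2 * Real.log (K / (η * δhat)) := by
    calc l ≤ Real.log ((K / (η * δhat)) ^ 2) := by
          refine Real.log_le_log (by positivity) (hδinv.trans ?_)
          rw [div_pow, mul_pow]
          gcongr
          · have : 0 ≤ 2 * (A + 2 * β ^ 4) * K₁ := by positivity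
            calc 2 * m * K₁ ≤ K := by linarith
              _ ≤ K ^ 2 := le_self_pow₀ hK1 (by norm_num)
          · exact pow_le_of_le_one hδhat.le hδhat1.le (by norm_num)
      _ = _ := by rw [Real.log_pow]; norm_num
  have hn' : (n : ℝ) ≤ (A + 2 * β ^ 4) * l / η ^ 4 := by
    have h1 : (n : ℝ) < A * l / η ^ 4 + 1 := by
      rw [hn]
      exact Nat.ceil_lt_add_one (by positivity)
    have h2 : 1 ≤ 2 * β ^ 4 * l / η ^ 4 := by
      rw [le_div_iff₀ (by positivity)]
      have h3 : η ^ 4 ≤ β ^ 4 := by gcongr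
      nlinarith [pow_pos hβ 4]
    calc (n : ℝ) ≤ A * l / η ^ 4 + 2 * β ^ 4 * l / η ^ 4 := by linarith
      _ = _ := by ring
  have hlog0 : 0 ≤ Real.log (K / (η * δhat)) := by linarith
  calc (n : ℝ) * T ≤ (A + 2 * β ^ 4) * l / η ^ 4 * (K₁ / η ^ 2) := by gcongr
    _ = (A + 2 * β ^ 4) * K₁ * l / η ^ 6 := by field_simp
    _ ≤ (A + 2 * β ^ 4) * K₁ * (2 * Real.log (K / (η * δhat))) / η ^ 6 := by gcongr
    _ = (2 * (A + 2 * β ^ 4) * K₁) * Real.log (K / (η * δhat)) / η ^ 6 := by ring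
    _ ≤ _ := by
        gcongr
        have : 0 ≤ 2 * m * K₁ := by positivity
        linarith

end Constants

end LBSGD

end

theorem theorem3 {m : ℕ} (hm : 1 ≤ m) (L M : Fin (m + 1) → ℝ)
    (hL : ∀ i, 0 < L i) (hM : ∀ i, 0 < M i) (R β : ℝ) (hR : 0 < R) (hβ : 0 < β) :
    ∃ κ : ℝ, 0 < κ ∧
    ∀ σ σg : Fin (m + 1) → ℝ, (∀ i, 0 ≤ σ i) → (∀ i, 0 ≤ σg i) →
    ∃ A K : ℝ, 0 < A ∧ 0 < K ∧
    ∀ (d : ℕ) (f : Fin (m + 1) → LBSGD.Space d → ℝ) (x₀ xs : LBSGD.Space d)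
      (η ρ βhat δhat : ℝ) (b : Fin (m + 1) → ℝ)
      (Ω : Type*) [MeasurableSpace Ω] (μ : Measure Ω) [IsProbabilityMeasure μ]
      (Ξ : Type*) [MeasurableSpace Ξ] (ν : Measure Ξ) [IsProbabilityMeasure ν]
      (F : Fin (m + 1) → LBSGD.Space d → Ξ → ℝ)
      (G : Fin (m + 1) → LBSGD.Space d → Ξ → LBSGD.Space d)
      (ξ : ℕ → ℕ → Ω → Ξ),
      1 ≤ d →
      LBSGD.IsConvexProblem L M R β f x₀ →
      0 < βhat → (∀ i : Fin m, ∀ x ∈ LBSGD.feasible f, |f i.succ x| ≤ βhat) →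
      0 < η → η ≤ ρ → ρ ≤ β / 2 →
      LBSGD.IsBarrierMinimizer f η xs →
      LBSGD.IsOracle ν f F G σ σg b →
      (∀ i, 0 ≤ b i) → (∀ i, b i ≤ κ * (η / R)) →
      LBSGD.IsIIDSample μ ν ξ →
      0 < δhat → δhat < 1 →
      -- convergence for all sufficiently small noise levels of the averaged measurements
      (∀ (T n : ℕ) (δ : ℝ), 1 ≤ T → 1 ≤ n →
        ‖x₀ - xs‖ ^ 2 /
          (LBSGD.CConst m (LBSGD.maxConst L) (LBSGD.maxConst M) R β ρ η * η ^ 2) ≤ T →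
        0 < δ → δ ≤ 1 / 2 → δ ≤ δhat / (m * T) →
        (∀ i : Fin m, σ i.succ / √n ≤ κ * (η ^ 2 / (R * √(Real.log (1 / δ))))) →
        (∀ i, σg i / √n ≤ κ * (η / (R * √(Real.log (1 / δ))))) →
        1 - δhat ≤ μ.real {ω | LBSGD.IsGoodPoint f η
          (LBSGD.accuracy m (LBSGD.maxConst L) R β βhat η) xs
          (LBSGD.Alg.average ⟨F, G, M, σ, σg, b, η, δ, n⟩ x₀ (fun t j => ξ t j ω) T)}) ∧
      -- oracle complexity for fixed noise parameters
      (∀ (T n : ℕ) (δ : ℝ),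
        T = max 1 ⌈‖x₀ - xs‖ ^ 2 /
          (LBSGD.CConst m (LBSGD.maxConst L) (LBSGD.maxConst M) R β ρ η * η ^ 2)⌉₊ →
        δ = min (1 / 2) (δhat / (m * T)) →
        n = ⌈A * Real.log (1 / δ) / η ^ 4⌉₊ →
        (n : ℝ) * T ≤ K * Real.log (K / (η * δhat)) / η ^ 6 ∧
        1 - δhat ≤ μ.real {ω | LBSGD.IsGoodPoint f η
          (LBSGD.accuracy m (LBSGD.maxConst L) R β βhat η) xs
          (LBSGD.Alg.average ⟨F, G, M, σ, σg, b, η, δ, n⟩ x₀ (fun t j => ξ t j ω) T)}) := by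
  have hLc : 0 < LBSGD.maxConst L := LBSGD.maxConst_pos hL
  have hMc : 0 < LBSGD.maxConst M := LBSGD.maxConst_pos hM
  have hc₀ : 0 < LBSGD.cConst m (LBSGD.maxConst L) R β (β / 2) :=
    LBSGD.cConst_pos hLc hR (by linarith)
  obtain ⟨ε, hε0, hε⟩ := LBSGD.exists_isSmallNoise hL hM hR hβ hc₀
  obtain ⟨C₀, hC₀, hC⟩ := LBSGD.exists_le_CConst (m := m) hLc hMc hR hβ
  have hκ : 0 < ε * R / 14 := by positivity
  refine ⟨ε * R / 14, hκ, fun σ σg hσ0 hσg0 ↦ ?_⟩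
  have hσmax := LBSGD.le_maxConst σ
  have hσgmax := LBSGD.le_maxConst σg
  have hσm0 : 0 ≤ LBSGD.maxConst σ := (hσ0 0).trans (hσmax 0)
  have hσgm0 : 0 ≤ LBSGD.maxConst σg := (hσg0 0).trans (hσgmax 0)
  -- `A` is chosen such that `σ i * R ≤ κ √A` and `σg i * η * R ≤ κ √A`; the factor `η ≤ β` in the
  -- latter reflects that the gradients only have to be accurate to order `η`, not `η²`.
  set s := R / (ε * R / 14) * (LBSGD.maxConst σ + LBSGD.maxConst σg * β) with hs
  set A := s ^ 2 + 1 with hA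
  have hA0 : 0 < A := by positivity
  have hs0 : 0 ≤ s := by positivity
  have hsA : s ≤ √A := Real.le_sqrt_of_sq_le (by linarith)
  have hAκ : (LBSGD.maxConst σ + LBSGD.maxConst σg * β) * R ≤ ε * R / 14 * √A := by
    calc _ = ε * R / 14 * s := by rw [hs]; field_simp
      _ ≤ _ := by gcongr
  set K₁ := β ^ 2 + R ^ 2 / C₀ with hK₁
  have hK₁0 : 0 < K₁ := by positivity
  refine ⟨A, 2 * (A + 2 * β ^ 4) * K₁ + 2 * m * K₁ + β + 1, hA0, by positivity, ?_⟩
  intro d f x₀ xs η ρ βhat δhat b Ω _ μ _ Ξ _ ν _ F G ξ hd h hβhat0 hβhat hη hηρ hρβ hxs hor hb0 hb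
    hξ hδhat hδhat1
  have hηβ : η ≤ β := by linarith
  have hsmall : LBSGD.IsSmallNoise L M R η (LBSGD.cConst m (LBSGD.maxConst L) R β ρ) ε :=
    hε η _ hη hηβ (LBSGD.cConst_anti hLc hR hρβ (by linarith))
  have part1 : ∀ (T n : ℕ) (δ : ℝ), 1 ≤ T → 1 ≤ n →
        ‖x₀ - xs‖ ^ 2 /
          (LBSGD.CConst m (LBSGD.maxConst L) (LBSGD.maxConst M) R β ρ η * η ^ 2) ≤ T →
        0 < δ → δ ≤ 1 / 2 → δ ≤ δhat / (m * T) →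
        (∀ i : Fin m, σ i.succ / √n ≤ ε * R / 14 * (η ^ 2 / (R * √(Real.log (1 / δ))))) →
        (∀ i, σg i / √n ≤ ε * R / 14 * (η / (R * √(Real.log (1 / δ))))) →
        1 - δhat ≤ μ.real {ω | LBSGD.IsGoodPoint f η
          (LBSGD.accuracy m (LBSGD.maxConst L) R β βhat η) xs
          (LBSGD.Alg.average ⟨F, G, M, σ, σg, b, η, δ, n⟩ x₀ (fun t j => ξ t j ω) T)} := by
    intro T n δ hT hn hTC hδ0 hδ2 hδ hσ hσg
    have hl : 0 < √(Real.log (1 / δ)) :=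
      Real.sqrt_pos.2 (Real.log_pos (by rw [lt_div_iff₀ hδ0]; linarith))
    refine LBSGD.prob_isGoodPoint (P := ⟨F, G, M, σ, σg, b, η, δ, n⟩) h hd hm hM hL hR hβ hη hηρ hρβ
      hsmall hε0 hβhat hxs hor hσ0 hσg0 hb0 (fun i ↦ (hb i).trans_eq ?_) hξ hT hn hTC hδ0 hδ2 hδ
      (fun i ↦ (hσ i).trans_eq ?_) (fun i ↦ (hσg i).trans_eq ?_)
    all_goals field_simp
  refine ⟨part1, fun T n δ hT hδ hn ↦ ?_⟩
  have hm1 : (1 : ℝ) ≤ m := by exact_mod_cast hm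
  have hT1 : 1 ≤ T := hT ▸ le_max_left _ _
  have hT1' : (1 : ℝ) ≤ T := by exact_mod_cast hT1
  have hδ0 : 0 < δ := by rw [hδ]; exact lt_min (by norm_num) (by positivity)
  have hδ2 : δ ≤ 1 / 2 := hδ ▸ min_le_left _ _
  have hl : 0 < Real.log (1 / δ) := Real.log_pos (by rw [lt_div_iff₀ hδ0]; linarith)
  have hn1 : 1 ≤ n := by
    rw [hn]
    exact Nat.ceil_pos.2 (by positivity)
  have hnA : A * Real.log (1 / δ) / η ^ 4 ≤ n := by rw [hn]; exact Nat.le_ceil _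
  have hCη := hC η ρ hη hηρ hρβ
  set C := LBSGD.CConst m (LBSGD.maxConst L) (LBSGD.maxConst M) R β ρ η with hCdef
  have hC0 : 0 < C := hC₀.trans_le hCη
  have hD : ‖x₀ - xs‖ ≤ R := h.diam x₀ (fun i ↦ (h.start i).trans (by linarith)) xs
    fun i ↦ (hxs.1 i).le
  have hTK : (T : ℝ) ≤ K₁ / η ^ 2 := by
    have h1 : (T : ℝ) ≤ 1 + ‖x₀ - xs‖ ^ 2 / (C * η ^ 2) := by
      rw [hT, Nat.cast_max, Nat.cast_one]
      refine max_le (by linarith [show 0 ≤ ‖x₀ - xs‖ ^ 2 / (C * η ^ 2) by positivity]) ?_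
      linarith [Nat.ceil_lt_add_one (show 0 ≤ ‖x₀ - xs‖ ^ 2 / (C * η ^ 2) by positivity)]
    calc (T : ℝ) ≤ 1 + ‖x₀ - xs‖ ^ 2 / (C * η ^ 2) := h1
      _ ≤ β ^ 2 / η ^ 2 + R ^ 2 / (C₀ * η ^ 2) := by
          refine add_le_add ?_ (by gcongr)
          rw [le_div_iff₀ (by positivity), one_mul]
          gcongr
      _ = _ := by rw [hK₁]; field_simp
  refine ⟨LBSGD.oracle_calls_le hA0 hβ hK₁0 hη hηβ hδhat hδhat1 hm hT1 hTK hδ hn, ?_⟩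
  refine part1 T n δ hT1 hn1 ?_ hδ0 hδ2 (hδ ▸ min_le_right _ _) (fun i ↦ ?_) (fun i ↦ ?_)
  · refine (Nat.le_ceil _).trans ?_
    exact_mod_cast (le_max_right _ _).trans_eq hT.symm
  · refine LBSGD.div_sqrt_le hl hη hR hA0 (hσ0 _) (le_trans ?_ hAκ) hnA
    have := hσmax i.succ
    gcongr
    linarith [mul_nonneg hσgm0 hβ.le]
  · have h1 : σg i * η / √n ≤ ε * R / 14 * (η ^ 2 / (R * √(Real.log (1 / δ)))) := by
      refine LBSGD.div_sqrt_le hl hη hR hA0 (mul_nonneg (hσg0 i) hη.le) (le_trans ?_ hAκ) hnA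
      have : σg i * η ≤ LBSGD.maxConst σg * β := by
        have := hσgmax i
        gcongr
      gcongr
      linarith
    refine le_of_mul_le_mul_right ?_ hη
    calc σg i / √n * η = σg i * η / √n := by ring
      _ ≤ _ := h1
      _ = _ := by ring
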